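/- Let $k\ge 2$, $A=\{1,\dots,k\}$, and let $M=(M(i,j))_{i,j\in A}$ be a matrix with coefficients in $\{0,1\}$ such that for some $p\ge 1$ all coefficients of $M^p$ are strictly positive. Let $\mathbb X=\{x\in A^{\mathbb Z}: M(x_n,x_{n+1})=1 \text{ for all } n\in\mathbb Z\}$ and $\mathbb X^+=\{x\in A^{\mathbb N}: M(x_n,x_{n+1})=1\text{ for all } n\ge 0\}$ (with $\mathbb N=\{0,1,2,\dots\}$), with the topologies induced by the product topologies, and denote by $T$ the shift $(Tx)_n=x_{n+1}$ on either space. A function $f:\mathbb X\to\mathbb R$ is Hölder continuous if there are $C>0$ and $\alpha\in(0,1)$ with $|f(x)-f(y)|\le C\alpha^{\omega(x,y)}$ for all $x\ne y$, where $\omega(x,y)=\min\{j\ge 0: x_j\neq y_j\text{ or }x_{-j}\ne y_{-j}\}$; Hölder continuity on $\mathbb X^+$ is defined in the same way with $\omega(x,y)=\min\{j\ge 0:x_j\ne y_j\}$. A function $f:\mathbb X\to\mathbb R$ is a coboundary if there is a Hölder continuous $g:\mathbb X\to\mathbb R$ with $f(x)=g(Tx)-g(x)$ for all $x\in\mathbb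 X$. Let $\psi:\mathbb X^+\to\mathbb R$ be Hölder continuous and normalized, i.e. $\mathcal L_\psi 1=1$, where $\mathcal L_\psi g(z)=\sum_{y\in\mathbb X^+:\,Ty=z}e^{-\psi(y)}g(y)$. Let $\nu$ be the Gibbs measure on $\mathbb X$ associated with $\psi$: the $T$-invariant Borel probability measure on $\mathbb X$ whose image $\nu^+$ under the natural projection $\mathbb X\to\mathbb X^+$ satisfies $\nu^+(\mathcal L_\psi g)=\nu^+(g)$ for all continuous $g:\mathbb X^+\to\mathbb R$. For $f:\mathbb X\to\mathbb R$, $t\in\mathbb R$, $x\in\mathbb X$ put $S_nf=\sum_{j=0}^{n-1}f\circ T^j$ and $\tau_t^f(x)=\inf\{j\ge 1: t+S_jf(x)<0\}$ (with $\inf\emptyset=\infty$). Theorem. Let $f:\mathbb X\to\mathbb R$ be Hölder continuous with $\nu(f)=\int_{\mathbb X} f\,d\nu=0$, and assume that $f$ is not a coboundary. Then there exists a unique Radon measure $\mu^f$ on $\mathbb X\times\mathbb R$ such that for every continuous compactly supported $\varphi:\mathbb X\times\mathbb R\to\mathbb R$, $$\lim_{n\to\infty}\int_{\mathbb X\times\mathbb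 R}\varphi(x,t)\,S_nf(x)\,\mathbf 1_{\{\tau_t^f(x)>n\}}\,\nu(dx)\,dt=\int_{\mathbb X\times\mathbb R}\varphi(x,t)\,\mu^f(dx,dt).$$ Moreover, for every continuous compactly supported $\varphi:\mathbb X\times\mathbb R\to\mathbb R$, $$\int_{\mathbb X\times\mathbb R}\varphi(x,t)\,\mu^f(dx,dt)=\int_{\mathbb X\times\mathbb R}\varphi\bigl(T^{-1}x,\;t-f(T^{-1}x)\bigr)\,\mathbf 1_{\{t\ge 0\}}\,\mu^f(dx,dt).$$ -/

import Mathlib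

open MeasureTheory Filter Topology

noncomputable section

namespace SFT

variable {k : ℕ}

/-- A transition matrix on the alphabet `Fin k`: a matrix with coefficients in `{0, 1}`, one power
`M ^ p` (`p ≥ 1`) of which has only positive coefficients. -/
structure IsTransitionMatrix (M : Matrix (Fin k) (Fin k) ℕ) : Prop where
  zero_or_one : ∀ i j, M i j = 0 ∨ M i j = 1
  exists_pow_pos : ∃ p : ℕ, 1 ≤ p ∧ ∀ i j, 0 < (M ^ p) i j

/-- The two-sided subshift of finite type `𝕏 ⊆ A^ℤ`, `A = Fin k`. As a subtype of the product it
carries the topology induced by the product topology, and its Borel `σ`-algebra. -/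
def TwoSided (M : Matrix (Fin k) (Fin k) ℕ) : Set (ℤ → Fin k) :=
  {x | ∀ n : ℤ, M (x n) (x (n + 1)) = 1}

/-- The one-sided subshift of finite type `𝕏⁺ ⊆ A^ℕ`. -/
def OneSided (M : Matrix (Fin k) (Fin k) ℕ) : Set (ℕ → Fin k) :=
  {x | ∀ n : ℕ, M (x n) (x (n + 1)) = 1}

/-- The shift `(T x)_n = x_{n+1}` on `𝕏`, with inverse `(T⁻¹ x)_n = x_{n-1}`. -/
def shift (M : Matrix (Fin k) (Fin k) ℕ) : TwoSided M ≃ₜ TwoSided M where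
  toFun x := ⟨fun n => x.1 (n + 1), fun n => x.2 (n + 1)⟩
  invFun x := ⟨fun n => x.1 (n - 1), fun n => by
    have h := x.2 (n - 1)
    rw [sub_add_cancel] at h
    show M (x.1 (n - 1)) (x.1 (n + 1 - 1)) = 1
    rwa [add_sub_cancel_right]⟩
  left_inv x := by ext n; simp
  right_inv x := by ext n; simp
  continuous_toFun := by
    refine Continuous.subtype_mk (continuous_pi fun n : ℤ => ?_) _
    exact (continuous_apply (n + 1)).comp continuous_subtype_val
  continuous_invFun := by
    refine Continuous.subtype_mk (continuous_pi fun n : ℤ => ?_) _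
    exact (continuous_apply (n - 1)).comp continuous_subtype_val

/-- The one-sided shift `(x₀, x₁, x₂, …) ↦ (x₁, x₂, x₃, …)` on `𝕏⁺`. -/
def shiftPlus (M : Matrix (Fin k) (Fin k) ℕ) (x : OneSided M) : OneSided M :=
  ⟨fun n => x.1 (n + 1), fun n => x.2 (n + 1)⟩

/-- The natural projection `𝕏 → 𝕏⁺` that forgets the coordinates of negative index. -/
def future (M : Matrix (Fin k) (Fin k) ℕ) (x : TwoSided M) : OneSided M :=
  ⟨fun n => x.1 (n : ℤ), fun n => by exact_mod_cast x.2 (n : ℤ)⟩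

/-- `ω(x, y) = min {j ≥ 0 : x_j ≠ y_j or x_{-j} ≠ y_{-j}}`, for `x ≠ y` in `𝕏`. -/
def sep {M : Matrix (Fin k) (Fin k) ℕ} (x y : TwoSided M) : ℕ :=
  sInf {j : ℕ | x.1 (j : ℤ) ≠ y.1 (j : ℤ) ∨ x.1 (-(j : ℤ)) ≠ y.1 (-(j : ℤ))}

/-- `ω(x, y) = min {j ≥ 0 : x_j ≠ y_j}`, for `x ≠ y` in `𝕏⁺`. -/
def sepPlus {M : Matrix (Fin k) (Fin k) ℕ} (x y : OneSided M) : ℕ :=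
  sInf {j : ℕ | x.1 j ≠ y.1 j}

/-- Hölder continuity on `𝕏`: `|f x - f y| ≤ C α ^ ω(x, y)` for some `C > 0` and `α ∈ (0, 1)`.
For `x = y` the condition is void, since `ω(x, x) = ∞`. -/
def IsHolder {M : Matrix (Fin k) (Fin k) ℕ} (f : TwoSided M → ℝ) : Prop :=
  ∃ C α : ℝ, 0 < C ∧ 0 < α ∧ α < 1 ∧ ∀ x y, x ≠ y → |f x - f y| ≤ C * α ^ sep x y

/-- Hölder continuity on `𝕏⁺`. -/
def IsHolderPlus {M : Matrix (Fin k) (Fin k) ℕ} (f : OneSided M → ℝ) : Prop :=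
  ∃ C α : ℝ, 0 < C ∧ 0 < α ∧ α < 1 ∧ ∀ x y, x ≠ y → |f x - f y| ≤ C * α ^ sepPlus x y

/-- `f` is a coboundary: `f = g ∘ T - g` everywhere, for a Hölder continuous `g`. -/
def IsCoboundary {M : Matrix (Fin k) (Fin k) ℕ} (f : TwoSided M → ℝ) : Prop :=
  ∃ g : TwoSided M → ℝ, IsHolder g ∧ ∀ x, f x = g (shift M x) - g x

/-- A point of `𝕏⁺` has finitely many preimages under the shift, so that the sum which defines the
Ruelle operator is a finite one. -/
theorem finite_preimages {M : Matrix (Fin k) (Fin k) ℕ} (z : OneSided M) :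
    {y : OneSided M | shiftPlus M y = z}.Finite := by
  refine Set.Finite.of_finite_image (f := fun y : OneSided M => y.1 0) (Set.toFinite _) ?_
  intro y hy y' hy' h
  have e : shiftPlus M y = shiftPlus M y' := hy.trans hy'.symm
  ext n
  cases n with
  | zero => exact congrArg Fin.val h
  | succ n => exact congrArg Fin.val (congrFun (congrArg Subtype.val e) n)

/-- The Ruelle operator `(𝓛_ψ g)(z) = ∑_{y : T y = z} exp (-ψ y) g y` on functions on `𝕏⁺`. -/
def ruelle {M : Matrix (Fin k) (Fin k) ℕ} (ψ g : OneSided M → ℝ) (z : OneSided M) : ℝ :=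
  ∑ᶠ y ∈ {y : OneSided M | shiftPlus M y = z}, Real.exp (-ψ y) * g y

/-- `ψ` is normalized: `𝓛_ψ 1 = 1`. -/
def IsNormalized {M : Matrix (Fin k) (Fin k) ℕ} (ψ : OneSided M → ℝ) : Prop :=
  ∀ z, ruelle ψ (fun _ => 1) z = 1

/-- The one-sided Gibbs measure `ν⁺` of a normalized potential `ψ`: the Borel probability measure
on `𝕏⁺` that is invariant under the Ruelle operator. -/
structure IsGibbsPlus {M : Matrix (Fin k) (Fin k) ℕ} (ψ : OneSided M → ℝ)
    (ν : Measure (OneSided M)) : Prop where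
  isProbabilityMeasure : IsProbabilityMeasure ν
  integral_ruelle : ∀ g : C(OneSided M, ℝ), ∫ z, ruelle ψ g z ∂ν = ∫ z, g z ∂ν

/-- The Gibbs measure `ν` of a normalized potential `ψ` on `𝕏`: the shift-invariant Borel
probability measure whose image under the projection `𝕏 → 𝕏⁺` is the one-sided Gibbs measure. -/
structure IsGibbs {M : Matrix (Fin k) (Fin k) ℕ} (ψ : OneSided M → ℝ)
    (ν : Measure (TwoSided M)) : Prop where
  isProbabilityMeasure : IsProbabilityMeasure ν
  measurePreserving : MeasurePreserving (shift M) ν ν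
  map_future : IsGibbsPlus ψ (ν.map (future M))

/-- The exit time `τ_t^f(x) = inf {j ≥ 1 : t + S_j f(x) < 0}`, equal to `∞` if there is no such
`j`; here `S_j f = f + f ∘ T + ⋯ + f ∘ T^{j-1}` is the Birkhoff sum. -/
def exitTime {M : Matrix (Fin k) (Fin k) ℕ} (f : TwoSided M → ℝ) (t : ℝ) (x : TwoSided M) : ℕ∞ :=
  sInf ((fun j : ℕ => (j : ℕ∞)) '' {j : ℕ | 1 ≤ j ∧ t + birkhoffSum (shift M) f j x < 0})

/-- `μ` is a Radon measure on `𝕏 × ℝ` with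
`∫ φ(x, t) S_n f(x) 1_{τ_t^f(x) > n} ν(dx) dt → ∫ φ dμ` for every continuous compactly
supported `φ`. -/
def IsHarmonicMeasure {M : Matrix (Fin k) (Fin k) ℕ} (ν : Measure (TwoSided M))
    (f : TwoSided M → ℝ) (μ : Measure (TwoSided M × ℝ)) : Prop :=
  μ.Regular ∧ ∀ φ : TwoSided M × ℝ → ℝ, Continuous φ → HasCompactSupport φ →
    Tendsto (fun n : ℕ => ∫ p : TwoSided M × ℝ,
        φ p * birkhoffSum (shift M) f n p.1 *
          {q : TwoSided M × ℝ | (n : ℕ∞) < exitTime f q.2 q.1}.indicator (fun _ => (1 : ℝ)) p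
        ∂(ν.prod volume))
      atTop (𝓝 (∫ p, φ p ∂μ))

end SFT

end

/-!
Write `m_n(x) = max_{1 ≤ i ≤ n} (-S_i f(x))`. The condition `τ_t^f(x) > n` says that `t ≥ m_n(x)`,
so integrating in `t` first turns the sequence of the theorem into `b_n = ∫ Φ(x, m_n(x)) S_n f(x)
ν(dx)`, where `Φ(x, s) = ∫_s^∞ φ(x, t) dt` (`integral_mul_weight`). Convergence is proved by
telescoping. With `B_n = Φ(·, m_n)`, `Y_0 = B_0` and `Y_n = B_n - B_{n-1}` for `n ≥ 1`,

  `b_{n+1} - b_n = ∫ Y_{n+1} S_{n+1} f dν + ∑_{j ≤ n} ∫ Y_j · f ∘ T^n dν`.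

The function `Y_j` vanishes unless a new maximum is attained at time `j` and the previous one is
still below the end of the support of `φ`, that is, for a suitable `K`, unless the Birkhoff sums
have stayed above `-K` up to time `j` and the `j`-th one is bounded by `K`. The probabilities `p_j`
of these events are summable (`summable_confined`): `f` not being a coboundary, the Birkhoff sums
take arbitrarily negative values (`isCoboundary_of_birkhoffSum_le`), so by mixing each visit to
`[-K, K]` is followed, within a bounded time and with a probability bounded below, by a fall under
`-K`. The second term is of the order of `∑_{j ≤ n} p_j θ^{n-j}` for some `θ < 1`
(`summable_correlations`). Both facts need mixing relative to events of small probability that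
depend on a long past: the error has to be proportional to the probability of the event, with a rate
independent of the length of the past. This is `exists_mixing`; it comes from the contraction by the
Ruelle operator of a cone of functions with log-Hölder bounds (`exists_cone_contraction`), a cone
that the iterates of the operator reach with a constant independent of the number of coordinates
(`LogHolder.iterate_ruelle`).

This gives the limit for `φ` depending on finitely many coordinates. Since `S_n f ≥ -t` on
`{τ_t^f > n}`, it also bounds `∫ |S_n f| 1_{τ_t^f > n} dν` uniformly in `n`
(`exists_integral_abs_weight_le`), whence the limit for every `φ` by uniform approximation, and the convergence to `0` of the
probability of `{τ_t^f > n}` (`tendsto_survival`). The limit is therefore a positive functional, and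
the Riesz–Markov–Kakutani theorem yields the measure and its uniqueness.

The second identity is the limit of the relation `weight_succ` between `n + 1` and `n`, read along
the skew product `(x, t) ↦ (T x, t + f x)`, which preserves `ν ⊗ dt`. The discontinuity of
`1_{t ≥ 0}` is harmless: by the uniform bound, the mass of `𝕏 × [-δ, 0]` is of order `δ`.
-/

open MeasureTheory Filter Topology

noncomputable section

namespace SFT

variable {k : ℕ} {M : Matrix (Fin k) (Fin k) ℕ}

/-! ### The Ruelle operator on one-sided sequences -/

/-- The two points of `𝕏⁺` have the same first `n` coordinates. -/
def AgreePlus (n : ℕ) (z z' : OneSided M) : Prop := ∀ i < n, z.1 i = z'.1 i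

/-- The point `b z₀ z₁ …` of `𝕏⁺`, for a letter `b` that may precede `z₀`. -/
def consPlus (b : Fin k) (z : OneSided M) (h : M b (z.1 0) = 1) : OneSided M :=
  ⟨fun n => Nat.casesOn n b z.1, fun n => by
    cases n with
    | zero => exact h
    | succ n => exact z.2 n⟩

theorem shiftPlus_consPlus (b : Fin k) (z : OneSided M) (h : M b (z.1 0) = 1) :
    shiftPlus M (consPlus b z h) = z := rfl

theorem consPlus_shiftPlus (y : OneSided M) :
    consPlus (y.1 0) (shiftPlus M y) (y.2 0) = y := by
  apply Subtype.ext
  funext n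
  cases n <;> rfl

theorem AgreePlus.consPlus {n : ℕ} {z z' : OneSided M} (hz : AgreePlus n z z') (b : Fin k)
    (h : M b (z.1 0) = 1) (h' : M b (z'.1 0) = 1) :
    AgreePlus (n + 1) (consPlus b z h) (consPlus b z' h') := by
  intro i hi
  cases i with
  | zero => rfl
  | succ i => exact hz i (by omega)

theorem ruelle_eq_sum (ψ g : OneSided M → ℝ) (z : OneSided M) :
    ruelle ψ g z = ∑ b, if h : M b (z.1 0) = 1 then
      Real.exp (-ψ (consPlus b z h)) * g (consPlus b z h) else 0 := by
  unfold ruelle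
  rw [finsum_mem_eq_finite_toFinset_sum _ (finite_preimages z)]
  refine Finset.sum_of_injOn (fun y => y.1 0) ?_ (fun _ _ => Finset.mem_coe.2 (Finset.mem_univ _))
    ?_ ?_
  · intro y hy y' hy' h
    simp only [Set.Finite.coe_toFinset, Set.mem_ofPred_eq] at hy hy'
    have e : shiftPlus M y = shiftPlus M y' := hy.trans hy'.symm
    apply Subtype.ext
    funext n
    cases n with
    | zero => exact h
    | succ n => exact congrFun (congrArg Subtype.val e) n
  · intro b _ hb
    rw [dif_neg]
    intro h
    exact hb ⟨consPlus b z h, by simp [shiftPlus_consPlus], rfl⟩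
  · intro y hy
    simp only [Set.Finite.mem_toFinset, Set.mem_ofPred_eq] at hy
    subst hy
    have h : M (y.1 0) ((shiftPlus M y).1 0) = 1 := y.2 0
    rw [dif_pos h, consPlus_shiftPlus]

section Operator

variable {ψ : OneSided M → ℝ}

theorem ruelle_mono {g h : OneSided M → ℝ} (H : ∀ z, g z ≤ h z) (z : OneSided M) :
    ruelle ψ g z ≤ ruelle ψ h z := by
  rw [ruelle_eq_sum, ruelle_eq_sum]
  refine Finset.sum_le_sum fun b _ => ?_
  split_ifs with hb
  · exact mul_le_mul_of_nonneg_left (H _) (Real.exp_nonneg _)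
  · exact le_rfl

theorem ruelle_add_const (hψ1 : IsNormalized ψ) (h : OneSided M → ℝ) (t : ℝ) (z : OneSided M) :
    ruelle ψ (fun y => h y + t) z = ruelle ψ h z + t := by
  have h1 := hψ1 z
  rw [ruelle_eq_sum] at h1 ⊢
  rw [ruelle_eq_sum]
  have : t = t * 1 := (mul_one t).symm
  conv_rhs => rw [this, ← h1]
  rw [Finset.mul_sum, ← Finset.sum_add_distrib]
  refine Finset.sum_congr rfl fun b _ => ?_
  split_ifs <;> ring

theorem ruelle_mul_comp (u v : OneSided M → ℝ) (z : OneSided M) :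
    ruelle ψ (fun y => u y * v (shiftPlus M y)) z = ruelle ψ u z * v z := by
  rw [ruelle_eq_sum, ruelle_eq_sum, Finset.sum_mul]
  refine Finset.sum_congr rfl fun b _ => ?_
  split_ifs
  · rw [shiftPlus_consPlus]; ring
  · ring

theorem le_ruelle_shiftPlus {h : OneSided M → ℝ} (h0 : ∀ z, 0 ≤ h z) (y : OneSided M) :
    Real.exp (-ψ y) * h y ≤ ruelle ψ h (shiftPlus M y) := by
  rw [ruelle_eq_sum]
  have hb : M (y.1 0) ((shiftPlus M y).1 0) = 1 := y.2 0
  refine le_trans (le_of_eq ?_) (Finset.single_le_sum (fun b _ => ?_) (Finset.mem_univ (y.1 0)))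
  · rw [dif_pos hb, consPlus_shiftPlus]
  · split_ifs
    · exact mul_nonneg (Real.exp_nonneg _) (h0 _)
    · exact le_rfl

theorem ruelle_nonneg {h : OneSided M → ℝ} (h0 : ∀ z, 0 ≤ h z) (z : OneSided M) :
    0 ≤ ruelle ψ h z := by
  rw [ruelle_eq_sum]
  refine Finset.sum_nonneg fun b _ => ?_
  split_ifs
  · exact mul_nonneg (Real.exp_nonneg _) (h0 _)
  · exact le_rfl

theorem iterate_ruelle_nonneg {h : OneSided M → ℝ} (h0 : ∀ z, 0 ≤ h z) (n : ℕ) :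
    ∀ z, 0 ≤ (ruelle ψ)^[n] h z := by
  induction n with
  | zero => exact h0
  | succ n ih => rw [Function.iterate_succ_apply']; exact ruelle_nonneg ih

theorem iterate_ruelle_add_const (hψ1 : IsNormalized ψ) (h : OneSided M → ℝ) (t : ℝ) (n : ℕ) :
    (ruelle ψ)^[n] (fun y => h y + t) = fun z => (ruelle ψ)^[n] h z + t := by
  induction n with
  | zero => rfl
  | succ n ih =>
    rw [Function.iterate_succ_apply', ih, Function.iterate_succ_apply']
    funext z
    exact ruelle_add_const hψ1 _ t z

theorem iterate_ruelle_le (hψ1 : IsNormalized ψ) {h : OneSided M → ℝ} {S : ℝ}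
    (hS : ∀ z, h z ≤ S) (n : ℕ) : ∀ z, (ruelle ψ)^[n] h z ≤ S := by
  induction n with
  | zero => exact hS
  | succ n ih =>
    rw [Function.iterate_succ_apply']
    intro z
    refine (ruelle_mono ih z).trans (le_of_eq ?_)
    have := ruelle_add_const hψ1 (fun _ => 0) S z
    simp only [zero_add] at this
    rw [this, ruelle_eq_sum]
    simp

/-- One term of the sum over the preimages of order `n` bounds `𝓛_ψ ^ n h` from below. -/
theorem le_iterate_ruelle {h : OneSided M → ℝ} (h0 : ∀ z, 0 ≤ h z) {B : ℝ} (hB : ∀ z, ψ z ≤ B)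
    (n : ℕ) (y : OneSided M) :
    Real.exp (-(n * B)) * h y ≤ (ruelle ψ)^[n] h ((shiftPlus M)^[n] y) := by
  induction n with
  | zero => simp
  | succ n ih =>
    rw [Function.iterate_succ_apply', Function.iterate_succ_apply']
    refine le_trans ?_ (le_ruelle_shiftPlus (iterate_ruelle_nonneg h0 n) _)
    have : Real.exp (-(((n + 1 : ℕ) : ℝ) * B)) = Real.exp (-B) * Real.exp (-(n * B)) := by
      rw [← Real.exp_add]; congr 1; push_cast; ring
    rw [this, mul_assoc]
    exact mul_le_mul (Real.exp_le_exp.2 (neg_le_neg (hB _))) ih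
      (mul_nonneg (Real.exp_nonneg _) (h0 _)) (Real.exp_nonneg _)

theorem iterate_ruelle_mul_comp (u v : OneSided M → ℝ) (n : ℕ) :
    (ruelle ψ)^[n] (fun y => u y * v ((shiftPlus M)^[n] y)) =
      fun z => (ruelle ψ)^[n] u z * v z := by
  induction n generalizing v with
  | zero => rfl
  | succ n ih =>
    have : (fun y => u y * v ((shiftPlus M)^[n + 1] y)) =
        fun y => u y * (fun w => v (shiftPlus M w)) ((shiftPlus M)^[n] y) := by
      funext y; rw [Function.iterate_succ_apply']
    rw [Function.iterate_succ_apply', this, ih (fun w => v (shiftPlus M w)),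
      Function.iterate_succ_apply']
    funext z
    exact ruelle_mul_comp _ v z

/-- Primitivity: a letter `b` with `M ^ n b z₀ > 0` begins a point whose `n`-th shift is `z`. -/
theorem exists_iterate_shiftPlus_eq (hM : IsTransitionMatrix M) (n : ℕ) (b : Fin k)
    (z : OneSided M) (h : 0 < (M ^ n) b (z.1 0)) :
    ∃ y : OneSided M, y.1 0 = b ∧ (shiftPlus M)^[n] y = z := by
  induction n generalizing b with
  | zero =>
    rw [pow_zero, Matrix.one_apply] at h
    refine ⟨z, ?_, rfl⟩
    by_contra hne
    rw [if_neg (Ne.symm hne)] at h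
    exact lt_irrefl _ h
  | succ n ih =>
    rw [pow_succ', Matrix.mul_apply] at h
    obtain ⟨d, -, hd⟩ := Finset.exists_ne_zero_of_sum_ne_zero h.ne'
    have h1 : M b d = 1 := (hM.zero_or_one b d).resolve_left (left_ne_zero_of_mul hd)
    obtain ⟨y, hy0, hy⟩ := ih d (Nat.pos_of_ne_zero (right_ne_zero_of_mul hd))
    subst hy0
    exact ⟨consPlus b y h1, rfl, by
      rw [Function.iterate_succ_apply, shiftPlus_consPlus, hy]⟩

end Operator

section Topology

theorem isClosed_oneSided : IsClosed (OneSided M) := by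
  have : OneSided M = ⋂ n : ℕ, (fun x : ℕ → Fin k => (x n, x (n + 1))) ⁻¹'
      {p | M p.1 p.2 = 1} := by ext x; simp [OneSided]
  rw [this]
  exact isClosed_iInter fun n => (isClosed_discrete _).preimage
    ((continuous_apply n).prodMk (continuous_apply (n + 1)))

instance : CompactSpace (OneSided M) := isCompact_iff_compactSpace.1 isClosed_oneSided.isCompact

theorem isClosed_twoSided : IsClosed (TwoSided M) := by
  have : TwoSided M = ⋂ n : ℤ, (fun x : ℤ → Fin k => (x n, x (n + 1))) ⁻¹'
      {p | M p.1 p.2 = 1} := by ext x; simp [TwoSided]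
  rw [this]
  exact isClosed_iInter fun n => (isClosed_discrete _).preimage
    ((continuous_apply n).prodMk (continuous_apply (n + 1)))

instance : CompactSpace (TwoSided M) := isCompact_iff_compactSpace.1 isClosed_twoSided.isCompact

theorem eventually_agreePlus (n : ℕ) (z : OneSided M) : ∀ᶠ z' in 𝓝 z, AgreePlus n z' z := by
  have : ∀ i ∈ Finset.range n, ∀ᶠ z' : OneSided M in 𝓝 z, z'.1 i = z.1 i := fun i _ => by
    have hc : Continuous fun z' : OneSided M => z'.1 i :=
      (continuous_apply i).comp continuous_subtype_val
    have := hc.continuousAt.eventually (show {z.1 i} ∈ 𝓝 (z.1 i) from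
      (isOpen_discrete {z.1 i}).mem_nhds rfl)
    filter_upwards [this] with z' hz' using hz'
  have h2 := (Filter.eventually_all_finset (Finset.range n)).2 this
  filter_upwards [h2] with z' hz' i hi using hz' i (Finset.mem_range.2 hi)

theorem continuous_of_agreePlus {n : ℕ} {u : OneSided M → ℝ}
    (hu : ∀ z z', AgreePlus n z z' → u z = u z') : Continuous u := by
  rw [continuous_iff_continuousAt]
  intro z
  have : u =ᶠ[𝓝 z] fun _ => u z := by
    filter_upwards [eventually_agreePlus n z] with z' hz' using hu _ _ hz'
  exact continuousAt_const.congr this.symm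

theorem continuous_shiftPlus : Continuous (shiftPlus M) := by
  refine Continuous.subtype_mk (continuous_pi fun n : ℕ => ?_) _
  exact (continuous_apply (n + 1)).comp continuous_subtype_val

theorem continuous_ruelle {ψ g : OneSided M → ℝ} (hψ : Continuous ψ) (hg : Continuous g) :
    Continuous (ruelle ψ g) := by
  have e : ruelle ψ g = fun z => ∑ b, if h : M b (z.1 0) = 1 then
      Real.exp (-ψ (consPlus b z h)) * g (consPlus b z h) else 0 := by
    funext z; exact ruelle_eq_sum ψ g z
  rw [e]
  refine continuous_finsetSum _ fun b _ => continuous_iff_continuousAt.2 fun z => ?_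
  by_cases h : M b (z.1 0) = 1
  · let c : OneSided M → OneSided M := fun z' =>
      if h' : M b (z'.1 0) = 1 then consPlus b z' h' else consPlus b z h
    have hcz : c z = consPlus b z h := dif_pos h
    have hev : ∀ᶠ z' in 𝓝 z, M b (z'.1 0) = 1 := by
      filter_upwards [eventually_agreePlus 1 z] with z' hz'
      rw [hz' 0 one_pos]; exact h
    have hc : ContinuousAt c z := by
      refine tendsto_subtype_rng.2 (tendsto_pi_nhds.2 fun i => ?_)
      have : (fun _ => (c z).1 i) =ᶠ[𝓝 z] fun z' => (c z').1 i := by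
        filter_upwards [eventually_agreePlus (i + 1) z, hev] with z' hz' h'
        have e : c z' = consPlus b z' h' := dif_pos h'
        rw [hcz, e]
        cases i with
        | zero => rfl
        | succ i => exact (hz' i (by omega)).symm
      exact tendsto_const_nhds.congr' this
    have hF : ContinuousAt (fun y => Real.exp (-ψ y) * g y) (c z) := by fun_prop
    refine (ContinuousAt.comp (f := c) hF hc).congr ?_
    filter_upwards [hev] with z' h'
    have e : c z' = consPlus b z' h' := dif_pos h'
    rw [dif_pos h', Function.comp_apply, e]
  · refine (continuousAt_const (y := (0 : ℝ))).congr ?_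
    filter_upwards [eventually_agreePlus 1 z] with z' hz'
    rw [dif_neg]
    rwa [hz' 0 one_pos]

theorem continuous_iterate_ruelle {ψ g : OneSided M → ℝ} (hψ : Continuous ψ) (hg : Continuous g)
    (n : ℕ) : Continuous ((ruelle ψ)^[n] g) := by
  induction n with
  | zero => exact hg
  | succ n ih => rw [Function.iterate_succ_apply']; exact continuous_ruelle hψ ih

theorem integral_iterate_ruelle {ψ g : OneSided M → ℝ} {m : Measure (OneSided M)}
    (hm : IsGibbsPlus ψ m) (hψ : Continuous ψ) (hg : Continuous g) (n : ℕ) :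
    ∫ z, (ruelle ψ)^[n] g z ∂m = ∫ z, g z ∂m := by
  induction n with
  | zero => rfl
  | succ n ih =>
    rw [Function.iterate_succ_apply', ← ih]
    exact hm.integral_ruelle ⟨_, continuous_iterate_ruelle hψ hg n⟩

theorem continuous_of_holder {C α : ℝ} (hα0 : 0 < α) (hα1 : α < 1) {h : OneSided M → ℝ}
    (hh : ∀ n z z', AgreePlus n z z' → |h z - h z'| ≤ C * α ^ n) : Continuous h := by
  refine continuous_iff_continuousAt.2 fun z => Metric.tendsto_nhds.2 fun ε hε => ?_
  have h1 : Tendsto (fun n : ℕ => C * α ^ n) atTop (𝓝 (C * 0)) :=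
    (tendsto_pow_atTop_nhds_zero_of_lt_one hα0.le hα1).const_mul C
  rw [mul_zero] at h1
  obtain ⟨n, hn⟩ := (h1.eventually (gt_mem_nhds hε)).exists
  filter_upwards [eventually_agreePlus n z] with z' hz'
  exact (hh n z' z hz').trans_lt hn

end Topology

theorem IsHolderPlus.exists_agreePlus {ψ : OneSided M → ℝ} (hψ : IsHolderPlus ψ) :
    ∃ C α : ℝ, 0 < C ∧ 0 < α ∧ α < 1 ∧
      ∀ n z z', AgreePlus n z z' → |ψ z - ψ z'| ≤ C * α ^ n := by
  obtain ⟨C, α, hC, h0, h1, h⟩ := hψ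
  refine ⟨C, α, hC, h0, h1, fun n z z' hz => ?_⟩
  by_cases e : z = z'
  · subst e; rw [sub_self, abs_zero]; positivity
  · refine (h z z' e).trans (mul_le_mul_of_nonneg_left ?_ hC.le)
    refine pow_le_pow_of_le_one h0.le h1.le (le_csInf ?_ fun j hj => ?_)
    · by_contra hne
      rw [Set.not_nonempty_iff_eq_empty] at hne
      refine e (Subtype.ext (funext fun j => ?_))
      by_contra hj
      exact (Set.eq_empty_iff_forall_notMem.1 hne) j hj
    · by_contra hlt
      exact hj (hz j (not_le.1 hlt))

/-! ### Contraction of cones and mixing of the one-sided Gibbs measure -/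

/-- The cone of nonnegative functions on `𝕏⁺` whose logarithm oscillates by at most `K * α ^ n`
between points that agree on the first `n + l` coordinates (`n ≥ 1`). -/
def LogHolder (α K : ℝ) (l : ℕ) (h : OneSided M → ℝ) : Prop :=
  (∀ z, 0 ≤ h z) ∧
    ∀ n, 1 ≤ n → ∀ z z', AgreePlus (n + l) z z' → h z ≤ Real.exp (K * α ^ n) * h z'

section Cone

variable {ψ : OneSided M → ℝ} {C α : ℝ}

theorem LogHolder.mono (hα0 : 0 < α) {K K' : ℝ} (hK : K ≤ K') {l : ℕ} {h : OneSided M → ℝ}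
    (hh : LogHolder α K l h) : LogHolder α K' l h :=
  ⟨hh.1, fun n hn z z' hz => (hh.2 n hn z z' hz).trans
    (mul_le_mul_of_nonneg_right (Real.exp_le_exp.2 (by gcongr)) (hh.1 z'))⟩

/-- The preimages of two points that share their first letter are paired by their first letter. -/
theorem ruelle_le_exp_mul (hψ : ∀ n z z', AgreePlus n z z' → |ψ z - ψ z'| ≤ C * α ^ n)
    {h : OneSided M → ℝ} (h0 : ∀ z, 0 ≤ h z) {N : ℕ} (hN : 1 ≤ N) {A : ℝ}
    (hA : ∀ z z', AgreePlus (N + 1) z z' → h z ≤ Real.exp A * h z') {z z' : OneSided M}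
    (hz : AgreePlus N z z') :
    ruelle ψ h z ≤ Real.exp (A + C * α ^ (N + 1)) * ruelle ψ h z' := by
  rw [ruelle_eq_sum, ruelle_eq_sum, Finset.mul_sum]
  refine Finset.sum_le_sum fun b _ => ?_
  have e : z.1 0 = z'.1 0 := hz 0 hN
  by_cases hb : M b (z.1 0) = 1
  · have hb' : M b (z'.1 0) = 1 := e ▸ hb
    rw [dif_pos hb, dif_pos hb']
    have ha := hz.consPlus b hb hb'
    have h1 := abs_le.1 (hψ _ _ _ ha)
    have h2 : Real.exp (-ψ (consPlus b z hb)) ≤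
        Real.exp (C * α ^ (N + 1)) * Real.exp (-ψ (consPlus b z' hb')) := by
      rw [← Real.exp_add]
      exact Real.exp_le_exp.2 (by linarith [h1.1])
    calc _ ≤ (Real.exp (C * α ^ (N + 1)) * Real.exp (-ψ (consPlus b z' hb'))) *
          (Real.exp A * h (consPlus b z' hb')) :=
        mul_le_mul h2 (hA _ _ ha) (h0 _) (by positivity)
      _ = _ := by rw [Real.exp_add]; ring
  · have hb' : ¬ M b (z'.1 0) = 1 := e ▸ hb
    rw [dif_neg hb, dif_neg hb', mul_zero]

theorem LogHolder.ruelle_of_succ (hψ : ∀ n z z', AgreePlus n z z' → |ψ z - ψ z'| ≤ C * α ^ n)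
    {K : ℝ} {l : ℕ} {h : OneSided M → ℝ} (hh : LogHolder α K (l + 1) h) :
    LogHolder α (K + C * α ^ (l + 1)) l (ruelle ψ h) := by
  refine ⟨ruelle_nonneg hh.1, fun n hn z z' hz => ?_⟩
  refine (ruelle_le_exp_mul hψ hh.1 (N := n + l) (by omega) (A := K * α ^ n)
    (fun w w' hw => hh.2 n hn w w' hw) hz).trans (le_of_eq ?_)
  congr 2
  ring

theorem LogHolder.ruelle_zero (hψ : ∀ n z z', AgreePlus n z z' → |ψ z - ψ z'| ≤ C * α ^ n)
    {K : ℝ} {h : OneSided M → ℝ} (hh : LogHolder α K 0 h) :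
    LogHolder α ((K + C) * α) 0 (ruelle ψ h) := by
  refine ⟨ruelle_nonneg hh.1, fun n hn z z' hz => ?_⟩
  refine (ruelle_le_exp_mul hψ hh.1 (by omega) (A := K * α ^ (n + 1))
    (fun w w' hw => hh.2 (n + 1) (by omega) w w' hw) hz).trans (le_of_eq ?_)
  congr 2
  ring

/-- A nonnegative function of the first `l + 1` coordinates has oscillation constant `0` at level
`l`; each application of `𝓛_ψ` lowers the level by one and adds the oscillation of `ψ`, so that the
constant at level `0` does not depend on `l`. -/
theorem LogHolder.iterate_ruelle (hα0 : 0 < α) (hα1 : α < 1) (hC : 0 < C)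
    (hψ : ∀ n z z', AgreePlus n z z' → |ψ z - ψ z'| ≤ C * α ^ n)
    {l : ℕ} {h : OneSided M → ℝ} (hh : LogHolder α 0 l h) :
    LogHolder α (2 * C / (1 - α)) 0 ((ruelle ψ)^[l] h) := by
  have key : ∀ l K (h : OneSided M → ℝ), LogHolder α K l h →
      LogHolder α (K + C * ∑ i ∈ Finset.range l, α ^ (i + 1)) 0 ((ruelle ψ)^[l] h) := by
    intro l
    induction l with
    | zero => intro K h hh; simpa using hh
    | succ l ih =>
      intro K h hh
      rw [Function.iterate_succ_apply, Finset.sum_range_succ]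
      refine (ih _ _ (hh.ruelle_of_succ hψ)).mono hα0 (le_of_eq (by ring))
  refine (key l 0 h hh).mono hα0 ?_
  have h1 : ∑ i ∈ Finset.range l, α ^ (i + 1) ≤ 1 / (1 - α) := by
    have : ∑ i ∈ Finset.range l, α ^ (i + 1) ≤ ∑ i ∈ Finset.range l, α ^ i :=
      Finset.sum_le_sum fun i _ => pow_le_pow_of_le_one hα0.le hα1.le (by omega)
    refine this.trans ?_
    rw [geom_sum_eq hα1.ne, ← neg_div_neg_eq]
    have : 0 < 1 - α := by linarith
    rw [neg_sub, neg_sub]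
    gcongr
    linarith [pow_nonneg hα0.le l]
  have h2 : 0 ≤ 1 / (1 - α) := by have : 0 < 1 - α := by linarith
                                  positivity
  have : 2 * C / (1 - α) = 2 * (C * (1 / (1 - α))) := by ring
  rw [this, zero_add]
  nlinarith [mul_le_mul_of_nonneg_left h1 hC.le, mul_nonneg hC.le h2]

/-- One application of `𝓛_ψ ^ p`, with `M ^ p > 0`, makes a function of the cone comparable to a
constant; subtracting a small multiple of its supremum leaves a function of the cone with a smaller
supremum. -/
theorem exists_cone_contraction (hM : IsTransitionMatrix M)
    (hα0 : 0 < α) (hα1 : α < 1) (hC : 0 < C)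
    (hψ : ∀ n z z', AgreePlus n z z' → |ψ z - ψ z'| ≤ C * α ^ n) :
    ∃ (p : ℕ) (c ε : ℝ), 1 ≤ p ∧ 0 < c ∧ 0 < ε ∧ ε < 1 ∧
      ∀ h : OneSided M → ℝ, LogHolder α (2 * C / (1 - α)) 0 h →
        (∀ z y, c * h y ≤ (ruelle ψ)^[p] h z) ∧
        (IsNormalized ψ → ∀ S : ℝ, (∀ z, h z ≤ S) →
          ∃ (t : ℝ) (h' : OneSided M → ℝ), LogHolder α (2 * C / (1 - α)) 0 h' ∧
            (∀ z, h' z ≤ (1 - ε) * S) ∧ (ruelle ψ)^[p] h = fun z => h' z + t) := by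
  obtain ⟨p, hp, hMp⟩ := hM.exists_pow_pos
  obtain ⟨B, hB0, hB⟩ : ∃ B, 0 ≤ B ∧ ∀ z, ψ z ≤ B := by
    rcases isEmpty_or_nonempty (OneSided M) with he | ⟨⟨y⟩⟩
    · exact ⟨0, le_rfl, fun z => (he.false z).elim⟩
    · refine ⟨|ψ y| + C, by positivity, fun z => ?_⟩
      have := hψ 0 z y (fun i hi => by omega)
      rw [pow_zero, mul_one] at this
      linarith [(abs_le.1 this).2, le_abs_self (ψ y)]
  have h1α : 0 < 1 - α := by linarith
  -- `𝓛_ψ` maps the cone of constant `a` into the smaller cone of constant `a'`; the difference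
  -- leaves room for the subtraction of a constant
  set a := 2 * C / (1 - α) with ha
  have ha0 : 0 < a := by positivity
  set a' := (a + C) * α with ha'
  have haa : a' < a := by
    have : a * (1 - α) = 2 * C := by rw [ha]; field_simp
    nlinarith
  have ha'0 : 0 < a' := by positivity
  set c := Real.exp (-(p * B) - a) with hc
  have hc0 : 0 < c := Real.exp_pos _
  have hc1 : c < 1 := by
    rw [hc, Real.exp_lt_one_iff]
    have : 0 ≤ p * B := by positivity
    linarith
  set ε := c * ((a - a') / (a * Real.exp a)) with hε
  have hε0 : 0 < ε := by have : 0 < a - a' := by linarith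
                         positivity
  have hεc : ε ≤ c := by
    rw [hε]
    refine mul_le_of_le_one_right hc0.le ?_
    rw [div_le_one (by positivity)]
    nlinarith [Real.one_le_exp ha0.le]
  -- the preimage `w` of `z` of order `p` that starts with the letter of `y` has `h w` comparable
  -- to `h y`
  have low : ∀ h : OneSided M → ℝ, LogHolder α a 0 h →
      ∀ z y, c * h y ≤ (ruelle ψ)^[p] h z := by
    intro h hh z y
    obtain ⟨w, hw0, hw⟩ := exists_iterate_shiftPlus_eq hM p (y.1 0) z (hMp _ _)
    have h1 := le_iterate_ruelle hh.1 hB p w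
    rw [hw] at h1
    refine le_trans ?_ h1
    have h2 := hh.2 1 le_rfl y w (fun i hi => by
      obtain rfl : i = 0 := by omega
      exact hw0.symm)
    have h3 : h y ≤ Real.exp a * h w := h2.trans
      (mul_le_mul_of_nonneg_right (Real.exp_le_exp.2 (by rw [pow_one]; nlinarith)) (hh.1 w))
    calc c * h y ≤ c * (Real.exp a * h w) := mul_le_mul_of_nonneg_left h3 hc0.le
      _ = _ := by rw [← mul_assoc, hc, ← Real.exp_add]; ring_nf
  refine ⟨p, c, ε, hp, hc0, hε0, hεc.trans_lt hc1, fun h hh => ⟨low h hh, fun hψ1 S hS => ?_⟩⟩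
  rcases isEmpty_or_nonempty (OneSided M) with he | hne
  · exact ⟨0, h, hh, fun z => (he.false z).elim, funext fun z => (he.false z).elim⟩
  set s := ⨆ z, h z with hs
  have hbdd : BddAbove (Set.range h) := ⟨S, by rintro _ ⟨z, rfl⟩; exact hS z⟩
  have hs0 : 0 ≤ s := (hh.1 hne.some).trans (le_ciSup hbdd _)
  have hsS : s ≤ S := ciSup_le hS
  have hlow : ∀ z, c * s ≤ (ruelle ψ)^[p] h z := fun z => by
    rw [hs, Real.mul_iSup_of_nonneg hc0.le]
    exact ciSup_le fun y => low h hh z y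
  have hit : ∀ n, LogHolder α a 0 ((ruelle ψ)^[n] h) := by
    intro n
    induction n with
    | zero => exact hh
    | succ n ih =>
      rw [Function.iterate_succ_apply']
      exact (ih.ruelle_zero hψ).mono hα0 haa.le
  have hcone : LogHolder α a' 0 ((ruelle ψ)^[p] h) := by
    obtain ⟨q, rfl⟩ : ∃ q, p = q + 1 := ⟨p - 1, by omega⟩
    rw [Function.iterate_succ_apply']
    exact (hit q).ruelle_zero hψ
  refine ⟨ε * s, fun z => (ruelle ψ)^[p] h z - ε * s, ⟨fun z => ?_, fun n hn z z' hz => ?_⟩,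
    fun z => ?_, funext fun z => by ring⟩
  · linarith [hlow z, mul_le_mul_of_nonneg_right hεc hs0]
  · set δ := α ^ n with hδ
    have hδ0 : 0 < δ := by positivity
    have hδ1 : δ ≤ 1 := pow_le_one₀ hα0.le hα1.le
    have h1 := hcone.2 n hn z z' hz
    set Z := (ruelle ψ)^[p] h z'
    have e1 : Real.exp (a * δ) - 1 ≤ a * δ * Real.exp a := by
      have h2 := Real.add_one_le_exp (-(a * δ))
      have h3 : Real.exp (a * δ) * Real.exp (-(a * δ)) = 1 := by
        rw [← Real.exp_add, add_neg_cancel, Real.exp_zero]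
      have h4 : Real.exp (a * δ) ≤ Real.exp a := Real.exp_le_exp.2 (by nlinarith)
      have h5 := Real.exp_pos (a * δ)
      have h6 : 0 < a * δ := by positivity
      nlinarith
    have e2 : (a - a') * δ ≤ Real.exp (a * δ) - Real.exp (a' * δ) := by
      have h2 := Real.add_one_le_exp ((a - a') * δ)
      have h3 : Real.exp (a * δ) = Real.exp (a' * δ) * Real.exp ((a - a') * δ) := by
        rw [← Real.exp_add]; ring_nf
      have h4 : 1 ≤ Real.exp (a' * δ) := Real.one_le_exp (by positivity)
      have h5 : 0 ≤ (a - a') * δ := mul_nonneg (by linarith) hδ0.le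
      rw [h3]
      nlinarith
    -- `ε` is chosen so that this holds for all `δ ∈ (0, 1]`
    have e3 : ε * (Real.exp (a * δ) - 1) ≤ c * (Real.exp (a * δ) - Real.exp (a' * δ)) := by
      calc ε * (Real.exp (a * δ) - 1) ≤ ε * (a * δ * Real.exp a) :=
            mul_le_mul_of_nonneg_left e1 hε0.le
        _ = c * ((a - a') * δ) := by rw [hε]; field_simp
        _ ≤ _ := mul_le_mul_of_nonneg_left e2 hc0.le
    have e4 : 0 ≤ Real.exp (a * δ) - Real.exp (a' * δ) :=
      le_trans (mul_nonneg (by linarith) hδ0.le) e2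
    have e5 := mul_le_mul_of_nonneg_right e3 hs0
    have e6 := mul_le_mul_of_nonneg_right (hlow z') e4
    show (ruelle ψ)^[p] h z - ε * s ≤ Real.exp (a * δ) * (Z - ε * s)
    nlinarith
  · have := iterate_ruelle_le hψ1 (fun z => le_ciSup hbdd z) p z
    nlinarith

theorem exists_pow_div_le {ρ : ℝ} (h0 : 0 < ρ) (h1 : ρ < 1) {p : ℕ} (hp : 1 ≤ p) :
    ∃ D θ : ℝ, 0 < D ∧ 0 < θ ∧ θ < 1 ∧ ∀ n : ℕ, ρ ^ (n / p) ≤ D * θ ^ n := by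
  have hp0 : (0 : ℝ) < p := by exact_mod_cast hp
  have hp1 : (1 : ℝ) ≤ p := by exact_mod_cast hp
  set θ := 1 - (1 - ρ) / p with hθ
  have hd : (1 - ρ) / p < 1 := by rw [div_lt_one hp0]; linarith
  have hd0 : 0 < (1 - ρ) / p := div_pos (by linarith) hp0
  have hθ0 : 0 < θ := by linarith
  have hθ1 : θ < 1 := by linarith
  have hb : ρ ≤ θ ^ p := by
    have := one_add_mul_le_pow (a := -((1 - ρ) / p)) (by linarith) p
    have e : 1 + (p : ℝ) * -((1 - ρ) / p) = ρ := by field_simp; ring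
    rw [e] at this
    rwa [hθ, sub_eq_add_neg]
  refine ⟨(θ ^ p)⁻¹, θ, by positivity, hθ0, hθ1, fun n => ?_⟩
  rw [inv_mul_eq_div, le_div_iff₀ (by positivity)]
  calc ρ ^ (n / p) * θ ^ p ≤ (θ ^ p) ^ (n / p) * θ ^ p := by gcongr
    _ = θ ^ (p * (n / p) + p) := by rw [← pow_mul, pow_add]
    _ ≤ θ ^ n := by
      refine pow_le_pow_of_le_one hθ0.le hθ1.le ?_
      have := Nat.div_add_mod n p
      have := Nat.mod_lt n hp
      omega

end Cone

/-- Exponential mixing of `ν⁺`, relative in the past: the error is proportional to the integral of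
the nonnegative function `u` of the first `l + 1` coordinates, however large `l` is. -/
theorem exists_mixing_plus (hM : IsTransitionMatrix M) {ψ : OneSided M → ℝ} (hψ : IsHolderPlus ψ)
    (hψ1 : IsNormalized ψ) {m : Measure (OneSided M)} (hm : IsGibbsPlus ψ m) :
    ∃ D ρ : ℝ, 0 < D ∧ 0 < ρ ∧ ρ < 1 ∧ ∀ (l n : ℕ) (u v : OneSided M → ℝ),
      (∀ z, 0 ≤ u z) → (∀ z z', AgreePlus (l + 1) z z' → u z = u z') → Continuous v →
      |∫ z, u z * v ((shiftPlus M)^[l + n] z) ∂m - (∫ z, u z ∂m) * ∫ z, v z ∂m| ≤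
        D * ρ ^ n * (∫ z, u z ∂m) * ∫ z, |v z| ∂m := by
  obtain ⟨C, α, hC, hα0, hα1, hh⟩ := hψ.exists_agreePlus
  obtain ⟨p, c, ε, hp, hc, hε0, hε1, H⟩ := exists_cone_contraction hM hα0 hα1 hC hh
  obtain ⟨D, ρ, hD, hρ0, hρ1, hρ⟩ := exists_pow_div_le (ρ := 1 - ε) (by linarith) (by linarith) hp
  have hψc : Continuous ψ := continuous_of_holder hα0 hα1 hh
  have := hm.isProbabilityMeasure
  refine ⟨D / c, ρ, by positivity, hρ0, hρ1, fun l n u v hu0 hu hv => ?_⟩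
  have huc := continuous_of_agreePlus hu
  have hint : ∀ g : OneSided M → ℝ, Continuous g → Integrable g m := fun g hg =>
    hg.integrable_of_hasCompactSupport (HasCompactSupport.of_compactSpace g)
  have hcone : LogHolder α (2 * C / (1 - α)) 0 ((ruelle ψ)^[l] u) := by
    refine LogHolder.iterate_ruelle hα0 hα1 hC hh ⟨hu0, fun n hn z z' hz => ?_⟩
    rw [zero_mul, Real.exp_zero, one_mul]
    exact (hu z z' fun i hi => hz i (by omega)).le
  set h := (ruelle ψ)^[l] u with hdef
  have hhc : Continuous h := continuous_iterate_ruelle hψc huc l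
  have hI : ∀ j, ∫ z, (ruelle ψ)^[j] h z ∂m = ∫ z, u z ∂m := fun j => by
    rw [integral_iterate_ruelle hm hψc hhc, hdef, integral_iterate_ruelle hm hψc huc]
  set I := ∫ z, u z ∂m with hIdef
  have hI0 : 0 ≤ I := integral_nonneg hu0
  have hS : ∀ y, h y ≤ I / c := fun y => by
    rw [le_div_iff₀ hc, mul_comm, ← hI p]
    calc c * h y = ∫ _, c * h y ∂m := by simp
      _ ≤ _ := integral_mono (integrable_const _)
        (hint _ (continuous_iterate_ruelle hψc hhc p)) fun z => (H h hcone).1 z y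
  -- up to an additive constant, `𝓛_ψ ^ (p * j) h` lies in the cone, with an upper bound that decays
  have hosc : ∀ j, ∃ (t : ℝ) (h' : OneSided M → ℝ), LogHolder α (2 * C / (1 - α)) 0 h' ∧
      (∀ z, h' z ≤ (1 - ε) ^ j * (I / c)) ∧ (ruelle ψ)^[p * j] h = fun z => h' z + t := by
    intro j
    induction j with
    | zero => exact ⟨0, h, hcone, fun z => by simpa using hS z, by simp⟩
    | succ j ih =>
      obtain ⟨t, h', h1, h2, h3⟩ := ih
      obtain ⟨t', h'', h4, h5, h6⟩ := (H h' h1).2 hψ1 _ h2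
      refine ⟨t' + t, h'', h4, fun z => (h5 z).trans (le_of_eq (by ring)), ?_⟩
      rw [mul_add, mul_one, add_comm, Function.iterate_add_apply, h3,
        iterate_ruelle_add_const hψ1, h6]
      funext z; ring
  obtain ⟨t, h', h1, h2, h3⟩ := hosc (n / p)
  set δ := (1 - ε) ^ (n / p) * (I / c) with hδ
  have hLn : ∀ z, t ≤ (ruelle ψ)^[n] h z ∧ (ruelle ψ)^[n] h z ≤ t + δ := by
    intro z
    have e : n = n % p + p * (n / p) := (Nat.mod_add_div n p).symm
    have e2 : (ruelle ψ)^[n] h z = (ruelle ψ)^[n % p] h' z + t := by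
      conv_lhs => rw [e]
      rw [Function.iterate_add_apply, h3, iterate_ruelle_add_const hψ1]
    rw [e2]
    have := iterate_ruelle_nonneg (ψ := ψ) h1.1 (n % p) z
    have := iterate_ruelle_le hψ1 h2 (n % p) z
    constructor <;> linarith
  have hLc := continuous_iterate_ruelle hψc hhc n
  have hIt : t ≤ I ∧ I ≤ t + δ := by
    rw [← hI n]
    constructor
    · calc t = ∫ _, t ∂m := by simp
        _ ≤ _ := integral_mono (integrable_const _) (hint _ hLc) fun z => (hLn z).1
    · calc _ ≤ ∫ _, t + δ ∂m :=
          integral_mono (hint _ hLc) (integrable_const _) fun z => (hLn z).2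
        _ = t + δ := by simp
  have e1 : ∫ z, u z * v ((shiftPlus M)^[l + n] z) ∂m =
      ∫ z, (ruelle ψ)^[n] h z * v z ∂m := by
    have hc2 : Continuous fun z => u z * v ((shiftPlus M)^[l + n] z) :=
      huc.mul (hv.comp (continuous_shiftPlus.iterate _))
    rw [← integral_iterate_ruelle hm hψc hc2 (l + n), iterate_ruelle_mul_comp]
    refine integral_congr_ae (ae_of_all _ fun z => ?_)
    show (ruelle ψ)^[l + n] u z * v z = _
    rw [add_comm l n, Function.iterate_add_apply]
  rw [e1, ← integral_const_mul, ← integral_sub (f := fun z => (ruelle ψ)^[n] h z * v z)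
    (hint _ (hLc.mul hv)) ((hint v hv).const_mul I)]
  have hδ0 : ∀ z, |(ruelle ψ)^[n] h z - I| ≤ δ := fun z => by
    rw [abs_le]
    constructor <;> linarith [hLn z, hIt.1, hIt.2]
  rw [← Real.norm_eq_abs]
  refine (norm_integral_le_of_norm_le (μ := m) (g := fun z => δ * |v z|)
    ((hint _ hv.abs).const_mul δ)
    (ae_of_all _ fun z => ?_)).trans ?_
  · rw [← sub_mul, norm_mul]
    exact mul_le_mul_of_nonneg_right (hδ0 z) (norm_nonneg _)
  · rw [integral_const_mul]
    refine mul_le_mul_of_nonneg_right ?_ (integral_nonneg fun z => abs_nonneg _)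
    calc δ = (1 - ε) ^ (n / p) * (I / c) := hδ
      _ ≤ D * ρ ^ n * (I / c) := mul_le_mul_of_nonneg_right (hρ n) (by positivity)
      _ = _ := by ring

/-- `ν⁺` has full support. -/
theorem integral_pos_of_agreePlus (hM : IsTransitionMatrix M) {ψ : OneSided M → ℝ}
    (hψ : IsHolderPlus ψ) {m : Measure (OneSided M)} (hm : IsGibbsPlus ψ m) {l : ℕ}
    {u : OneSided M → ℝ} (hu0 : ∀ z, 0 ≤ u z)
    (hu : ∀ z z', AgreePlus (l + 1) z z' → u z = u z') {y : OneSided M} (hy : 0 < u y) :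
    0 < ∫ z, u z ∂m := by
  obtain ⟨C, α, hC, hα0, hα1, hh⟩ := hψ.exists_agreePlus
  obtain ⟨p, c, ε, hp, hc, hε0, hε1, H⟩ := exists_cone_contraction hM hα0 hα1 hC hh
  have hψc : Continuous ψ := continuous_of_holder hα0 hα1 hh
  have := hm.isProbabilityMeasure
  have huc := continuous_of_agreePlus hu
  obtain ⟨B, hB⟩ := (isCompact_range hψc).bddAbove
  have h1 := le_iterate_ruelle hu0 (fun z => hB ⟨z, rfl⟩) l y
  have hcone : LogHolder α (2 * C / (1 - α)) 0 ((ruelle ψ)^[l] u) := by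
    refine LogHolder.iterate_ruelle hα0 hα1 hC hh ⟨hu0, fun n hn z z' hz => ?_⟩
    rw [zero_mul, Real.exp_zero, one_mul]
    exact (hu z z' fun i hi => hz i (by omega)).le
  have hhc := continuous_iterate_ruelle hψc huc l
  have hLc := continuous_iterate_ruelle hψc hhc p
  rw [← integral_iterate_ruelle hm hψc huc l, ← integral_iterate_ruelle hm hψc hhc p]
  refine lt_of_lt_of_le (mul_pos hc (lt_of_lt_of_le (mul_pos (Real.exp_pos _) hy) h1)) ?_
  calc c * (ruelle ψ)^[l] u ((shiftPlus M)^[l] y)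
      = ∫ _, c * (ruelle ψ)^[l] u ((shiftPlus M)^[l] y) ∂m := by simp
    _ ≤ _ := integral_mono (integrable_const _)
      (hLc.integrable_of_hasCompactSupport (HasCompactSupport.of_compactSpace _))
      fun z => (H _ hcone).1 z _

/-! ### Two-sided sequences, mixing and decay of correlations -/

/-- The two points of `𝕏` have the same coordinates with indices in `[a, b]`. -/
def Agree (a b : ℤ) (x y : TwoSided M) : Prop := ∀ i, a ≤ i → i ≤ b → x.1 i = y.1 i

theorem Agree.refl (a b : ℤ) (x : TwoSided M) : Agree a b x x := fun _ _ _ => rfl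

theorem Agree.symm {a b : ℤ} {x y : TwoSided M} (h : Agree a b x y) : Agree a b y x :=
  fun i h1 h2 => (h i h1 h2).symm

theorem Agree.trans {a b : ℤ} {x y z : TwoSided M} (h : Agree a b x y) (h' : Agree a b y z) :
    Agree a b x z := fun i h1 h2 => (h i h1 h2).trans (h' i h1 h2)

theorem Agree.mono {a b a' b' : ℤ} {x y : TwoSided M} (h : Agree a b x y) (ha : a ≤ a')
    (hb : b' ≤ b) : Agree a' b' x y := fun i h1 h2 => h i (ha.trans h1) (h2.trans hb)

theorem iterate_shift_apply (n : ℕ) (x : TwoSided M) (i : ℤ) :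
    ((shift M)^[n] x).1 i = x.1 (i + n) := by
  induction n generalizing i with
  | zero => simp
  | succ n ih =>
    rw [Function.iterate_succ_apply']
    show ((shift M)^[n] x).1 (i + 1) = _
    rw [ih]; push_cast; ring_nf

theorem iterate_shift_symm_apply (n : ℕ) (x : TwoSided M) (i : ℤ) :
    ((shift M).symm^[n] x).1 i = x.1 (i - n) := by
  induction n generalizing i with
  | zero => simp
  | succ n ih =>
    rw [Function.iterate_succ_apply']
    show ((shift M).symm^[n] x).1 (i - 1) = _
    rw [ih]; push_cast; ring_nf

theorem Agree.iterate_shift {a b : ℤ} {x y : TwoSided M} (h : Agree a b x y) (n : ℕ) :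
    Agree (a - n) (b - n) ((shift M)^[n] x) ((shift M)^[n] y) := by
  intro i h1 h2
  rw [iterate_shift_apply, iterate_shift_apply]
  exact h _ (by omega) (by omega)

theorem Agree.iterate_shift_symm {a b : ℤ} {x y : TwoSided M} (h : Agree a b x y) (n : ℕ) :
    Agree (a + n) (b + n) ((shift M).symm^[n] x) ((shift M).symm^[n] y) := by
  intro i h1 h2
  rw [iterate_shift_symm_apply, iterate_shift_symm_apply]
  exact h _ (by omega) (by omega)

theorem eventually_agree (a b : ℤ) (x : TwoSided M) : ∀ᶠ y in 𝓝 x, Agree a b y x := by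
  have : ∀ i ∈ Finset.Icc a b, ∀ᶠ y : TwoSided M in 𝓝 x, y.1 i = x.1 i := fun i _ => by
    have hc : Continuous fun y : TwoSided M => y.1 i :=
      (continuous_apply i).comp continuous_subtype_val
    have := hc.continuousAt.eventually (show {x.1 i} ∈ 𝓝 (x.1 i) from
      (isOpen_discrete {x.1 i}).mem_nhds rfl)
    filter_upwards [this] with y hy using hy
  have h2 := (Filter.eventually_all_finset (Finset.Icc a b)).2 this
  filter_upwards [h2] with y hy i hi hi' using hy i (Finset.mem_Icc.2 ⟨hi, hi'⟩)

theorem continuous_of_agree {Y : Type*} [TopologicalSpace Y] {a b : ℤ} {u : TwoSided M → Y}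
    (hu : ∀ x y, Agree a b x y → u x = u y) : Continuous u := by
  rw [continuous_iff_continuousAt]
  intro x
  have : u =ᶠ[𝓝 x] fun _ => u x := by
    filter_upwards [eventually_agree a b x] with y hy using hu _ _ hy
  exact continuousAt_const.congr this.symm

variable (M) in
/-- The points of `𝕏` can be represented, up to the coordinates outside `[a, b]`, by points that
depend only on the coordinates in `[a, b]`. -/
theorem exists_representative (a b : ℤ) : ∃ R : TwoSided M → TwoSided M,
    (∀ x, Agree a b (R x) x) ∧ ∀ x y, Agree a b x y → R x = R y := by
  let s : Setoid (TwoSided M) := ⟨Agree a b, fun _ _ _ _ => rfl, Agree.symm, Agree.trans⟩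
  exact ⟨fun x => (Quotient.mk s x).out,
    fun x => Quotient.exact (Quotient.out_eq (Quotient.mk s x)),
    fun x y h => congrArg Quotient.out (Quotient.sound h)⟩

theorem IsTransitionMatrix.exists_pred (hM : IsTransitionMatrix M) (b : Fin k) :
    ∃ a, M a b = 1 := by
  obtain ⟨p, hp, h⟩ := hM.exists_pow_pos
  obtain ⟨q, rfl⟩ : ∃ q, p = q + 1 := ⟨p - 1, by omega⟩
  have := h b b
  rw [pow_succ, Matrix.mul_apply] at this
  obtain ⟨d, -, hd⟩ := Finset.exists_ne_zero_of_sum_ne_zero this.ne'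
  exact ⟨d, (hM.zero_or_one d b).resolve_left (right_ne_zero_of_mul hd)⟩

theorem future_surjective (hM : IsTransitionMatrix M) : Function.Surjective (future M) := by
  intro z
  choose pr hpr using hM.exists_pred
  refine ⟨⟨fun i => if 0 ≤ i then z.1 i.toNat else pr^[(-i).toNat] (z.1 0), fun i => ?_⟩, ?_⟩
  · by_cases h : 0 ≤ i
    · have h1 : 0 ≤ i + 1 := by omega
      simp only [h, h1, if_true]
      have : (i + 1).toNat = i.toNat + 1 := by omega
      rw [this]; exact z.2 _
    · have e : (-i).toNat = (-(i + 1)).toNat + 1 := by omega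
      have e2 : (if 0 ≤ i + 1 then z.1 (i + 1).toNat else pr^[(-(i + 1)).toNat] (z.1 0)) =
          pr^[(-(i + 1)).toNat] (z.1 0) := by
        split_ifs with h1
        · have h2 : i + 1 = 0 := by omega
          rw [h2]; rfl
        · rfl
      show M (if 0 ≤ i then _ else _) (if 0 ≤ i + 1 then _ else _) = 1
      rw [e2, if_neg h, e, Function.iterate_succ_apply']
      exact hpr _
  · apply Subtype.ext
    funext n
    simp [future]

theorem future_iterate_shift (n : ℕ) (x : TwoSided M) :
    future M ((shift M)^[n] x) = (shiftPlus M)^[n] (future M x) := by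
  induction n with
  | zero => rfl
  | succ n ih =>
    rw [Function.iterate_succ_apply', Function.iterate_succ_apply', ← ih]
    apply Subtype.ext
    funext i
    show ((shift M)^[n] x).1 ((i : ℤ) + 1) = ((shift M)^[n] x).1 ((i + 1 : ℕ) : ℤ)
    push_cast; rfl

theorem continuous_future : Continuous (future M) := by
  refine Continuous.subtype_mk (continuous_pi fun n : ℕ => ?_) _
  exact (continuous_apply (n : ℤ)).comp continuous_subtype_val

theorem agree_of_agreePlus_future {n : ℕ} {x y : TwoSided M}
    (h : AgreePlus (n + 1) (future M x) (future M y)) : Agree 0 n x y := by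
  intro i h0 hn
  obtain ⟨j, rfl⟩ := Int.eq_ofNat_of_zero_le h0
  exact h j (by omega)

theorem integrable_of_continuous {ν : Measure (TwoSided M)} [IsFiniteMeasure ν]
    {g : TwoSided M → ℝ} (hg : Continuous g) : Integrable g ν :=
  hg.integrable_of_hasCompactSupport (HasCompactSupport.of_compactSpace g)

section Mixing

variable {ψ : OneSided M → ℝ} {ν : Measure (TwoSided M)}

theorem IsGibbs.integral_comp_iterate_shift (hν : IsGibbs ψ ν) (n : ℕ) (g : TwoSided M → ℝ) :
    ∫ x, g ((shift M)^[n] x) ∂ν = ∫ x, g x ∂ν := by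
  have h := hν.measurePreserving.iterate n
  have he : MeasurableEmbedding ((shift M)^[n]) := by
    induction n with
    | zero => exact MeasurableEmbedding.id
    | succ n ih =>
      rw [Function.iterate_succ']
      exact (shift M).measurableEmbedding.comp (ih (hν.measurePreserving.iterate n))
  exact h.integral_comp he g

/-- Exponential mixing of `ν`, relative in the past: the error is proportional to the integral of
the nonnegative function `U` of the coordinates in `[-a, l]`, and the rate depends only on the gap
`n` between the coordinates of `U` and those of `V`. -/
theorem exists_mixing (hM : IsTransitionMatrix M) (hψ : IsHolderPlus ψ) (hψ1 : IsNormalized ψ)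
    (hν : IsGibbs ψ ν) :
    ∃ D ρ : ℝ, 0 < D ∧ 0 < ρ ∧ ρ < 1 ∧ ∀ (a l n : ℕ) (b : ℤ) (U V : TwoSided M → ℝ),
      (∀ x, 0 ≤ U x) → (∀ x y, Agree (-a) l x y → U x = U y) →
      (∀ x y, Agree (l + n) b x y → V x = V y) →
      |∫ x, U x * V x ∂ν - (∫ x, U x ∂ν) * ∫ x, V x ∂ν| ≤
        D * ρ ^ n * (∫ x, U x ∂ν) * ∫ x, |V x| ∂ν := by
  obtain ⟨D, ρ, hD, h0, h1, H⟩ := exists_mixing_plus hM hψ hψ1 hν.map_future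
  refine ⟨D, ρ, hD, h0, h1, fun a l n b U V hU0 hU hV => ?_⟩
  -- after `a` shifts, both functions depend on the coordinates of nonnegative index only; composed
  -- with an arbitrary section `ext` of the projection they become functions on `𝕏⁺`
  choose ext hext using future_surjective hM
  have hmap : ∀ g : OneSided M → ℝ, Continuous g →
      ∫ z, g z ∂(ν.map (future M)) = ∫ x, g (future M x) ∂ν := fun g hg =>
    integral_map continuous_future.aemeasurable hg.aestronglyMeasurable
  have hext_agree : ∀ (z : OneSided M) (x : TwoSided M) (j : ℕ) , AgreePlus (j + 1) (future M x) z →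
      Agree 0 j x (ext z) := fun z x j h =>
    agree_of_agreePlus_future (by rwa [hext])
  set u : OneSided M → ℝ := fun z => U ((shift M)^[a] (ext z)) with hu
  set v : OneSided M → ℝ := fun z => V ((shift M).symm^[l + n] (ext z)) with hv
  have hu' : ∀ z z', AgreePlus (a + l + 1) z z' → u z = u z' := by
    intro z z' h
    refine hU _ _ ?_
    have := (hext_agree z' (ext z) (a + l) (by rwa [hext])).iterate_shift a
    exact this.mono (by omega) (by push_cast; omega)
  have hv' : ∀ z z', AgreePlus ((b - l - n).toNat + 1) z z' → v z = v z' := by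
    intro z z' h
    refine hV _ _ ?_
    have := (hext_agree z' (ext z) (b - l - n).toNat (by rwa [hext])).iterate_shift_symm (l + n)
    exact this.mono (by push_cast; omega) (by push_cast; omega)
  have hUu : ∀ x, U ((shift M)^[a] x) = u (future M x) := by
    intro x
    refine hU _ _ ?_
    have := (hext_agree (future M x) x (a + l) (fun _ _ => rfl)).iterate_shift a
    exact this.mono (by omega) (by push_cast; omega)
  have hVv : ∀ x, V x = v (future M ((shift M)^[l + n] x)) := by
    intro x
    refine hV _ _ ?_
    have := (hext_agree (future M ((shift M)^[l + n] x)) ((shift M)^[l + n] x) (b - l - n).toNat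
      (fun _ _ => rfl)).iterate_shift_symm (l + n)
    have e : (shift M).symm^[l + n] ((shift M)^[l + n] x) = x :=
      (Function.LeftInverse.iterate (shift M).symm_apply_apply _) x
    rw [e] at this
    exact this.mono (by push_cast; omega) (by push_cast; omega)
  have huc := continuous_of_agreePlus hu'
  have hvc := continuous_of_agreePlus hv'
  have key := H (a + l) n u v (fun z => hU0 _) hu' hvc
  have huv : Continuous fun z => u z * v ((shiftPlus M)^[a + l + n] z) :=
    huc.mul (hvc.comp (continuous_shiftPlus.iterate _))
  rw [hmap _ huc, hmap _ hvc, hmap _ hvc.abs, hmap _ huv] at key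
  have i1 : ∫ x, u (future M x) ∂ν = ∫ x, U x ∂ν := by
    rw [← hν.integral_comp_iterate_shift a U]
    exact integral_congr_ae (ae_of_all _ fun x => (hUu x).symm)
  have i2 : ∫ x, v (future M x) ∂ν = ∫ x, V x ∂ν :=
    (hν.integral_comp_iterate_shift (l + n) fun x => v (future M x)).symm.trans
      (integral_congr_ae (ae_of_all _ fun x => (hVv x).symm))
  have i3 : ∫ x, |v (future M x)| ∂ν = ∫ x, |V x| ∂ν :=
    (hν.integral_comp_iterate_shift (l + n) fun x => |v (future M x)|).symm.trans
      (integral_congr_ae (ae_of_all _ fun x => congrArg abs (hVv x).symm))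
  have i4 : ∫ x, u (future M x) * v ((shiftPlus M)^[a + l + n] (future M x)) ∂ν =
      ∫ x, U x * V x ∂ν := by
    rw [← hν.integral_comp_iterate_shift a (fun x => U x * V x)]
    refine integral_congr_ae (ae_of_all _ fun x => ?_)
    show u (future M x) * v ((shiftPlus M)^[a + l + n] (future M x)) =
      U ((shift M)^[a] x) * V ((shift M)^[a] x)
    rw [hUu, hVv, ← future_iterate_shift, ← Function.iterate_add_apply,
      show a + l + n = l + n + a by ring]
  rw [i1, i2, i3, i4] at key
  exact key

/-- `ν` has full support. -/
theorem integral_pos_of_agree (hM : IsTransitionMatrix M) (hψ : IsHolderPlus ψ)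
    (hν : IsGibbs ψ ν) {a b : ℕ} {U : TwoSided M → ℝ} (hU0 : ∀ x, 0 ≤ U x)
    (hU : ∀ x y, Agree (-a) b x y → U x = U y) {y : TwoSided M} (hy : 0 < U y) :
    0 < ∫ x, U x ∂ν := by
  choose ext hext using future_surjective hM
  have hext_agree : ∀ (z : OneSided M) (x : TwoSided M) (j : ℕ) , AgreePlus (j + 1) (future M x) z →
      Agree 0 j x (ext z) := fun z x j h =>
    agree_of_agreePlus_future (by rwa [hext])
  set u : OneSided M → ℝ := fun z => U ((shift M)^[a] (ext z)) with hu
  have hu' : ∀ z z', AgreePlus (a + b + 1) z z' → u z = u z' := by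
    intro z z' h
    refine hU _ _ ?_
    have := (hext_agree z' (ext z) (a + b) (by rwa [hext])).iterate_shift a
    exact this.mono (by omega) (by push_cast; omega)
  have hUu : ∀ x, U ((shift M)^[a] x) = u (future M x) := by
    intro x
    refine hU _ _ ?_
    have := (hext_agree (future M x) x (a + b) (fun _ _ => rfl)).iterate_shift a
    exact this.mono (by omega) (by push_cast; omega)
  have e : (shift M)^[a] ((shift M).symm^[a] y) = y :=
    (Function.LeftInverse.iterate (shift M).apply_symm_apply _) y
  have h1 : 0 < u (future M ((shift M).symm^[a] y)) := by rw [← hUu, e]; exact hy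
  have := integral_pos_of_agreePlus hM hψ hν.map_future (fun z => hU0 _) hu' h1
  rw [integral_map continuous_future.aemeasurable
    (continuous_of_agreePlus hu').aestronglyMeasurable] at this
  rw [← hν.integral_comp_iterate_shift a U]
  simpa only [hUu] using this

/-- Hölder continuity on `𝕏`, with its constants, in terms of the windows `[-n, n]`. -/
structure IsHolderWith (C α : ℝ) (f : TwoSided M → ℝ) : Prop where
  pos : 0 < C
  exp_pos : 0 < α
  exp_lt_one : α < 1
  abs_sub_le : ∀ (n : ℕ) x y, Agree (-n) n x y → |f x - f y| ≤ C * α ^ n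

theorem IsHolder.exists_isHolderWith {f : TwoSided M → ℝ} (hf : IsHolder f) :
    ∃ C α, IsHolderWith C α f := by
  obtain ⟨C, α, hC, h0, h1, h⟩ := hf
  refine ⟨C, α, hC, h0, h1, fun n x y hz => ?_⟩
  by_cases e : x = y
  · subst e; rw [sub_self, abs_zero]; positivity
  · refine (h x y e).trans (mul_le_mul_of_nonneg_left ?_ hC.le)
    refine pow_le_pow_of_le_one h0.le h1.le (le_csInf ?_ fun j hj => ?_)
    · by_contra hne
      rw [Set.not_nonempty_iff_eq_empty] at hne
      refine e (Subtype.ext (funext fun j => ?_))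
      by_contra hj
      refine (Set.eq_empty_iff_forall_notMem.1 hne) j.natAbs ?_
      rcases Int.natAbs_eq j with h | h
      · exact Or.inl (by rw [← h]; exact hj)
      · exact Or.inr (by rw [← h]; exact hj)
    · by_contra hlt
      rcases hj with hj | hj
      · exact hj (hz j (by omega) (by omega))
      · exact hj (hz (-j) (by omega) (by omega))

theorem isHolder_of_agree {g : TwoSided M → ℝ} {C α : ℝ} (hC : 0 < C) (h0 : 0 < α) (h1 : α < 1)
    (hg : ∀ (n : ℕ) x y, Agree (-n) n x y → |g x - g y| ≤ C * α ^ n)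
    (hb : ∀ x y, |g x - g y| ≤ C) : IsHolder g := by
  refine ⟨C / α, α, by positivity, h0, h1, fun x y _ => ?_⟩
  rcases Nat.eq_zero_or_pos (sep x y) with h | h
  · rw [h, pow_zero, mul_one]
    exact (hb x y).trans ((le_div_iff₀ h0).2 (by nlinarith))
  · obtain ⟨n, hn⟩ : ∃ n, sep x y = n + 1 := ⟨sep x y - 1, by omega⟩
    rw [hn, pow_succ, div_mul_eq_mul_div, ← mul_assoc, mul_div_assoc, div_self h0.ne', mul_one]
    refine hg n x y fun i hi hi' => ?_
    by_contra hne
    have hlt : i.natAbs < sep x y := by omega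
    refine Nat.notMem_of_lt_sInf hlt ?_
    rcases Int.natAbs_eq i with h | h
    · exact Or.inl (by rw [← h]; exact hne)
    · exact Or.inr (by rw [← h]; exact hne)

theorem IsHolderWith.continuous {C α : ℝ} {f : TwoSided M → ℝ} (hf : IsHolderWith C α f) :
    Continuous f := by
  refine continuous_iff_continuousAt.2 fun z => Metric.tendsto_nhds.2 fun ε hε => ?_
  have h1 : Tendsto (fun n : ℕ => C * α ^ n) atTop (𝓝 (C * 0)) :=
    (tendsto_pow_atTop_nhds_zero_of_lt_one hf.exp_pos.le hf.exp_lt_one).const_mul C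
  rw [mul_zero] at h1
  obtain ⟨n, hn⟩ := (h1.eventually (gt_mem_nhds hε)).exists
  filter_upwards [eventually_agree (-n) n z] with z' hz'
  exact (hf.abs_sub_le n z' z hz').trans_lt hn

theorem exists_mixing_abs (hM : IsTransitionMatrix M) (hψ : IsHolderPlus ψ)
    (hψ1 : IsNormalized ψ) (hν : IsGibbs ψ ν) :
    ∃ D ρ : ℝ, 0 < D ∧ 0 < ρ ∧ ρ < 1 ∧ ∀ (a l n : ℕ) (b : ℤ) (U V : TwoSided M → ℝ),
      (∀ x y, Agree (-a) l x y → U x = U y) →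
      (∀ x y, Agree (l + n) b x y → V x = V y) →
      |∫ x, U x * V x ∂ν - (∫ x, U x ∂ν) * ∫ x, V x ∂ν| ≤
        D * ρ ^ n * (∫ x, |U x| ∂ν) * ∫ x, |V x| ∂ν := by
  obtain ⟨D, ρ, hD, h0, h1, H⟩ := exists_mixing hM hψ hψ1 hν
  have := hν.isProbabilityMeasure
  refine ⟨D, ρ, hD, h0, h1, fun a l n b U V hU hV => ?_⟩
  have hUc := continuous_of_agree hU
  have hVc := continuous_of_agree hV
  have h1 := H a l n b (fun x => max (U x) 0) V (fun x => le_max_right _ _)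
    (fun x y h => by rw [hU x y h]) hV
  have h2 := H a l n b (fun x => max (-U x) 0) V (fun x => le_max_right _ _)
    (fun x y h => by rw [hU x y h]) hV
  have e : ∀ x, U x = max (U x) 0 - max (-U x) 0 := fun x => by
    rcases le_total (U x) 0 with h | h
    · rw [max_eq_right h, max_eq_left (by linarith)]; ring
    · rw [max_eq_left h, max_eq_right (by linarith)]; ring
  have e' : ∀ x, |U x| = max (U x) 0 + max (-U x) 0 := fun x => by
    rcases le_total (U x) 0 with h | h
    · rw [max_eq_right h, max_eq_left (by linarith), abs_of_nonpos h]; ring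
    · rw [max_eq_left h, max_eq_right (by linarith), abs_of_nonneg h]; ring
  have c1 : Continuous fun x => max (U x) 0 := by fun_prop
  have c2 : Continuous fun x => max (-U x) 0 := by fun_prop
  have i1 : ∫ x, U x * V x ∂ν = ∫ x, max (U x) 0 * V x ∂ν - ∫ x, max (-U x) 0 * V x ∂ν := by
    have d1 : Continuous fun x => max (U x) 0 * V x := c1.mul hVc
    have d2 : Continuous fun x => max (-U x) 0 * V x := c2.mul hVc
    rw [← integral_sub (integrable_of_continuous d1) (integrable_of_continuous d2)]
    refine integral_congr_ae (ae_of_all _ fun x => ?_)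
    show U x * V x = max (U x) 0 * V x - max (-U x) 0 * V x
    rw [← sub_mul, ← e]
  have i2 : ∫ x, U x ∂ν = ∫ x, max (U x) 0 ∂ν - ∫ x, max (-U x) 0 ∂ν := by
    rw [← integral_sub (integrable_of_continuous c1) (integrable_of_continuous c2)]
    exact integral_congr_ae (ae_of_all _ e)
  have i3 : ∫ x, |U x| ∂ν = ∫ x, max (U x) 0 ∂ν + ∫ x, max (-U x) 0 ∂ν := by
    rw [← integral_add (integrable_of_continuous c1) (integrable_of_continuous c2)]
    exact integral_congr_ae (ae_of_all _ e')
  rw [i1, i2, i3]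
  rw [abs_le] at h1 h2 ⊢
  constructor <;> nlinarith [h1.1, h1.2, h2.1, h2.2]

/-- Decay of correlations between a function of the coordinates in `[-a, l]` and a centred Hölder
function evaluated along the orbit after time `l`. -/
theorem exists_decay (hM : IsTransitionMatrix M) (hψ : IsHolderPlus ψ)
    (hψ1 : IsNormalized ψ) (hν : IsGibbs ψ ν) {f : TwoSided M → ℝ} (hf : IsHolder f)
    (hf0 : ∫ x, f x ∂ν = 0) :
    ∃ D θ : ℝ, 0 < D ∧ 0 < θ ∧ θ < 1 ∧ ∀ (a l n : ℕ) (U : TwoSided M → ℝ),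
      (∀ x y, Agree (-a) l x y → U x = U y) →
      |∫ x, U x * f ((shift M)^[l + 2 * n] x) ∂ν| ≤ D * θ ^ n * ∫ x, |U x| ∂ν := by
  obtain ⟨D, ρ, hD, h0, h1, H⟩ := exists_mixing_abs hM hψ hψ1 hν
  obtain ⟨C, α, hC⟩ := hf.exists_isHolderWith
  have := hν.isProbabilityMeasure
  have hα0 := hC.exp_pos
  have hC0 := hC.pos
  have hfc := hC.continuous
  obtain ⟨F, hF⟩ := (isCompact_range hfc.abs).bddAbove
  replace hF : ∀ x, |f x| ≤ F := fun x => hF ⟨x, rfl⟩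
  have hne : Nonempty (TwoSided M) := by
    by_contra he
    rw [not_nonempty_iff] at he
    exact IsProbabilityMeasure.ne_zero ν (Measure.eq_zero_of_isEmpty ν)
  have hF0 : 0 ≤ F := (abs_nonneg _).trans (hF hne.some)
  refine ⟨2 * C + D * F, max ρ α, by positivity, lt_max_of_lt_left h0, max_lt h1 hC.exp_lt_one,
    fun a l n U hU => ?_⟩
  obtain ⟨R, hR1, hR2⟩ := exists_representative M (-(n : ℤ)) n
  have hUc := continuous_of_agree hU
  have hg : ∀ x y, Agree (-(n : ℤ)) n x y → f (R x) = f (R y) := fun x y h => by rw [hR2 x y h]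
  have hgc := continuous_of_agree hg
  set τ := (shift M)^[l + 2 * n] with hτ
  have hτc : Continuous τ := (shift M).continuous.iterate _
  have hV : ∀ x y, Agree (l + n) (l + 3 * n) x y → f (R (τ x)) = f (R (τ y)) := fun x y h =>
    hg _ _ ((h.iterate_shift (l + 2 * n)).mono (by push_cast; omega) (by push_cast; omega))
  have hfg : ∀ x, |f x - f (R x)| ≤ C * α ^ n := fun x => hC.abs_sub_le n _ _ (hR1 x).symm
  have hmean : |∫ x, f (R x) ∂ν| ≤ C * α ^ n := by
    have : ∫ x, f (R x) ∂ν = ∫ x, (f (R x) - f x) ∂ν := by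
      rw [integral_sub (integrable_of_continuous hgc) (integrable_of_continuous hfc), hf0, sub_zero]
    rw [this, ← Real.norm_eq_abs]
    refine (norm_integral_le_of_norm_le_const (C := C * α ^ n)
      (ae_of_all ν fun x => ?_)).trans
      (le_of_eq (by rw [probReal_univ, mul_one]))
    rw [Real.norm_eq_abs, abs_sub_comm]
    exact hfg x
  have hmean' : ∫ x, f (R (τ x)) ∂ν = ∫ x, f (R x) ∂ν :=
    hν.integral_comp_iterate_shift (l + 2 * n) fun x => f (R x)
  have key := H a l n (l + 3 * n) U (fun x => f (R (τ x))) hU hV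
  have hVF : ∫ x, |f (R (τ x))| ∂ν ≤ F := by
    calc _ ≤ ∫ _, F ∂ν := integral_mono (integrable_of_continuous (hgc.comp hτc).abs)
          (integrable_const _) fun x => hF _
      _ = F := by simp
  set I := ∫ x, |U x| ∂ν with hI
  have hI0 : 0 ≤ I := integral_nonneg fun x => abs_nonneg _
  have hUI : |∫ x, U x ∂ν| ≤ I := abs_integral_le_integral_abs
  have hdiff : |∫ x, U x * f (τ x) ∂ν - ∫ x, U x * f (R (τ x)) ∂ν| ≤ C * α ^ n * I := by
    have d1 : Continuous fun x => U x * f (τ x) := hUc.mul (hfc.comp hτc)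
    have d2 : Continuous fun x => U x * f (R (τ x)) := hUc.mul (hgc.comp hτc)
    rw [← integral_sub (integrable_of_continuous d1) (integrable_of_continuous d2), hI,
      ← integral_const_mul]
    rw [← Real.norm_eq_abs]
    refine norm_integral_le_of_norm_le (μ := ν) ((integrable_of_continuous hUc.abs).const_mul _)
      (ae_of_all _ fun x => ?_)
    rw [← mul_sub, norm_mul, mul_comm]
    exact mul_le_mul_of_nonneg_right (hfg _) (norm_nonneg _)
  have hp : |(∫ x, U x ∂ν) * ∫ x, f (R (τ x)) ∂ν| ≤ I * (C * α ^ n) := by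
    rw [abs_mul, hmean']
    exact mul_le_mul hUI hmean (abs_nonneg _) hI0
  have hkey : |∫ x, U x * f (R (τ x)) ∂ν - (∫ x, U x ∂ν) * ∫ x, f (R (τ x)) ∂ν| ≤
      D * ρ ^ n * I * F :=
    key.trans (mul_le_mul_of_nonneg_left hVF (by positivity))
  have hα' : α ^ n ≤ max ρ α ^ n := pow_le_pow_left₀ hα0.le (le_max_right _ _) n
  have hρ' : ρ ^ n ≤ max ρ α ^ n := pow_le_pow_left₀ h0.le (le_max_left _ _) n
  calc |∫ x, U x * f (τ x) ∂ν| ≤ C * α ^ n * I + D * ρ ^ n * I * F + I * (C * α ^ n) := by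
        rw [abs_le] at *
        constructor <;> linarith [hdiff.1, hdiff.2, hp.1, hp.2, hkey.1, hkey.2]
    _ = (2 * C * I) * α ^ n + (D * F * I) * ρ ^ n := by ring
    _ ≤ (2 * C * I) * max ρ α ^ n + (D * F * I) * max ρ α ^ n := by gcongr
    _ = _ := by ring

end Mixing

/-! ### Birkhoff sums bounded above and coboundaries -/

theorem isOpen_of_agree {a b : ℤ} {s : Set (TwoSided M)}
    (hs : ∀ x y, Agree a b x y → x ∈ s → y ∈ s) : IsOpen s :=
  isOpen_iff_eventually.2 fun x hx => by
    filter_upwards [eventually_agree a b x] with y hy using hs x y hy.symm hx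

theorem exists_agree_subset {x : TwoSided M} {s : Set (TwoSided M)} (hs : s ∈ 𝓝 x) :
    ∃ n : ℕ, ∀ y, Agree (-n) n y x → y ∈ s := by
  by_contra! h
  choose y hy hys using h
  have : Tendsto y atTop (𝓝 x) := by
    refine tendsto_subtype_rng.2 (tendsto_pi_nhds.2 fun i => ?_)
    refine tendsto_const_nhds.congr' ?_
    filter_upwards [eventually_ge_atTop i.natAbs] with n hn
    exact (hy n i (by omega) (by omega)).symm
  obtain ⟨n, hn⟩ := (this.eventually hs).exists
  exact hys n hn

theorem sum_pow_le {α : ℝ} (h0 : 0 < α) (h1 : α < 1) (n : ℕ) :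
    ∑ i ∈ Finset.range n, α ^ i ≤ 1 / (1 - α) := by
  rw [one_div, ← tsum_geometric_of_lt_one h0.le h1]
  exact (summable_geometric_of_lt_one h0.le h1).sum_le_tsum _ fun i _ => pow_nonneg h0.le i

theorem sum_pow_sub_le {α : ℝ} (h0 : 0 < α) (h1 : α < 1) {i n : ℕ} (hi : i ≤ n) :
    ∑ j ∈ Finset.range i, α ^ (n - j) ≤ 1 / (1 - α) := by
  refine le_trans ?_ (sum_pow_le h0 h1 n)
  rw [← Finset.sum_range_reflect (fun j => α ^ j) n]
  calc ∑ j ∈ Finset.range i, α ^ (n - j) ≤ ∑ j ∈ Finset.range i, α ^ (n - 1 - j) :=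
        Finset.sum_le_sum fun j _ => pow_le_pow_of_le_one h0.le h1.le (by omega)
    _ ≤ _ := Finset.sum_le_sum_of_subset_of_nonneg (Finset.range_mono hi)
        fun j _ _ => pow_nonneg h0.le _

section Birkhoff

variable {f : TwoSided M → ℝ} {C α : ℝ}

/-- Bounded distortion of the Birkhoff sums `S_i f`, `i ≤ n`. -/
theorem IsHolderWith.abs_birkhoffSum_sub_le (hf : IsHolderWith C α f) {m n i : ℕ} (hi : i ≤ n)
    {x y : TwoSided M} (h : Agree (-m) (n + m) x y) :
    |birkhoffSum (shift M) f i x - birkhoffSum (shift M) f i y| ≤ 2 * C / (1 - α) * α ^ m := by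
  have h0 := hf.exp_pos
  have h1 := hf.exp_lt_one
  have hC := hf.pos
  rw [birkhoffSum, birkhoffSum, ← Finset.sum_sub_distrib]
  refine (Finset.abs_sum_le_sum_abs _ _).trans ?_
  have hterm : ∀ j ∈ Finset.range i, |f ((shift M)^[j] x) - f ((shift M)^[j] y)| ≤
      C * α ^ m * (α ^ j + α ^ (n - j)) := by
    intro j hj
    have hj := Finset.mem_range.1 hj
    have ha := h.iterate_shift j
    rcases le_total (m + j) (m + (n - j)) with hle | hle
    · refine (hf.abs_sub_le (m + j) _ _ (ha.mono (by push_cast; omega) (by push_cast; omega))).trans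
        ?_
      rw [pow_add, mul_assoc]
      gcongr
      have := pow_nonneg h0.le (n - j)
      linarith
    · refine (hf.abs_sub_le (m + (n - j)) _ _
        (ha.mono (by push_cast; omega) (by push_cast; omega))).trans ?_
      rw [pow_add, mul_assoc]
      gcongr
      have := pow_nonneg h0.le j
      linarith
  refine (Finset.sum_le_sum hterm).trans ?_
  rw [← Finset.mul_sum, Finset.sum_add_distrib]
  calc C * α ^ m * _ ≤ C * α ^ m * (1 / (1 - α) + 1 / (1 - α)) := by
        gcongr
        · exact sum_pow_le h0 h1 i
        · exact sum_pow_sub_le h0 h1 hi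
    _ = _ := by ring

theorem birkhoffSum_le_mul {F : ℝ} (hF : ∀ x, f x ≤ F) (n : ℕ) (x : TwoSided M) :
    birkhoffSum (shift M) f n x ≤ n * F := by
  refine (Finset.sum_le_card_nsmul _ _ F fun i _ => hF _).trans (le_of_eq ?_)
  rw [Finset.card_range, nsmul_eq_mul]

end Birkhoff

section Coboundary

/-- The point with the past of `y` and the future of `x`. -/
def glue (y x : TwoSided M) (h : y.1 0 = x.1 0) : TwoSided M :=
  ⟨fun i => if i ≤ 0 then y.1 i else x.1 i, fun i => by
    by_cases h1 : i + 1 ≤ 0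
    · have h2 : i ≤ 0 := by omega
      simp only [h1, h2, if_true]
      exact y.2 i
    · by_cases h2 : i ≤ 0
      · obtain rfl : i = 0 := by omega
        simp only [h1, h2, if_true, if_false, h]
        exact x.2 0
      · simp only [h1, h2, if_false]
        exact x.2 i⟩

variable {f : TwoSided M → ℝ} {C α : ℝ}

/-- The total difference of `f` along the forward orbits of two points. -/
def forwardDiff (f : TwoSided M → ℝ) (y x : TwoSided M) : ℝ :=
  ∑' i : ℕ, (f ((shift M)^[i] y) - f ((shift M)^[i] x))

theorem IsHolderWith.abs_sub_iterate_le (hf : IsHolderWith C α f) {x y : TwoSided M}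
    (h : ∀ i : ℤ, 0 ≤ i → y.1 i = x.1 i) (i : ℕ) :
    |f ((shift M)^[i] y) - f ((shift M)^[i] x)| ≤ C * α ^ i := by
  refine hf.abs_sub_le i _ _ fun j h1 _ => ?_
  rw [iterate_shift_apply, iterate_shift_apply]
  exact h _ (by omega)

theorem IsHolderWith.summable_forwardDiff (hf : IsHolderWith C α f) {x y : TwoSided M}
    (h : ∀ i : ℤ, 0 ≤ i → y.1 i = x.1 i) :
    Summable fun i : ℕ => f ((shift M)^[i] y) - f ((shift M)^[i] x) :=
  Summable.of_norm_bounded ((summable_geometric_of_lt_one hf.exp_pos.le hf.exp_lt_one).mul_left C)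
    fun i => hf.abs_sub_iterate_le h i

/-- A pair `(n, y)` where `y` has the same future as `x`. -/
abbrev History (x : TwoSided M) : Type :=
  {p : ℕ × TwoSided M // ∀ i : ℤ, 0 ≤ i → p.2.1 i = x.1 i}

/-- The sum of `f` along the last `n` steps before `y` and along the forward orbit of `y`,
relative to the sum along the forward orbit of `x`. -/
def historySum (f : TwoSided M → ℝ) (x : TwoSided M) (p : History x) : ℝ :=
  birkhoffSum (shift M) f p.1.1 ((shift M).symm^[p.1.1] p.1.2) + forwardDiff f p.1.2 x

theorem iterate_shift_symm_cancel (n : ℕ) (y : TwoSided M) :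
    (shift M)^[n] ((shift M).symm^[n] y) = y :=
  (Function.LeftInverse.iterate (shift M).apply_symm_apply _) y

/-- The transfer function is `g x = sup (S_n f (T⁻ⁿ y) + ∑ᵢ (f (Tⁱ y) - f (Tⁱ x)))`, over `n ≥ 0`
and over the points `y` with the future of `x`. It is Hölder and satisfies `g ∘ T ≥ g + f`; since
`f` has mean zero and `ν` has full support, equality holds everywhere. -/
theorem isCoboundary_of_birkhoffSum_le (hM : IsTransitionMatrix M) {ψ : OneSided M → ℝ}
    (hψ : IsHolderPlus ψ) {ν : Measure (TwoSided M)} (hν : IsGibbs ψ ν)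
    (hf : IsHolderWith C α f) (hf0 : ∫ x, f x ∂ν = 0) {B : ℝ}
    (hB : ∀ n x, birkhoffSum (shift M) f n x ≤ B) : IsCoboundary f := by
  have h0 := hf.exp_pos
  have h1 := hf.exp_lt_one
  have hC := hf.pos
  have h1α : 0 < 1 - α := by linarith
  have := hν.isProbabilityMeasure
  have hgeom := summable_geometric_of_lt_one h0.le h1
  have htsum : ∑' i : ℕ, C * α ^ i = C / (1 - α) := by
    rw [tsum_mul_left, tsum_geometric_of_lt_one h0.le h1]; rfl
  have hD : ∀ (x y : TwoSided M), (∀ i : ℤ, 0 ≤ i → y.1 i = x.1 i) →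
      forwardDiff f y x ≤ C / (1 - α) := by
    intro x y h
    rw [← htsum]
    exact (hf.summable_forwardDiff h).tsum_le_tsum
      (fun i => (le_abs_self _).trans (hf.abs_sub_iterate_le h i)) (hgeom.mul_left C)
  have hG : ∀ x p, historySum f x p ≤ B + C / (1 - α) := fun x p =>
    add_le_add (hB _ _) (hD _ _ p.2)
  let base : ∀ x : TwoSided M, History x := fun x => ⟨(0, x), fun _ _ => rfl⟩
  have hbase : ∀ x, historySum f x (base x) = 0 := fun x => by
    simp [historySum, forwardDiff, base]
  set g : TwoSided M → ℝ := fun x => ⨆ p, historySum f x p with hg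
  have hbdd : ∀ x, BddAbove (Set.range (historySum f x)) := fun x =>
    ⟨_, by rintro _ ⟨p, rfl⟩; exact hG x p⟩
  have hne : ∀ x : TwoSided M, Nonempty (History x) := fun x => ⟨base x⟩
  have hg0 : ∀ x, 0 ≤ g x := fun x => by
    rw [← hbase x]; exact le_ciSup (hbdd x) (base x)
  have hgB : ∀ x, g x ≤ B + C / (1 - α) := fun x => ciSup_le (hG x)
  -- moving one step along the orbit adds `f x` to every competitor of the supremum
  have hsub : ∀ x, g x + f x ≤ g (shift M x) := by
    intro x
    rw [← le_sub_iff_add_le]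
    refine ciSup_le fun p => ?_
    rw [le_sub_iff_add_le]
    obtain ⟨⟨n, y⟩, hy⟩ := p
    let q : History (shift M x) := ⟨(n + 1, shift M y), fun i hi => hy (i + 1) (by omega)⟩
    refine le_trans (le_of_eq ?_) (le_ciSup (hbdd (shift M x)) q)
    show birkhoffSum (shift M) f n ((shift M).symm^[n] y) + forwardDiff f y x + f x =
      birkhoffSum (shift M) f (n + 1) ((shift M).symm^[n + 1] (shift M y)) +
        forwardDiff f (shift M y) (shift M x)
    have e1 : forwardDiff f y x = (f y - f x) + forwardDiff f (shift M y) (shift M x) :=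
      (hf.summable_forwardDiff hy).tsum_eq_zero_add
    rw [e1, Function.iterate_succ_apply, Homeomorph.symm_apply_apply, birkhoffSum_succ,
      iterate_shift_symm_cancel]
    ring
  -- a competitor for `x` becomes one for `x'` by gluing its past to the future of `x'`; agreement
  -- on `[-2m, 2m]` makes the first `m` terms of the forward differences close, and the others small
  have hhol : ∀ (m : ℕ) x x', Agree (-(2 * m)) (2 * m) x x' →
      g x ≤ g x' + 5 * C / (1 - α) * α ^ m := by
    intro m x x' hx
    refine ciSup_le fun p => ?_
    obtain ⟨⟨n, y⟩, hy⟩ := p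
    dsimp only at hy
    have e0 : y.1 0 = x'.1 0 := (hy 0 le_rfl).trans (hx 0 (by omega) (by omega))
    set y' := glue y x' e0 with hy'def
    have hy' : ∀ i : ℤ, 0 ≤ i → y'.1 i = x'.1 i := by
      intro i hi
      show (if i ≤ 0 then y.1 i else x'.1 i) = x'.1 i
      split_ifs with h
      · obtain rfl : i = 0 := by omega
        exact e0
      · rfl
    have hyy : ∀ i : ℤ, i ≤ 2 * m → y.1 i = y'.1 i := by
      intro i hi
      show y.1 i = if i ≤ 0 then y.1 i else x'.1 i
      split_ifs with h
      · rfl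
      · exact (hy i (by omega)).trans (hx i (by omega) hi)
    have hS : birkhoffSum (shift M) f n ((shift M).symm^[n] y) -
        birkhoffSum (shift M) f n ((shift M).symm^[n] y') ≤ C / (1 - α) * α ^ m := by
      rw [birkhoffSum, birkhoffSum, ← Finset.sum_sub_distrib]
      have hterm : ∀ j ∈ Finset.range n, f ((shift M)^[j] ((shift M).symm^[n] y)) -
          f ((shift M)^[j] ((shift M).symm^[n] y')) ≤ C * α ^ m * α ^ (n - j) := by
        intro j hj
        have hj := Finset.mem_range.1 hj
        refine (le_abs_self _).trans ((hf.abs_sub_le (m + (n - j)) _ _ fun i _ hi => ?_).trans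
          (le_of_eq (by rw [pow_add]; ring)))
        simp only [iterate_shift_apply, iterate_shift_symm_apply]
        exact hyy _ (by push_cast at hi; omega)
      refine (Finset.sum_le_sum hterm).trans ?_
      rw [← Finset.mul_sum]
      calc C * α ^ m * _ ≤ C * α ^ m * (1 / (1 - α)) := by
            gcongr
            exact sum_pow_sub_le h0 h1 le_rfl
        _ = _ := by ring
    have hF : forwardDiff f y x - forwardDiff f y' x' ≤ 4 * C / (1 - α) * α ^ m := by
      have s1 := hf.summable_forwardDiff hy
      have s2 := hf.summable_forwardDiff hy'
      rw [forwardDiff, forwardDiff, ← s1.tsum_sub s2, ← (s1.sub s2).sum_add_tsum_nat_add m]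
      have t1 : ∀ j ∈ Finset.range m, f ((shift M)^[j] y) - f ((shift M)^[j] x) -
          (f ((shift M)^[j] y') - f ((shift M)^[j] x')) ≤ 2 * C * α ^ m * α ^ (m - j) := by
        intro j hj
        have hj := Finset.mem_range.1 hj
        have a1 := (abs_le.1 (hf.abs_sub_le (m + (m - j)) ((shift M)^[j] y) ((shift M)^[j] y')
          fun i _ hi => by
            rw [iterate_shift_apply, iterate_shift_apply]
            exact hyy _ (by push_cast at hi; omega))).2
        have a2 := (abs_le.1 (hf.abs_sub_le (m + (m - j)) ((shift M)^[j] x) ((shift M)^[j] x')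
          ((hx.iterate_shift j).mono (by push_cast; omega) (by push_cast; omega)))).1
        rw [pow_add] at a1 a2
        linarith
      have t2 : ∀ j : ℕ, f ((shift M)^[j + m] y) - f ((shift M)^[j + m] x) -
          (f ((shift M)^[j + m] y') - f ((shift M)^[j + m] x')) ≤ 2 * C * α ^ m * α ^ j := by
        intro j
        have a1 := (abs_le.1 (hf.abs_sub_iterate_le hy (j + m))).2
        have a2 := (abs_le.1 (hf.abs_sub_iterate_le hy' (j + m))).1
        rw [pow_add] at a1 a2
        linarith
      have b1 := Finset.sum_le_sum t1
      have b2 := ((summable_nat_add_iff m).2 (s1.sub s2)).tsum_le_tsum t2 (hgeom.mul_left _)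
      rw [← Finset.mul_sum] at b1
      rw [tsum_mul_left, tsum_geometric_of_lt_one h0.le h1] at b2
      have b3 : 2 * C * α ^ m * ∑ j ∈ Finset.range m, α ^ (m - j) ≤
          2 * C * α ^ m * (1 / (1 - α)) := by
        gcongr
        exact sum_pow_sub_le h0 h1 le_rfl
      calc _ ≤ 2 * C * α ^ m * (1 / (1 - α)) + 2 * C * α ^ m * (1 - α)⁻¹ :=
            add_le_add (b1.trans b3) b2
        _ = _ := by rw [one_div]; ring
    have hle := le_ciSup (hbdd x') (⟨(n, y'), hy'⟩ : History x')
    change birkhoffSum (shift M) f n ((shift M).symm^[n] y') + forwardDiff f y' x' ≤ g x' at hle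
    show birkhoffSum (shift M) f n ((shift M).symm^[n] y) + forwardDiff f y x ≤ _
    calc _ ≤ g x' + (C / (1 - α) * α ^ m + 4 * C / (1 - α) * α ^ m) := by linarith
      _ = _ := by ring
  obtain ⟨E, θ, hE, hθ0, hθ1, hθ⟩ := exists_pow_div_le h0 h1 (p := 2) (by norm_num)
  have hgH : IsHolder g := by
    set A := 5 * C / (1 - α) with hA
    have hA0 : 0 < A := by positivity
    have hB0 : 0 ≤ B + C / (1 - α) := by
      rcases isEmpty_or_nonempty (TwoSided M) with he | ⟨⟨x⟩⟩
      · exact absurd (Measure.eq_zero_of_isEmpty ν) (IsProbabilityMeasure.ne_zero ν)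
      · exact (hg0 x).trans (hgB x)
    refine isHolder_of_agree (C := A * E + (B + C / (1 - α))) (α := θ) (by positivity) hθ0 hθ1
      (fun n x y h => ?_) fun x y => ?_
    · have hb : A * α ^ (n / 2) ≤ (A * E + (B + C / (1 - α))) * θ ^ n := by
        have i1 := mul_le_mul_of_nonneg_left (hθ n) hA0.le
        have i2 : 0 ≤ (B + C / (1 - α)) * θ ^ n := by positivity
        linarith
      have l1 := hhol (n / 2) x y (h.mono (by omega) (by omega))
      have l2 := hhol (n / 2) y x (h.symm.mono (by omega) (by omega))
      rw [abs_le]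
      constructor <;> linarith
    · have := hg0 x; have := hg0 y; have := hgB x; have := hgB y
      have : 0 ≤ A * E := by positivity
      rw [abs_le]
      constructor <;> linarith
  obtain ⟨C', α', hg'⟩ := hgH.exists_isHolderWith
  have hgc := hg'.continuous
  have hfc := hf.continuous
  refine ⟨g, hgH, fun x₀ => ?_⟩
  by_contra hne
  set h : TwoSided M → ℝ := fun x => g (shift M x) - g x - f x with hh
  have hh0 : ∀ x, 0 ≤ h x := fun x => by have := hsub x; simp only [hh]; linarith
  have hhx : 0 < h x₀ := by
    refine lt_of_le_of_ne (hh0 x₀) fun e => hne ?_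
    simp only [hh] at e; linarith
  have hgs : Continuous fun x => g (shift M x) := hgc.comp (shift M).continuous
  have hhc : Continuous h := (hgs.sub hgc).sub hfc
  have hint : ∫ x, h x ∂ν = 0 := by
    have e1 : ∫ x, g (shift M x) ∂ν = ∫ x, g x ∂ν := hν.integral_comp_iterate_shift 1 g
    have d : Continuous fun x => g (shift M x) - g x := hgs.sub hgc
    simp only [hh]
    rw [integral_sub (integrable_of_continuous d) (integrable_of_continuous hfc),
      integral_sub (integrable_of_continuous hgs) (integrable_of_continuous hgc), e1, hf0]
    ring
  -- `h` is nonnegative with zero integral, and would be at least `h x₀ / 2` on a cylinder of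
  -- positive measure
  obtain ⟨n, hn⟩ := exists_agree_subset (hhc.continuousAt.eventually
    (lt_mem_nhds (show h x₀ / 2 < h x₀ by linarith)))
  classical
  let U : TwoSided M → ℝ := fun x => if Agree (-(n : ℤ)) n x x₀ then 1 else 0
  have hU : ∀ x y, Agree (-(n : ℤ)) n x y → U x = U y := fun x y hxy => by
    have : Agree (-(n : ℤ)) n x x₀ ↔ Agree (-(n : ℤ)) n y x₀ :=
      ⟨fun h => hxy.symm.trans h, fun h => hxy.trans h⟩
    simp only [U, this]
  have hU0 : ∀ x, 0 ≤ U x := fun x => by simp only [U]; split_ifs <;> norm_num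
  have hpos := integral_pos_of_agree hM hψ hν hU0 hU (y := x₀)
    (by simp only [U]; rw [if_pos (Agree.refl _ _ _)]; norm_num)
  have : h x₀ / 2 * ∫ x, U x ∂ν ≤ ∫ x, h x ∂ν := by
    rw [← integral_const_mul]
    refine integral_mono ((integrable_of_continuous (continuous_of_agree hU)).const_mul _)
      (integrable_of_continuous hhc) fun x => ?_
    by_cases hx : Agree (-(n : ℤ)) n x x₀
    · simp only [U, if_pos hx, mul_one]
      exact (hn x hx).le
    · simp only [U, if_neg hx, mul_zero]
      exact hh0 x
  rw [hint] at this
  have := mul_pos (half_pos hhx) hpos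
  linarith

/-- The Birkhoff sums of `-f` are not bounded above, as `-f` is not a coboundary either. -/
theorem exists_birkhoffSum_lt (hM : IsTransitionMatrix M) {ψ : OneSided M → ℝ}
    (hψ : IsHolderPlus ψ) {ν : Measure (TwoSided M)} (hν : IsGibbs ψ ν)
    (hf : IsHolderWith C α f) (hf0 : ∫ x, f x ∂ν = 0) (hfc : ¬ IsCoboundary f) (K : ℝ) :
    ∃ n x, birkhoffSum (shift M) f n x < -K := by
  by_contra! H
  have hf' : IsHolderWith C α (fun x => -f x) := ⟨hf.pos, hf.exp_pos, hf.exp_lt_one,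
    fun n x y h => by rw [neg_sub_neg, abs_sub_comm]; exact hf.abs_sub_le n x y h⟩
  have hS : ∀ n x, birkhoffSum (shift M) (fun x => -f x) n x = -birkhoffSum (shift M) f n x :=
    fun n x => by simp [birkhoffSum]
  obtain ⟨g, ⟨C', α', hC', h0, h1, hg⟩, hgf⟩ := isCoboundary_of_birkhoffSum_le hM hψ hν hf'
    (by rw [integral_neg, hf0, neg_zero]) (B := K) fun n x => by rw [hS]; linarith [H n x]
  refine hfc ⟨fun x => -g x, ⟨C', α', hC', h0, h1, fun x y h => ?_⟩, fun x => ?_⟩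
  · rw [neg_sub_neg, abs_sub_comm]; exact hg x y h
  · linarith [hgf x]

end Coboundary

/-! ### Confinement of the Birkhoff sums -/

/-- The points whose Birkhoff sums up to time `n` stay above `-K` and whose `n`-th Birkhoff sum is
at most `K`. -/
def confined (f : TwoSided M → ℝ) (n : ℕ) (K : ℝ) : Set (TwoSided M) :=
  {x | (∀ i ≤ n, -K ≤ birkhoffSum (shift M) f i x) ∧ birkhoffSum (shift M) f n x ≤ K}

theorem continuous_birkhoffSum {f : TwoSided M → ℝ} (hf : Continuous f) (n : ℕ) :
    Continuous (birkhoffSum (shift M) f n) :=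
  continuous_finsetSum _ fun i _ => hf.comp ((shift M).continuous.iterate i)

theorem measurableSet_confined {f : TwoSided M → ℝ} (hf : Continuous f) (n : ℕ) (K : ℝ) :
    MeasurableSet (confined f n K) := by
  have : confined f n K = (⋂ i : ℕ, ⋂ _ : i ≤ n, {x | -K ≤ birkhoffSum (shift M) f i x}) ∩
      {x | birkhoffSum (shift M) f n x ≤ K} := by
    ext x; simp [confined]
  rw [this]
  refine (MeasurableSet.iInter fun i => MeasurableSet.iInter fun _ => ?_).inter ?_
  · exact (isClosed_le continuous_const (continuous_birkhoffSum hf i)).measurableSet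
  · exact (isClosed_le (continuous_birkhoffSum hf n) continuous_const).measurableSet

theorem confined_mono {f : TwoSided M → ℝ} {n : ℕ} {K K' : ℝ} (h : K ≤ K') :
    confined f n K ⊆ confined f n K' :=
  fun _ hx => ⟨fun i hi => (neg_le_neg h).trans (hx.1 i hi), hx.2.trans h⟩

/-- Up to an enlargement of `K`, confinement at time `n` is decided by the coordinates in
`[0, n]`. -/
theorem IsHolderWith.mem_confined_of_agree {f : TwoSided M → ℝ} {C α : ℝ}
    (hf : IsHolderWith C α f) {n : ℕ} {K : ℝ} {x y : TwoSided M} (hx : x ∈ confined f n K)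
    (h : Agree 0 n x y) : y ∈ confined f n (K + 2 * C / (1 - α)) := by
  have key : ∀ i ≤ n, |birkhoffSum (shift M) f i x - birkhoffSum (shift M) f i y| ≤
      2 * C / (1 - α) := fun i hi => by
    have := hf.abs_birkhoffSum_sub_le (m := 0) hi (h.mono (by simp) (by simp))
    rwa [pow_zero, mul_one] at this
  exact ⟨fun i hi => by linarith [hx.1 i hi, (abs_le.1 (key i hi)).2],
    by linarith [hx.2, (abs_le.1 (key n le_rfl)).1]⟩

/-- If an event at time `n` excludes all the events from time `n + N` on, then at most `N` of the
events occur. -/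
theorem sum_indicator_le {X : Type*} (E : ℕ → Set X) (N : ℕ)
    (hE : ∀ x n n', x ∈ E n → x ∈ E n' → n' < n + N) (m : ℕ) (x : X) :
    ∑ n ∈ Finset.range m, (E n).indicator (fun _ => (1 : ℝ)) x ≤ N := by
  classical
  by_cases hx : ∃ n, x ∈ E n
  · have hsub : (Finset.range m).filter (fun n => x ∈ E n) ⊆
        Finset.Ico (Nat.find hx) (Nat.find hx + N) := fun n hn => by
      have hn := (Finset.mem_filter.1 hn).2
      exact Finset.mem_Ico.2 ⟨Nat.find_min' hx hn, hE x _ n (Nat.find_spec hx) hn⟩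
    have e : ∑ n ∈ Finset.range m, (E n).indicator (fun _ => (1 : ℝ)) x =
        ((Finset.range m).filter (fun n => x ∈ E n)).card := by
      simp only [Set.indicator_apply, Finset.sum_boole]
    rw [e]
    exact_mod_cast (Finset.card_le_card hsub).trans (by simp)
  · push Not at hx
    rw [Finset.sum_eq_zero fun n _ => Set.indicator_of_notMem (hx n) _]
    exact Nat.cast_nonneg N

/-- The expected number of visits of the Birkhoff sums to a compact interval before they fall below
it is finite: after each visit they fall, within a bounded time, with a probability that is bounded
below. -/
theorem summable_confined (hM : IsTransitionMatrix M) {ψ : OneSided M → ℝ}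
    (hψ : IsHolderPlus ψ) (hψ1 : IsNormalized ψ) {ν : Measure (TwoSided M)} (hν : IsGibbs ψ ν)
    {f : TwoSided M → ℝ} {C α : ℝ} (hf : IsHolderWith C α f) (hf0 : ∫ x, f x ∂ν = 0)
    (hfc : ¬ IsCoboundary f) (K : ℝ) : Summable fun n => ν.real (confined f n K) := by
  classical
  have := hν.isProbabilityMeasure
  obtain ⟨D, ρ, hD, hρ0, hρ1, H⟩ := exists_mixing hM hψ hψ1 hν
  have hcont := hf.continuous
  obtain ⟨F, hF⟩ := (isCompact_range hcont).bddAbove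
  replace hF : ∀ x, f x ≤ F := fun x => hF ⟨x, rfl⟩
  obtain ⟨r, hr⟩ : ∃ r, D * ρ ^ r ≤ 1 / 2 := by
    have h1 : Tendsto (fun n : ℕ => D * ρ ^ n) atTop (𝓝 (D * 0)) :=
      (tendsto_pow_atTop_nhds_zero_of_lt_one hρ0.le hρ1).const_mul D
    rw [mul_zero] at h1
    exact (h1.eventually (ge_mem_nhds (by norm_num))).exists
  -- along the cylinder of `x₀`, the sum falls by so much that it drops below `-(K + c)` even from
  -- the height `K + c`, after a gap of `r` steps and a distortion `c`
  set c := 2 * C / (1 - α) with hc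
  obtain ⟨q, x₀, hx₀⟩ := exists_birkhoffSum_lt hM hψ hν hf hf0 hfc (2 * K + 3 * c + r * F)
  -- the saturation of `confined f n K` for the coordinates in `[0, n]`
  let Q : ℕ → Set (TwoSided M) := fun n => {x | ∃ y ∈ confined f n K, Agree 0 n x y}
  have hQ : ∀ (n : ℕ) x y, Agree 0 n x y → x ∈ Q n → y ∈ Q n := fun n x y h ⟨w, hw, hxw⟩ =>
    ⟨w, hw, h.symm.trans hxw⟩
  have hQc : ∀ n, Q n ⊆ confined f n (K + c) := fun n x ⟨y, hy, hxy⟩ =>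
    hf.mem_confined_of_agree hy hxy.symm
  let W : Set (TwoSided M) := {x | Agree 0 q x x₀}
  have hW : ∀ x y, Agree 0 q x y → x ∈ W → y ∈ W := fun x y h hx => h.symm.trans hx
  let U : ℕ → TwoSided M → ℝ := fun n => (Q n).indicator fun _ => 1
  let V : TwoSided M → ℝ := W.indicator fun _ => 1
  have hU : ∀ (n : ℕ) x y, Agree 0 n x y → U n x = U n y := fun n x y h => by
    have : x ∈ Q n ↔ y ∈ Q n := ⟨hQ n x y h, hQ n y x h.symm⟩
    simp only [U, Set.indicator_apply, this]
  have hV : ∀ x y, Agree 0 q x y → V x = V y := fun x y h => by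
    have : x ∈ W ↔ y ∈ W := ⟨hW x y h, hW y x h.symm⟩
    simp only [V, Set.indicator_apply, this]
  have hU0 : ∀ n x, 0 ≤ U n x := fun n x => Set.indicator_nonneg (fun _ _ => zero_le_one) x
  have hV0 : ∀ x, 0 ≤ V x := fun x => Set.indicator_nonneg (fun _ _ => zero_le_one) x
  set v := ∫ x, V x ∂ν with hv
  have hvpos : 0 < v := integral_pos_of_agree hM hψ hν (a := 0) (b := q) hV0
    (fun x y h => hV x y (h.mono (by simp) le_rfl)) (y := x₀) (by
      simp only [V]
      rw [Set.indicator_of_mem (show x₀ ∈ W from Agree.refl _ _ _)]; exact one_pos)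
  set τ : ℕ → TwoSided M → TwoSided M := fun n => (shift M)^[n + r] with hτ
  have hlow : ∀ n, 1 / 2 * v * ∫ x, U n x ∂ν ≤ ∫ x, U n x * V (τ n x) ∂ν := by
    intro n
    have hVn : ∀ x y, Agree (n + r) (n + r + q) x y → V (τ n x) = V (τ n y) := fun x y h =>
      hV _ _ ((h.iterate_shift (n + r)).mono (by push_cast; omega) (by push_cast; omega))
    have h1 := H 0 n r (n + r + q) (U n) (fun x => V (τ n x)) (hU0 n)
      (fun x y h => hU n x y (h.mono (by simp) le_rfl)) hVn
    have e1 : ∫ x, V (τ n x) ∂ν = v := hν.integral_comp_iterate_shift (n + r) V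
    have e2 : ∫ x, |V (τ n x)| ∂ν = v := by
      simp only [abs_of_nonneg (hV0 _)]; exact e1
    rw [e1, e2] at h1
    have hI : 0 ≤ ∫ x, U n x ∂ν := integral_nonneg (hU0 n)
    have h2 := (abs_le.1 h1).1
    have h3 : D * ρ ^ r * (∫ x, U n x ∂ν) * v ≤ 1 / 2 * (∫ x, U n x ∂ν) * v := by gcongr
    linarith
  let E : ℕ → Set (TwoSided M) := fun n =>
    {x | x ∈ Q n ∧ birkhoffSum (shift M) f (n + (r + q)) x < -(K + c)}
  have hUE : ∀ n x, U n x * V (τ n x) ≤ (E n).indicator (fun _ => (1 : ℝ)) x := by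
    intro n x
    by_cases hx : x ∈ Q n
    · by_cases hx' : τ n x ∈ W
      · have hE : x ∈ E n := by
          refine ⟨hx, ?_⟩
          rw [← add_assoc, birkhoffSum_add, birkhoffSum_add]
          have h1 := (hQc n hx).2
          have h2 := birkhoffSum_le_mul hF r ((shift M)^[n] x)
          have h3 := hf.abs_birkhoffSum_sub_le (m := 0) (le_refl q)
            (x := τ n x) (y := x₀) (Agree.mono hx' (by simp) (by simp))
          rw [pow_zero, mul_one] at h3
          have h4 := (abs_le.1 h3).2
          simp only [τ] at h4
          linarith
        simp only [U, V, Set.indicator_of_mem hx, Set.indicator_of_mem hx',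
          Set.indicator_of_mem hE, mul_one, le_refl]
      · simp only [V, Set.indicator_of_notMem hx', mul_zero]
        exact Set.indicator_nonneg (fun _ _ => zero_le_one) x
    · simp only [U, Set.indicator_of_notMem hx, zero_mul]
      exact Set.indicator_nonneg (fun _ _ => zero_le_one) x
  -- a sum below `-(K + c)` at time `n + (r + q)` excludes all later visits
  have hcount := sum_indicator_le E (r + q) fun x n n' hn hn' => by
    by_contra hlt
    have := (hQc n' hn'.1).1 (n + (r + q)) (not_lt.1 hlt)
    linarith [hn.2]
  have hUc : ∀ n, Continuous (U n) := fun n => continuous_of_agree (hU n)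
  have hVc : Continuous V := continuous_of_agree hV
  have hUVc : ∀ n, Continuous fun x => U n x * V (τ n x) := fun n =>
    (hUc n).mul (hVc.comp ((shift M).continuous.iterate _))
  refine summable_of_sum_range_le (c := 2 / v * (r + q : ℕ)) (fun n => measureReal_nonneg)
    fun m => ?_
  have hQm : ∀ n, ν.real (confined f n K) ≤ ∫ x, U n x ∂ν := fun n => by
    have hm : MeasurableSet (Q n) := (isOpen_of_agree (hQ n)).measurableSet
    have : ∫ x, U n x ∂ν = ν.real (Q n) := integral_indicator_one hm
    rw [this]
    exact measureReal_mono fun x hx => ⟨x, hx, Agree.refl _ _ _⟩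
  have hsum : ∑ n ∈ Finset.range m, ∫ x, U n x * V (τ n x) ∂ν ≤ (r + q : ℕ) := by
    rw [← integral_finsetSum _ fun n _ => integrable_of_continuous (hUVc n)]
    calc _ ≤ ∫ _, ((r + q : ℕ) : ℝ) ∂ν := by
          refine integral_mono (integrable_finsetSum _ fun n _ =>
            integrable_of_continuous (hUVc n)) (integrable_const _) fun x => ?_
          exact (Finset.sum_le_sum fun n _ => hUE n x).trans (hcount m x)
      _ = _ := by simp
  calc ∑ n ∈ Finset.range m, ν.real (confined f n K)
      ≤ ∑ n ∈ Finset.range m, 2 / v * ∫ x, U n x * V (τ n x) ∂ν := by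
        refine Finset.sum_le_sum fun n _ => (hQm n).trans ?_
        have := mul_le_mul_of_nonneg_left (hlow n) (show 0 ≤ 2 / v by positivity)
        refine le_trans (le_of_eq ?_) this
        field_simp
    _ ≤ _ := by
        rw [← Finset.mul_sum]
        exact mul_le_mul_of_nonneg_left hsum (by positivity)

/-! ### Convergence for test functions of finitely many coordinates -/

section Correlations

variable {ψ : OneSided M → ℝ} {ν : Measure (TwoSided M)} {f : TwoSided M → ℝ} {C α : ℝ}

theorem integral_abs_le_of_support [IsFiniteMeasure ν] {s : Set (TwoSided M)}
    (hs : MeasurableSet s) {g : TwoSided M → ℝ} {A : ℝ} (hA : ∀ x, |g x| ≤ A)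
    (hg : ∀ x, g x ≠ 0 → x ∈ s) : ∫ x, |g x| ∂ν ≤ A * ν.real s := by
  have h1 : ∀ x, |g x| ≤ s.indicator (fun _ => A) x := fun x => by
    by_cases hx : x ∈ s
    · rw [Set.indicator_of_mem hx]; exact hA x
    · rw [Set.indicator_of_notMem hx]
      have : g x = 0 := by by_contra h; exact hx (hg x h)
      rw [this, abs_zero]
  calc ∫ x, |g x| ∂ν ≤ ∫ x, s.indicator (fun _ => A) x ∂ν :=
        integral_mono_of_nonneg (ae_of_all _ fun x => abs_nonneg _)
          ((integrable_const A).indicator hs) (ae_of_all _ h1)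
    _ = A * ν.real s := by rw [integral_indicator_const _ hs, smul_eq_mul, mul_comm]

/-- Let `Y j` be supported where the Birkhoff sums are confined at time `j`, and determined by the
coordinates in `[-m, j + m]` up to an error of order `α ^ m`. Then the correlations of `Y j` with
`f ∘ T ^ n`, `n ≥ j`, are summable: replacing `Y j` by a function of finitely many coordinates, they
are bounded by an exponential in `n - j` times the probability of confinement. -/
theorem summable_correlations (hM : IsTransitionMatrix M)
    (hψ : IsHolderPlus ψ) (hψ1 : IsNormalized ψ) (hν : IsGibbs ψ ν)
    (hf : IsHolderWith C α f) (hfH : IsHolder f) (hf0 : ∫ x, f x ∂ν = 0)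
    (hfc : ¬ IsCoboundary f) {Y : ℕ → TwoSided M → ℝ} {A K : ℝ} {q : ℕ} (hA : 0 ≤ A)
    (hY : ∀ j x, |Y j x| ≤ A)
    (hYH : ∀ (j m : ℕ) x y, q ≤ m → Agree (-m) (j + m) x y → |Y j x - Y j y| ≤ A * α ^ m)
    (hYK : ∀ j x, Y j x ≠ 0 → x ∈ confined f j K) :
    Summable fun n : ℕ => ∑ j ∈ Finset.range (n + 1), |∫ x, Y j x * f ((shift M)^[n] x) ∂ν| := by
  obtain ⟨D, ρ, hD, hρ0, hρ1, H⟩ := exists_decay hM hψ hψ1 hν hfH hf0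
  have := hν.isProbabilityMeasure
  have h0 := hf.exp_pos
  have h1 := hf.exp_lt_one
  have hC := hf.pos
  have h1α : 0 < 1 - α := by linarith
  have hfcont := hf.continuous
  obtain ⟨F₁, hF₁⟩ := (isCompact_range hfcont.abs).bddAbove
  obtain ⟨F, hF0, hF⟩ : ∃ F, 0 ≤ F ∧ ∀ x, |f x| ≤ F :=
    ⟨|F₁|, abs_nonneg _, fun x => (hF₁ ⟨x, rfl⟩).trans (le_abs_self _)⟩
  set c := 2 * C / (1 - α) with hc
  have hc0 : 0 ≤ c := by positivity
  set p : ℕ → ℝ := fun j => ν.real (confined f j (K + c)) with hp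
  have hp0 : ∀ j, 0 ≤ p j := fun j => measureReal_nonneg
  have hpS : Summable p := summable_confined hM hψ hψ1 hν hf hf0 hfc (K + c)
  have hYc : ∀ j, Continuous (Y j) := fun j => by
    refine continuous_iff_continuousAt.2 fun z => Metric.tendsto_nhds.2 fun ε hε => ?_
    have t1 : Tendsto (fun n : ℕ => A * α ^ n) atTop (𝓝 (A * 0)) :=
      (tendsto_pow_atTop_nhds_zero_of_lt_one h0.le h1).const_mul A
    rw [mul_zero] at t1
    obtain ⟨n, hn, hnq⟩ := ((t1.eventually (gt_mem_nhds hε)).and (eventually_ge_atTop q)).exists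
    filter_upwards [eventually_agree (-n) (j + n) z] with z' hz'
    exact (hYH j n z' z hnq hz').trans_lt hn
  have hm := fun j => measurableSet_confined hfcont j (K + c)
  have hYK' : ∀ j x, Y j x ≠ 0 → x ∈ confined f j (K + c) := fun j x h =>
    confined_mono (by linarith) (hYK j x h)
  set β := max α ρ with hβ
  have hβ0 : 0 < β := lt_max_of_lt_left h0
  have hβ1 : β < 1 := max_lt h1 hρ1
  set G := A * F * (α ^ q)⁻¹ + D * A with hG
  have hG0 : 0 ≤ G := by positivity
  have hFY : ∀ (j n : ℕ) (g : TwoSided M → ℝ) (B : ℝ), Continuous g → (∀ x, |g x| ≤ B) →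
      (∀ x, g x ≠ 0 → x ∈ confined f j (K + c)) →
      |∫ x, g x * f ((shift M)^[n] x) ∂ν| ≤ B * F * p j := by
    intro j n g B hgc hgB hgK
    refine abs_integral_le_integral_abs.trans
      (integral_abs_le_of_support (hm j) (fun x => ?_) fun x hx => hgK x (left_ne_zero_of_mul hx))
    rw [abs_mul]
    exact mul_le_mul (hgB x) (hF _) (abs_nonneg _) ((abs_nonneg _).trans (hgB x))
  have key : ∀ j i : ℕ, |∫ x, Y j x * f ((shift M)^[j + i] x) ∂ν| ≤ G * β ^ (i / 3) * p j := by
    intro j i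
    -- the gap `i` is split in three: the coordinates of `Y j` beyond `j`, the free steps, and the
    -- coordinates of `f ∘ T ^ (j + i)` before `j + i`
    set m := i / 3 with hmdef
    have hαβ : α ^ m ≤ β ^ m := pow_le_pow_left₀ h0.le (le_max_left _ _) m
    have hρβ : ρ ^ m ≤ β ^ m := pow_le_pow_left₀ hρ0.le (le_max_right _ _) m
    have hαq : 1 ≤ (α ^ q)⁻¹ := (one_le_inv₀ (by positivity)).2 (pow_le_one₀ h0.le h1.le)
    rcases le_or_gt q m with hq | hq
    · obtain ⟨R, hR1, hR2⟩ := exists_representative M (-(m : ℤ)) (j + m)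
      have hU : ∀ x y, Agree (-(m : ℤ)) ((j + m + i % 3 : ℕ) : ℤ) x y → Y j (R x) = Y j (R y) :=
        fun x y h => by rw [hR2 x y (h.mono le_rfl (by push_cast; omega))]
      have hUc := continuous_of_agree hU
      have hRK : ∀ x, Y j (R x) ≠ 0 → x ∈ confined f j (K + c) := fun x hx =>
        hf.mem_confined_of_agree (hYK j _ hx) ((hR1 x).mono (by omega) (by omega))
      have hdK : ∀ x, Y j x - Y j (R x) ≠ 0 → x ∈ confined f j (K + c) := fun x hx => by
        by_cases h : Y j x = 0
        · refine hRK x fun h' => hx (by rw [h, h', sub_zero])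
        · exact hYK' j x h
      have d1 := H m (j + m + i % 3) m (fun x => Y j (R x)) hU
      have d2 := hFY j (j + i) (fun x => Y j x - Y j (R x)) (A * α ^ m) ((hYc j).sub hUc)
        (fun x => hYH j m x _ hq (hR1 x).symm) hdK
      have d3 : ∫ x, |Y j (R x)| ∂ν ≤ A * p j :=
        integral_abs_le_of_support (hm j) (fun x => hY j _) hRK
      have en : j + m + i % 3 + 2 * m = j + i := by omega
      rw [en] at d1
      have hs : Continuous fun x => f ((shift M)^[j + i] x) :=
        hfcont.comp ((shift M).continuous.iterate _)
      have c1 : Continuous fun x => (Y j x - Y j (R x)) * f ((shift M)^[j + i] x) :=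
        ((hYc j).sub hUc).mul hs
      have c2 : Continuous fun x => Y j (R x) * f ((shift M)^[j + i] x) := hUc.mul hs
      have e : ∫ x, Y j x * f ((shift M)^[j + i] x) ∂ν =
          ∫ x, (Y j x - Y j (R x)) * f ((shift M)^[j + i] x) ∂ν +
            ∫ x, Y j (R x) * f ((shift M)^[j + i] x) ∂ν := by
        rw [← integral_add (integrable_of_continuous c1) (integrable_of_continuous c2)]
        exact integral_congr_ae (ae_of_all _ fun x => by ring)
      rw [e]
      refine (abs_add_le _ _).trans ((add_le_add d2 d1).trans ?_)
      have s1 : A * α ^ m * F * p j ≤ A * F * (α ^ q)⁻¹ * β ^ m * p j := by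
        refine mul_le_mul_of_nonneg_right ?_ (hp0 j)
        calc A * α ^ m * F = A * F * 1 * α ^ m := by ring
          _ ≤ _ := by gcongr
      have s2 : D * ρ ^ m * ∫ x, |Y j (R x)| ∂ν ≤ D * A * β ^ m * p j := by
        calc D * ρ ^ m * ∫ x, |Y j (R x)| ∂ν ≤ D * β ^ m * (A * p j) := by gcongr
          _ = _ := by ring
      calc _ ≤ A * F * (α ^ q)⁻¹ * β ^ m * p j + D * A * β ^ m * p j := add_le_add s1 s2
        _ = _ := by rw [hG]; ring
    · refine (hFY j (j + i) (Y j) A (hYc j) (hY j) (hYK' j)).trans ?_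
      refine mul_le_mul_of_nonneg_right ?_ (hp0 j)
      have s1 : 1 ≤ (α ^ q)⁻¹ * β ^ m := by
        rw [inv_mul_eq_div, one_le_div (by positivity)]
        exact (pow_le_pow_of_le_one h0.le h1.le hq.le).trans hαβ
      calc A * F ≤ A * F * ((α ^ q)⁻¹ * β ^ m) := le_mul_of_one_le_right (by positivity) s1
        _ = A * F * (α ^ q)⁻¹ * β ^ m := by ring
        _ ≤ G * β ^ m := by
          refine mul_le_mul_of_nonneg_right ?_ (by positivity)
          rw [hG]
          have : 0 ≤ D * A := by positivity
          linarith
  obtain ⟨E, θ, hE, hθ0, hθ1, hθ⟩ := exists_pow_div_le hβ0 hβ1 (p := 3) (by norm_num)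
  have hconv : Summable fun n : ℕ => ∑ j ∈ Finset.range (n + 1), p j * (G * E * θ ^ (n - j)) := by
    have hb : Summable fun i : ℕ => G * E * θ ^ i :=
      (summable_geometric_of_lt_one hθ0.le hθ1).mul_left _
    have := summable_norm_sum_mul_range_of_summable_norm (f := p)
      (g := fun i => G * E * θ ^ i) hpS.norm hb.norm
    exact this.of_norm
  refine Summable.of_nonneg_of_le (fun n => Finset.sum_nonneg fun j _ => abs_nonneg _)
    (fun n => Finset.sum_le_sum fun j hj => ?_) hconv
  have hj : j ≤ n := Nat.lt_succ_iff.1 (Finset.mem_range.1 hj)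
  have := key j (n - j)
  rw [Nat.add_sub_cancel' hj] at this
  refine this.trans ?_
  calc G * β ^ ((n - j) / 3) * p j ≤ G * (E * θ ^ (n - j)) * p j := by
        gcongr
        exact hθ (n - j)
    _ = _ := by ring

end Correlations

section RunningMaximum

/-- `max (-K) (max_{1 ≤ i ≤ n} (-S_i f))`: for `t > -K`, the exit time `τ_t^f` is larger than `n`
exactly when this is at most `t`. -/
def runMax (f : TwoSided M → ℝ) (K : ℝ) : ℕ → TwoSided M → ℝ
  | 0, _ => -K
  | n + 1, x => max (runMax f K n x) (-birkhoffSum (shift M) f (n + 1) x)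

variable {f : TwoSided M → ℝ} {K : ℝ}

theorem runMax_le_iff {n : ℕ} {x : TwoSided M} {t : ℝ} :
    runMax f K n x ≤ t ↔ -K ≤ t ∧ ∀ i, 1 ≤ i → i ≤ n → 0 ≤ t + birkhoffSum (shift M) f i x := by
  induction n with
  | zero => exact ⟨fun h => ⟨h, fun i h1 h2 => by omega⟩, fun h => h.1⟩
  | succ n ih =>
    rw [runMax, max_le_iff, ih]
    constructor
    · rintro ⟨⟨h1, h2⟩, h3⟩
      refine ⟨h1, fun i hi hi' => ?_⟩
      rcases Nat.lt_succ_iff_lt_or_eq.1 (Nat.lt_succ_iff.2 hi') with h | rfl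
      · exact h2 i hi (by omega)
      · linarith
    · rintro ⟨h1, h2⟩
      exact ⟨⟨h1, fun i hi hi' => h2 i hi (by omega)⟩,
        by linarith [h2 (n + 1) (by omega) le_rfl]⟩

theorem neg_le_runMax (n : ℕ) (x : TwoSided M) : -K ≤ runMax f K n x :=
  (runMax_le_iff.1 le_rfl).1

theorem abs_runMax_sub_le {n : ℕ} {x y : TwoSided M} {δ : ℝ} (hδ : 0 ≤ δ)
    (h : ∀ i ≤ n, |birkhoffSum (shift M) f i x - birkhoffSum (shift M) f i y| ≤ δ) :
    |runMax f K n x - runMax f K n y| ≤ δ := by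
  induction n with
  | zero => simpa [runMax] using hδ
  | succ n ih =>
    rw [runMax, runMax]
    refine (abs_max_sub_max_le_max _ _ _ _).trans (max_le (ih fun i hi => h i (by omega)) ?_)
    rw [neg_sub_neg, abs_sub_comm]
    exact h (n + 1) le_rfl

end RunningMaximum

section Tail

variable {φ : TwoSided M × ℝ → ℝ} {A K : ℝ}

/-- `∫_s^∞ φ(x, t) dt`, for functions `φ` that vanish for `t ≥ K`. -/
def tail (φ : TwoSided M × ℝ → ℝ) (K : ℝ) (x : TwoSided M) (s : ℝ) : ℝ := ∫ t in s..K, φ (x, t)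

theorem abs_tail_sub_le (hφ : Continuous φ) (hA : ∀ p, |φ p| ≤ A) (x : TwoSided M) (s s' : ℝ) :
    |tail φ K x s - tail φ K x s'| ≤ A * |s - s'| := by
  have hc : Continuous fun t => φ (x, t) := by fun_prop
  have : tail φ K x s - tail φ K x s' = ∫ t in s..s', φ (x, t) := by
    rw [tail, tail, ← intervalIntegral.integral_add_adjacent_intervals
      (hc.intervalIntegrable s s') (hc.intervalIntegrable s' K), add_sub_cancel_right]
  rw [this, abs_sub_comm s s', ← Real.norm_eq_abs]
  exact intervalIntegral.norm_integral_le_of_norm_le_const fun t _ => hA _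

theorem tail_eq_zero (hφK : ∀ x t, K ≤ |t| → φ (x, t) = 0) (x : TwoSided M) {s : ℝ}
    (hs : K ≤ s) : tail φ K x s = 0 := by
  rw [tail, intervalIntegral.integral_congr (g := fun _ => 0), intervalIntegral.integral_zero]
  intro t ht
  rw [Set.uIcc_of_ge hs] at ht
  exact hφK x t (ht.1.trans (le_abs_self t))

theorem abs_tail_le (hφ : Continuous φ) (hA : ∀ p, |φ p| ≤ A) (hA0 : 0 ≤ A)
    (hφK : ∀ x t, K ≤ |t| → φ (x, t) = 0) (hK : 0 ≤ K) (x : TwoSided M) {s : ℝ} (hs : -K ≤ s) :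
    |tail φ K x s| ≤ A * (2 * K) := by
  rcases le_total K s with h | h
  · rw [tail_eq_zero hφK x h, abs_zero]; positivity
  · have := abs_tail_sub_le (K := K) hφ hA x s K
    rw [tail_eq_zero hφK x le_rfl, sub_zero] at this
    refine this.trans (mul_le_mul_of_nonneg_left ?_ hA0)
    rw [abs_le]; constructor <;> linarith

end Tail

section Convergence

variable {ψ : OneSided M → ℝ} {ν : Measure (TwoSided M)} {f : TwoSided M → ℝ} {C α : ℝ}
  {φ : TwoSided M × ℝ → ℝ} {K : ℝ} {q : ℕ}

theorem tail_congr (hφq : ∀ x y t, Agree (-q) q x y → φ (x, t) = φ (y, t)) {x y : TwoSided M}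
    (h : Agree (-q) q x y) (s : ℝ) : tail φ K x s = tail φ K y s := by
  simp only [tail, hφq x y _ h]

theorem continuous_tail_runMax (hf : IsHolderWith C α f) (hφ : Continuous φ) {A : ℝ}
    (hA : ∀ p, |φ p| ≤ A) (hφq : ∀ x y t, Agree (-q) q x y → φ (x, t) = φ (y, t)) (n : ℕ) :
    Continuous fun x => tail φ K x (runMax f K n x) := by
  have hr : Continuous (runMax f K n) := by
    induction n with
    | zero => exact continuous_const
    | succ n ih => exact ih.max (continuous_birkhoffSum hf.continuous _).neg
  refine continuous_iff_continuousAt.2 fun x => ?_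
  have ht : Continuous (tail φ K x) := by
    have hA0 : 0 ≤ A := (abs_nonneg _).trans (hA (x, 0))
    exact (LipschitzWith.of_dist_le_mul (K := ⟨A, hA0⟩) fun s s' =>
      abs_tail_sub_le hφ hA x s s').continuous
  have h1 : ContinuousAt (fun y => tail φ K x (runMax f K n y)) x := (ht.comp hr).continuousAt
  refine h1.congr ?_
  filter_upwards [eventually_agree (-q) q x] with y hy
  exact (tail_congr hφq hy _).symm

set_option maxHeartbeats 1000000 in
/-- The increments in `n` of `∫ φ(x, t) S_n f(x) 1_{τ_t^f(x) > n} ν(dx) dt` are summable, for a test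
function `φ` that depends on finitely many coordinates of `x`: the increment of the tail integral is
supported where the Birkhoff sums are confined, and the increment of `S_n f` decorrelates. -/
theorem exists_tendsto_tail (hM : IsTransitionMatrix M)
    (hψ : IsHolderPlus ψ) (hψ1 : IsNormalized ψ) (hν : IsGibbs ψ ν)
    (hf : IsHolderWith C α f) (hfH : IsHolder f) (hf0 : ∫ x, f x ∂ν = 0)
    (hfc : ¬ IsCoboundary f) (hφ : Continuous φ) {A : ℝ} (hA : ∀ p, |φ p| ≤ A) (hA0 : 0 ≤ A)
    (hφq : ∀ x y t, Agree (-q) q x y → φ (x, t) = φ (y, t))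
    (hφK : ∀ x t, K ≤ |t| → φ (x, t) = 0) (hK : 0 ≤ K) :
    ∃ L, Tendsto (fun n => ∫ x, tail φ K x (runMax f K n x) * birkhoffSum (shift M) f n x ∂ν)
      atTop (𝓝 L) := by
  have := hν.isProbabilityMeasure
  have h0 := hf.exp_pos
  have h1 := hf.exp_lt_one
  have hC := hf.pos
  have h1α : 0 < 1 - α := by linarith
  have hfcont := hf.continuous
  obtain ⟨F₁, hF₁⟩ := (isCompact_range hfcont.abs).bddAbove
  obtain ⟨F, hF0, hF⟩ : ∃ F, 0 ≤ F ∧ ∀ x, |f x| ≤ F :=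
    ⟨|F₁|, abs_nonneg _, fun x => (hF₁ ⟨x, rfl⟩).trans (le_abs_self _)⟩
  set c := 2 * C / (1 - α) with hc
  have hc0 : 0 ≤ c := by positivity
  set B : ℕ → TwoSided M → ℝ := fun n x => tail φ K x (runMax f K n x) with hB
  have hBc : ∀ n, Continuous (B n) := fun n => continuous_tail_runMax hf hφ hA hφq n
  have hBA : ∀ n x, |B n x| ≤ A * (2 * K) := fun n x =>
    abs_tail_le hφ hA hA0 hφK hK x (neg_le_runMax n x)
  have hBH : ∀ (n m : ℕ) x y, q ≤ m → Agree (-m) (n + m) x y →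
      |B n x - B n y| ≤ A * (c * α ^ m) := fun n m x y hq h => by
    simp only [hB]
    rw [tail_congr hφq (h.mono (by omega) (by omega)) (runMax f K n x)]
    refine (abs_tail_sub_le hφ hA y _ _).trans (mul_le_mul_of_nonneg_left ?_ hA0)
    exact abs_runMax_sub_le (by positivity) fun i hi => hf.abs_birkhoffSum_sub_le hi h
  -- `B (n + 1) * S_{n+1} f - B n * S_n f = Y (n + 1) * S_{n+1} f + (∑ j ≤ n, Y j) * f ∘ T ^ n`, for
  -- the increments `Y` of `B`
  obtain ⟨Y, hY0, hY1⟩ : ∃ Y : ℕ → TwoSided M → ℝ, Y 0 = B 0 ∧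
      ∀ n, Y (n + 1) = fun x => B (n + 1) x - B n x :=
    ⟨fun n => Nat.casesOn n (B 0) fun n x => B (n + 1) x - B n x, rfl, fun _ => rfl⟩
  have hYsum : ∀ n x, B n x = ∑ j ∈ Finset.range (n + 1), Y j x := by
    intro n x
    induction n with
    | zero => rw [zero_add, Finset.sum_range_one, hY0]
    | succ n ih => rw [Finset.sum_range_succ, ← ih, hY1]; ring
  set A' := A * (4 * K) + 2 * A * c with hA'
  have hA'0 : 0 ≤ A' := by positivity
  have hYA : ∀ j x, |Y j x| ≤ A * (4 * K) := by
    intro j x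
    cases j with
    | zero =>
      rw [hY0]
      refine (hBA 0 x).trans (mul_le_mul_of_nonneg_left (by linarith) hA0)
    | succ n =>
      rw [hY1]
      refine (abs_sub _ _).trans ?_
      linarith [hBA (n + 1) x, hBA n x]
  have hYH : ∀ (j m : ℕ) x y, q ≤ m → Agree (-m) (j + m) x y →
      |Y j x - Y j y| ≤ A' * α ^ m := by
    intro j m x y hq h
    have hle : 2 * (A * (c * α ^ m)) ≤ A' * α ^ m := by
      have : 0 ≤ A * (4 * K) * α ^ m := by positivity
      rw [hA']; linarith
    have hnn : 0 ≤ A * (c * α ^ m) := by positivity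
    cases j with
    | zero => rw [hY0]; exact (hBH 0 m x y hq h).trans (by linarith)
    | succ n =>
      have b1 := abs_le.1 (hBH (n + 1) m x y hq h)
      have b2 := abs_le.1 (hBH n m x y hq (h.mono le_rfl (by push_cast; omega)))
      rw [hY1, abs_le]
      constructor <;> linarith [b1.1, b1.2, b2.1, b2.2]
  -- the tail changes at time `j` only if `-S_j f` is a new maximum, and the previous one is below
  -- `K`
  have hYK : ∀ j x, Y j x ≠ 0 → x ∈ confined f j (K + F) := by
    intro j x hx
    cases j with
    | zero =>
      refine ⟨fun i hi => ?_, ?_⟩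
      · obtain rfl : i = 0 := by omega
        rw [birkhoffSum_zero]; linarith
      · rw [birkhoffSum_zero]; linarith
    | succ n =>
      rw [hY1] at hx
      have hlt : runMax f K n x < K := by
        by_contra hge
        rw [not_lt] at hge
        refine hx ?_
        simp only [hB]
        have hge' : K ≤ runMax f K (n + 1) x := hge.trans (le_max_left _ _)
        rw [tail_eq_zero hφK x hge, tail_eq_zero hφK x hge', sub_zero]
      have hgt : runMax f K n x < -birkhoffSum (shift M) f (n + 1) x := by
        by_contra hge
        rw [not_lt] at hge
        refine hx ?_
        simp only [hB, runMax]
        rw [max_eq_left hge, sub_self]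
      have hi1 := (runMax_le_iff.1 hlt.le).2
      have hi : ∀ i ≤ n, -K ≤ birkhoffSum (shift M) f i x := fun i hi => by
        rcases Nat.eq_zero_or_pos i with rfl | hpos
        · rw [birkhoffSum_zero]; linarith
        · linarith [hi1 i hpos hi]
      refine ⟨fun i hi' => ?_, ?_⟩
      · rcases Nat.lt_succ_iff_lt_or_eq.1 (Nat.lt_succ_iff.2 hi') with h | rfl
        · linarith [hi i (by omega)]
        · rw [birkhoffSum_succ]
          linarith [hi n le_rfl, (abs_le.1 (hF ((shift M)^[n] x))).1]
      · linarith [neg_le_runMax (f := f) (K := K) n x]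
  have hcorr := summable_correlations hM hψ hψ1 hν hf hfH hf0 hfc hA'0
    (fun j x => (hYA j x).trans (by rw [hA']; have : 0 ≤ 2 * A * c := by positivity
                                    linarith)) hYH hYK
  have hSc := fun n => continuous_birkhoffSum hfcont n
  have hYc : ∀ n, Continuous (Y n) := fun n => by
    cases n with
    | zero => rw [hY0]; exact hBc 0
    | succ n => rw [hY1]; exact (hBc (n + 1)).sub (hBc n)
  have hstep : ∀ n, dist (∫ x, B n x * birkhoffSum (shift M) f n x ∂ν)
      (∫ x, B (n + 1) x * birkhoffSum (shift M) f (n + 1) x ∂ν) ≤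
      A * (4 * K) * (K + F) * ν.real (confined f (n + 1) (K + F)) +
        ∑ j ∈ Finset.range (n + 1), |∫ x, Y j x * f ((shift M)^[n] x) ∂ν| := by
    intro n
    have hs : Continuous fun x => f ((shift M)^[n] x) :=
      hfcont.comp ((shift M).continuous.iterate _)
    have d1 : Continuous fun x => B n x * birkhoffSum (shift M) f n x := (hBc n).mul (hSc n)
    have d2 : Continuous fun x => Y (n + 1) x * birkhoffSum (shift M) f (n + 1) x :=
      (hYc (n + 1)).mul (hSc (n + 1))
    have d3 : Continuous fun x => B n x * f ((shift M)^[n] x) := (hBc n).mul hs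
    have e : ∫ x, B (n + 1) x * birkhoffSum (shift M) f (n + 1) x ∂ν =
        ∫ x, B n x * birkhoffSum (shift M) f n x ∂ν +
          (∫ x, Y (n + 1) x * birkhoffSum (shift M) f (n + 1) x ∂ν +
            ∫ x, B n x * f ((shift M)^[n] x) ∂ν) := by
      have d4 : Continuous fun x => Y (n + 1) x * birkhoffSum (shift M) f (n + 1) x +
        B n x * f ((shift M)^[n] x) := d2.add d3
      rw [← integral_add (integrable_of_continuous d2) (integrable_of_continuous d3),
        ← integral_add (integrable_of_continuous d1) (integrable_of_continuous d4)]
      refine integral_congr_ae (ae_of_all _ fun x => ?_)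
      show B (n + 1) x * birkhoffSum (shift M) f (n + 1) x =
        B n x * birkhoffSum (shift M) f n x + (Y (n + 1) x *
          birkhoffSum (shift M) f (n + 1) x + B n x * f ((shift M)^[n] x))
      rw [hY1, birkhoffSum_succ]; ring
    have e2 : ∫ x, B n x * f ((shift M)^[n] x) ∂ν =
        ∑ j ∈ Finset.range (n + 1), ∫ x, Y j x * f ((shift M)^[n] x) ∂ν := by
      rw [← integral_finsetSum]
      · refine integral_congr_ae (ae_of_all _ fun x => ?_)
        show B n x * _ = _
        rw [hYsum n x, Finset.sum_mul]
      · intro j _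
        have d4 : Continuous fun x => Y j x * f ((shift M)^[n] x) := (hYc j).mul hs
        exact integrable_of_continuous d4
    rw [e, dist_self_add_right, Real.norm_eq_abs]
    refine (abs_add_le _ _).trans (add_le_add ?_ ?_)
    · refine abs_integral_le_integral_abs.trans ?_
      have hsupp : ∀ x, Y (n + 1) x * birkhoffSum (shift M) f (n + 1) x ≠ 0 →
          x ∈ confined f (n + 1) (K + F) := fun x hx => hYK _ x (left_ne_zero_of_mul hx)
      refine integral_abs_le_of_support (measurableSet_confined hfcont _ _) (fun x => ?_) hsupp
      by_cases hx : x ∈ confined f (n + 1) (K + F)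
      · rw [abs_mul]
        exact mul_le_mul (hYA _ x) (abs_le.2 ⟨hx.1 _ le_rfl, hx.2⟩) (abs_nonneg _) (by positivity)
      · have : Y (n + 1) x * birkhoffSum (shift M) f (n + 1) x = 0 := by
          by_contra h; exact hx (hsupp x h)
        rw [this, abs_zero]; positivity
    · rw [e2]
      exact Finset.abs_sum_le_sum_abs _ _
  refine cauchySeq_tendsto_of_complete (cauchySeq_of_dist_le_of_summable _ hstep ?_)
  refine Summable.add (Summable.mul_left _ ?_) hcorr
  exact (summable_nat_add_iff 1).2 (summable_confined hM hψ hψ1 hν hf hf0 hfc (K + F))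

end Convergence

/-! ### Exit times and uniform bounds -/

section Survival

variable {ν : Measure (TwoSided M)} {f : TwoSided M → ℝ}

/-- The pairs `(x, t)` with `τ_t^f(x) > n`. -/
def survival (f : TwoSided M → ℝ) (n : ℕ) : Set (TwoSided M × ℝ) :=
  {q | (n : ℕ∞) < exitTime f q.2 q.1}

theorem mem_survival {n : ℕ} {p : TwoSided M × ℝ} :
    p ∈ survival f n ↔ ∀ i, 1 ≤ i → i ≤ n → 0 ≤ p.2 + birkhoffSum (shift M) f i p.1 := by
  constructor
  · intro h i hi hn
    by_contra hlt
    have h1 : exitTime f p.2 p.1 ≤ (i : ℕ∞) := sInf_le ⟨i, ⟨hi, not_le.1 hlt⟩, rfl⟩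
    have h2 : (i : ℕ∞) ≤ n := by exact_mod_cast hn
    exact absurd h (not_lt.2 (h1.trans h2))
  · intro h
    have h1 : ((n + 1 : ℕ) : ℕ∞) ≤ exitTime f p.2 p.1 := by
      refine le_sInf ?_
      rintro _ ⟨i, ⟨hi, hi'⟩, rfl⟩
      by_contra hlt
      have : i < n + 1 := Nat.cast_lt.1 (not_le.1 hlt)
      exact absurd (h i hi (by omega)) (not_le.2 hi')
    refine lt_of_lt_of_le ?_ h1
    exact_mod_cast Nat.lt_succ_self n

/-- `S_n f(x) 1_{τ_t^f(x) > n}`. -/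
def weight (f : TwoSided M → ℝ) (n : ℕ) (p : TwoSided M × ℝ) : ℝ :=
  birkhoffSum (shift M) f n p.1 * (survival f n).indicator (fun _ => (1 : ℝ)) p

theorem isClosed_survival (hf : Continuous f) (n : ℕ) : IsClosed (survival f n) := by
  have : survival f n = ⋂ i : ℕ, ⋂ _ : 1 ≤ i, ⋂ _ : i ≤ n,
      {p : TwoSided M × ℝ | 0 ≤ p.2 + birkhoffSum (shift M) f i p.1} := by
    ext p
    simp only [mem_survival, Set.mem_iInter]
    rfl
  rw [this]
  refine isClosed_iInter fun i => isClosed_iInter fun _ => isClosed_iInter fun _ => ?_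
  exact isClosed_le continuous_const
    (continuous_snd.add ((continuous_birkhoffSum hf i).comp continuous_fst))

theorem indicator_survival_nonneg (n : ℕ) (p : TwoSided M × ℝ) :
    0 ≤ (survival f n).indicator (fun _ => (1 : ℝ)) p :=
  Set.indicator_nonneg (fun _ _ => zero_le_one) p

theorem indicator_survival_le_one (n : ℕ) (p : TwoSided M × ℝ) :
    (survival f n).indicator (fun _ => (1 : ℝ)) p ≤ 1 :=
  Set.indicator_le_self' (fun _ _ => zero_le_one) p

theorem measurable_indicator_survival (hf : Continuous f) (n : ℕ) :
    Measurable ((survival f n).indicator (fun _ => (1 : ℝ))) :=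
  measurable_const.indicator (isClosed_survival hf n).measurableSet

theorem measurable_weight (hf : Continuous f) (n : ℕ) : Measurable (weight f n) :=
  ((continuous_birkhoffSum hf n).measurable.comp measurable_fst).mul
    (measurable_indicator_survival hf n)

theorem exists_abs_weight_le (hf : Continuous f) (n : ℕ) : ∃ W, ∀ p, |weight f n p| ≤ W := by
  obtain ⟨W, hW⟩ := (isCompact_range (continuous_birkhoffSum hf n).abs).bddAbove
  refine ⟨W, fun p => ?_⟩
  rw [weight, abs_mul, abs_of_nonneg (indicator_survival_nonneg n p)]
  exact (mul_le_of_le_one_right (abs_nonneg _) (indicator_survival_le_one n p)).trans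
    (hW ⟨p.1, rfl⟩)

theorem indicator_survival_mono {n : ℕ} {x : TwoSided M} {s t : ℝ} (h : s ≤ t) :
    (survival f n).indicator (fun _ => (1 : ℝ)) (x, s) ≤
      (survival f n).indicator (fun _ => (1 : ℝ)) (x, t) := by
  by_cases hs : (x, s) ∈ survival f n
  · have ht : (x, t) ∈ survival f n := mem_survival.2 fun i h1 h2 => by
      have := mem_survival.1 hs i h1 h2
      dsimp only at this ⊢
      linarith
    rw [Set.indicator_of_mem hs, Set.indicator_of_mem ht]
  · rw [Set.indicator_of_notMem hs]
    exact indicator_survival_nonneg n _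

section Strip

variable [IsProbabilityMeasure ν] {g w : TwoSided M × ℝ → ℝ} {A W a b : ℝ}

theorem integrable_of_strip (hg : Measurable g) (hA : ∀ p, |g p| ≤ A)
    (h0 : ∀ p, p.2 ∉ Set.Icc a b → g p = 0) : Integrable g (ν.prod volume) := by
  have hs : MeasurableSet ((Set.univ : Set (TwoSided M)) ×ˢ Set.Icc a b) :=
    MeasurableSet.univ.prod measurableSet_Icc
  have hi : Integrable (((Set.univ : Set (TwoSided M)) ×ˢ Set.Icc a b).indicator fun _ => A)
      (ν.prod volume) := by
    rw [integrable_indicator_iff hs]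
    refine integrableOn_const ?_
    rw [Measure.prod_prod, measure_univ, one_mul, Real.volume_Icc]
    exact ENNReal.ofReal_ne_top
  refine hi.mono' hg.aestronglyMeasurable (ae_of_all _ fun p => ?_)
  by_cases hp : p.2 ∈ Set.Icc a b
  · rw [Set.indicator_of_mem (show p ∈ Set.univ ×ˢ Set.Icc a b from ⟨trivial, hp⟩)]
    exact hA p
  · rw [h0 p hp, norm_zero]
    exact Set.indicator_nonneg (fun _ _ => (abs_nonneg _).trans (hA p)) p

/-- An integral over `𝕏 × [a, b]` is bounded through its slices `𝕏 × {t}`. -/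
theorem abs_integral_prod_le (hg : Measurable g) (hA : ∀ p, |g p| ≤ A)
    (h0 : ∀ p, p.2 ∉ Set.Icc a b → g p = 0) (hab : a ≤ b) (hw : Measurable w)
    (hW : ∀ p, |w p| ≤ W) {C : ℝ} (hC : ∀ t ∈ Set.Icc a b, ∫ x, |w (x, t)| ∂ν ≤ C) :
    |∫ p, g p * w p ∂(ν.prod volume)| ≤ A * C * (b - a) := by
  have hint : Integrable (fun p => |g p * w p|) (ν.prod volume) := by
    refine integrable_of_strip (A := A * W) (a := a) (b := b) (hg.mul hw).abs (fun p => ?_)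
      fun p hp => ?_
    · rw [abs_abs, abs_mul]
      exact mul_le_mul (hA p) (hW p) (abs_nonneg _) ((abs_nonneg _).trans (hA p))
    · rw [h0 p hp, zero_mul, abs_zero]
  refine abs_integral_le_integral_abs.trans ?_
  rw [integral_prod_symm _ hint]
  have hle : ∀ t, ∫ x, |g (x, t) * w (x, t)| ∂ν ≤ (Set.Icc a b).indicator (fun _ => A * C) t := by
    intro t
    by_cases ht : t ∈ Set.Icc a b
    · rw [Set.indicator_of_mem ht]
      have hwi : Integrable (fun x => |w (x, t)|) ν :=
        Integrable.of_bound
          (hw.comp (measurable_id.prodMk measurable_const)).abs.aestronglyMeasurable W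
          (ae_of_all _ fun x => by rw [Real.norm_eq_abs, abs_abs]; exact hW _)
      calc ∫ x, |g (x, t) * w (x, t)| ∂ν ≤ ∫ x, A * |w (x, t)| ∂ν := by
            refine integral_mono_of_nonneg (ae_of_all _ fun x => abs_nonneg _) (hwi.const_mul A)
              (ae_of_all _ fun x => ?_)
            show |g (x, t) * w (x, t)| ≤ A * |w (x, t)|
            rw [abs_mul]
            exact mul_le_mul_of_nonneg_right (hA _) (abs_nonneg _)
        _ ≤ A * C := by
            rw [integral_const_mul]
            obtain ⟨x⟩ : Nonempty (TwoSided M) := by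
              by_contra he
              rw [not_nonempty_iff] at he
              exact IsProbabilityMeasure.ne_zero ν (Measure.eq_zero_of_isEmpty ν)
            exact mul_le_mul_of_nonneg_left (hC t ht) ((abs_nonneg _).trans (hA (x, t)))
    · rw [Set.indicator_of_notMem ht]
      refine le_of_eq ?_
      simp only [h0 _ (show (_, t).2 ∉ _ from ht), zero_mul, abs_zero, integral_zero]
  calc _ ≤ ∫ t, (Set.Icc a b).indicator (fun _ => A * C) t := by
        refine integral_mono_of_nonneg (ae_of_all _ fun t => integral_nonneg fun x => abs_nonneg _)
          ?_ (ae_of_all _ hle)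
        rw [integrable_indicator_iff measurableSet_Icc]
        exact integrableOn_const (by rw [Real.volume_Icc]; exact ENNReal.ofReal_ne_top)
    _ = _ := by
        rw [integral_indicator_const _ measurableSet_Icc, Real.volume_real_Icc_of_le hab,
          smul_eq_mul, mul_comm]

end Strip

/-- The condition `τ_t^f > n` on `t` is a lower bound on `t`, and integrating in `t` gives a tail.
-/
theorem integral_mul_indicator_survival {φ : TwoSided M × ℝ → ℝ} {K : ℝ}
    (hφK : ∀ x t, K ≤ |t| → φ (x, t) = 0) (n : ℕ) (x : TwoSided M) :
    ∫ t, φ (x, t) * (survival f n).indicator (fun _ => (1 : ℝ)) (x, t) =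
      tail φ K x (runMax f K n x) := by
  set r := runMax f K n x with hr
  have e : (fun t => φ (x, t) * (survival f n).indicator (fun _ => (1 : ℝ)) (x, t)) =
      (Set.Ici r).indicator fun t => φ (x, t) := by
    funext t
    by_cases ht : K ≤ |t|
    · rw [hφK x t ht, zero_mul]
      by_cases h : t ∈ Set.Ici r
      · rw [Set.indicator_of_mem h, hφK x t ht]
      · rw [Set.indicator_of_notMem h]
    · have ht' := abs_lt.1 (not_le.1 ht)
      have hiff : (x, t) ∈ survival f n ↔ t ∈ Set.Ici r := by
        rw [mem_survival, Set.mem_Ici, hr, runMax_le_iff]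
        exact ⟨fun h => ⟨ht'.1.le, h⟩, fun h => h.2⟩
      by_cases h : t ∈ Set.Ici r
      · rw [Set.indicator_of_mem h, Set.indicator_of_mem (hiff.2 h), mul_one]
      · rw [Set.indicator_of_notMem h, Set.indicator_of_notMem (fun h' => h (hiff.1 h')), mul_zero]
  rw [e, integral_indicator measurableSet_Ici, integral_Ici_eq_integral_Ioi]
  rcases le_total r K with h | h
  · rw [tail, intervalIntegral.integral_of_le h]
    refine setIntegral_eq_of_subset_of_forall_sdiff_eq_zero measurableSet_Ioi
      (fun t ht => ht.1) fun t ht => hφK x t ?_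
    have : K < t := by
      by_contra hle
      exact ht.2 ⟨ht.1, not_lt.1 hle⟩
    exact this.le.trans (le_abs_self t)
  · rw [tail_eq_zero hφK x h]
    exact setIntegral_eq_zero_of_forall_eq_zero fun t ht =>
      hφK x t ((h.trans (le_of_lt ht)).trans (le_abs_self t))

theorem integral_mul_weight [IsProbabilityMeasure ν] (hf : Continuous f)
    {φ : TwoSided M × ℝ → ℝ} {K A : ℝ} (hφ : Continuous φ) (hA : ∀ p, |φ p| ≤ A)
    (hφK : ∀ x t, K ≤ |t| → φ (x, t) = 0) (n : ℕ) :
    ∫ p, φ p * weight f n p ∂(ν.prod volume) =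
      ∫ x, tail φ K x (runMax f K n x) * birkhoffSum (shift M) f n x ∂ν := by
  obtain ⟨W, hW⟩ := exists_abs_weight_le hf n
  rw [integral_prod]
  · refine integral_congr_ae (ae_of_all _ fun x => ?_)
    show ∫ t, φ (x, t) * weight f n (x, t) =
      tail φ K x (runMax f K n x) * birkhoffSum (shift M) f n x
    rw [← integral_mul_indicator_survival hφK, ← integral_mul_const]
    refine integral_congr_ae (ae_of_all _ fun t => ?_)
    show φ (x, t) * (birkhoffSum (shift M) f n x * _) = _
    ring
  · refine integrable_of_strip (A := A * W) (a := -K) (b := K)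
      (hφ.measurable.mul (measurable_weight hf n)) (fun p => ?_) fun p hp => ?_
    · rw [abs_mul]
      exact mul_le_mul (hA p) (hW p) (abs_nonneg _) ((abs_nonneg _).trans (hA p))
    · rw [show φ p = 0 from hφK p.1 p.2 ?_, zero_mul]
      by_contra hlt
      have := abs_lt.1 (not_le.1 hlt)
      exact hp ⟨this.1.le, this.2.le⟩

end Survival

section Bounds

variable {ψ : OneSided M → ℝ} {ν : Measure (TwoSided M)} {f : TwoSided M → ℝ}

/-- `∫ |S_n f| 1_{τ_t^f > n} dν` is bounded in `n`, locally uniformly in `t`: its integral over a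
bounded set of `t` converges, and `1_{τ_t^f > n}` increases with `t`. -/
theorem exists_integral_abs_weight_le (hM : IsTransitionMatrix M)
    (hψ : IsHolderPlus ψ) (hψ1 : IsNormalized ψ) (hν : IsGibbs ψ ν) (hfH : IsHolder f)
    (hf0 : ∫ x, f x ∂ν = 0) (hfc : ¬ IsCoboundary f) (K : ℝ) :
    ∃ B, 0 ≤ B ∧ ∀ n, ∀ t ≤ K, ∫ x, |weight f n (x, t)| ∂ν ≤ B := by
  have := hν.isProbabilityMeasure
  obtain ⟨C, α, hf⟩ := hfH.exists_isHolderWith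
  have hfcont := hf.continuous
  set K' := |K| + 2 with hK'
  have hK'0 : 0 ≤ K' := by positivity
  set χ : TwoSided M × ℝ → ℝ := fun p => max 0 (K' - |p.2|) with hχ
  have hχc : Continuous χ := by fun_prop
  have hχ0 : ∀ p, 0 ≤ χ p := fun p => le_max_left _ _
  have hχA : ∀ p, |χ p| ≤ K' := fun p => by
    rw [abs_of_nonneg (hχ0 p)]
    exact max_le hK'0 (by linarith [abs_nonneg p.2])
  have hχK : ∀ x t, K' ≤ |t| → χ (x, t) = 0 := fun x t h => max_eq_left (by simpa using h)
  have hχs : ∀ p : TwoSided M × ℝ, p.2 ∉ Set.Icc (-K') K' → χ p = 0 := fun p hp =>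
    hχK p.1 p.2 (by
      by_contra hlt
      have := abs_lt.1 (not_le.1 hlt)
      exact hp ⟨this.1.le, this.2.le⟩)
  obtain ⟨L, hL⟩ := exists_tendsto_tail (q := 0) hM hψ hψ1 hν hf hfH hf0 hfc hχc hχA hK'0
    (fun x y t _ => rfl) hχK hK'0
  obtain ⟨B₁, hB₁⟩ := hL.bddAbove_range
  have hχi : Integrable χ (ν.prod volume) := integrable_of_strip hχc.measurable hχA hχs
  set B := B₁ + 2 * K' * ∫ p, χ p ∂(ν.prod volume) with hB
  have hwi : ∀ n, Integrable (fun p => χ p * weight f n p) (ν.prod volume) := fun n => by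
    obtain ⟨W, hW⟩ := exists_abs_weight_le hfcont n
    refine integrable_of_strip (A := K' * W) (a := -K') (b := K')
      (hχc.measurable.mul (measurable_weight hfcont n)) (fun p => ?_)
      fun p hp => by rw [hχs p hp, zero_mul]
    rw [abs_mul]
    exact mul_le_mul (hχA p) (hW p) (abs_nonneg _) hK'0
  have hwi' : ∀ n, Integrable (fun p => χ p * |weight f n p|) (ν.prod volume) := fun n => by
    refine (hwi n).abs.congr (ae_of_all _ fun p => ?_)
    show |χ p * weight f n p| = _
    rw [abs_mul, abs_of_nonneg (hχ0 p)]
  -- on `{τ_t > n}` the Birkhoff sum `S_n f` is at least `-t`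
  have hpt : ∀ n p, χ p * |weight f n p| ≤ χ p * weight f n p + 2 * K' * χ p := by
    intro n p
    rcases (hχ0 p).eq_or_lt with h | h
    · rw [← h]; simp
    have hp : |p.2| < K' := by
      by_contra hge
      exact h.ne' (hχK p.1 p.2 (not_lt.1 hge))
    have : |weight f n p| ≤ weight f n p + 2 * K' := by
      by_cases hs : p ∈ survival f n
      · have hSn : -K' ≤ birkhoffSum (shift M) f n p.1 := by
          rcases Nat.eq_zero_or_pos n with rfl | hn
          · rw [birkhoffSum_zero]; linarith
          · linarith [mem_survival.1 hs n hn le_rfl, (abs_lt.1 hp).2]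
        rw [weight, Set.indicator_of_mem hs, mul_one, abs_le]
        constructor <;> linarith
      · rw [weight, Set.indicator_of_notMem hs, mul_zero, abs_zero]
        linarith
    nlinarith
  have hmass : ∀ n, ∫ p, χ p * |weight f n p| ∂(ν.prod volume) ≤ B := by
    intro n
    have h1 : ∫ p, χ p * weight f n p ∂(ν.prod volume) ≤ B₁ := by
      rw [integral_mul_weight hfcont hχc hχA hχK]
      exact hB₁ ⟨n, rfl⟩
    calc _ ≤ ∫ p, (χ p * weight f n p + 2 * K' * χ p) ∂(ν.prod volume) :=
          integral_mono (hwi' n) ((hwi n).add (hχi.const_mul _)) (hpt n)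
      _ ≤ B := by
          rw [integral_add (hwi n) (hχi.const_mul _), integral_const_mul]
          linarith
  have hslice : ∀ n, ∀ t ≤ K, ∫ x, |weight f n (x, t)| ∂ν ≤
      ∫ p, χ p * |weight f n p| ∂(ν.prod volume) := by
    intro n t ht
    have e : ∫ x, |weight f n (x, t)| ∂ν = ∫ p : TwoSided M × ℝ, |weight f n (p.1, t)| *
        (Set.Icc K (K + 1)).indicator (fun _ => (1 : ℝ)) p.2 ∂(ν.prod volume) := by
      rw [integral_prod_mul (fun x => |weight f n (x, t)|)
        ((Set.Icc K (K + 1)).indicator fun _ => (1 : ℝ)),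
        integral_indicator_const _ measurableSet_Icc, Real.volume_real_Icc_of_le (by linarith)]
      simp
    rw [e]
    refine integral_mono_of_nonneg (ae_of_all _ fun p => mul_nonneg (abs_nonneg _)
      (Set.indicator_nonneg (fun _ _ => zero_le_one) _)) (hwi' n) (ae_of_all _ fun p => ?_)
    show |weight f n (p.1, t)| * (Set.Icc K (K + 1)).indicator (fun _ => (1 : ℝ)) p.2 ≤
      χ p * |weight f n p|
    by_cases hp : p.2 ∈ Set.Icc K (K + 1)
    · have hχ1 : 1 ≤ χ p := by
        refine le_max_of_le_right ?_
        have : |p.2| ≤ |K| + 1 := by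
          rw [abs_le]
          constructor <;> linarith [hp.1, hp.2, neg_abs_le K, le_abs_self K]
        rw [hK']; linarith
      have hmono : |weight f n (p.1, t)| ≤ |weight f n p| := by
        rw [weight, weight, abs_mul, abs_mul, abs_of_nonneg (indicator_survival_nonneg _ _),
          abs_of_nonneg (indicator_survival_nonneg _ _)]
        exact mul_le_mul_of_nonneg_left (indicator_survival_mono (ht.trans hp.1)) (abs_nonneg _)
      rw [Set.indicator_of_mem hp, mul_one]
      exact hmono.trans (le_mul_of_one_le_left (abs_nonneg _) hχ1)
    · rw [Set.indicator_of_notMem hp, mul_zero]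
      exact mul_nonneg (hχ0 p) (abs_nonneg _)
  refine ⟨B, ?_, fun n t ht => (hslice n t ht).trans (hmass n)⟩
  exact (integral_nonneg fun p => mul_nonneg (hχ0 p) (abs_nonneg _)).trans (hmass 0)

/-- The exit times are almost surely finite: while the Birkhoff sums survive they leave every
compact interval for good, by `summable_confined`, but their expectation stays bounded. -/
theorem tendsto_survival (hM : IsTransitionMatrix M)
    (hψ : IsHolderPlus ψ) (hψ1 : IsNormalized ψ) (hν : IsGibbs ψ ν) (hfH : IsHolder f)
    (hf0 : ∫ x, f x ∂ν = 0) (hfc : ¬ IsCoboundary f) (t : ℝ) :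
    Tendsto (fun n => ∫ x, (survival f n).indicator (fun _ => (1 : ℝ)) (x, t) ∂ν) atTop (𝓝 0) := by
  have := hν.isProbabilityMeasure
  obtain ⟨C, α, hf⟩ := hfH.exists_isHolderWith
  have hfcont := hf.continuous
  obtain ⟨B, hB0, hB⟩ := exists_integral_abs_weight_le hM hψ hψ1 hν hfH hf0 hfc t
  have hle : ∀ (L : ℝ), 0 < L → ∀ n, ∫ x, (survival f n).indicator (fun _ => (1 : ℝ)) (x, t) ∂ν ≤
      ν.real (confined f n (max |t| L)) + B / L := by
    intro L hL n
    have hm := measurableSet_confined hfcont n (max |t| L)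
    have hwm : Measurable fun x => |weight f n (x, t)| :=
      ((measurable_weight hfcont n).comp (measurable_id.prodMk measurable_const)).abs
    obtain ⟨W, hW⟩ := exists_abs_weight_le hfcont n
    have hwi : Integrable (fun x => |weight f n (x, t)|) ν :=
      Integrable.of_bound hwm.aestronglyMeasurable W
        (ae_of_all _ fun x => by rw [Real.norm_eq_abs, abs_abs]; exact hW _)
    have hci : Integrable ((confined f n (max |t| L)).indicator fun _ => (1 : ℝ)) ν :=
      (integrable_const _).indicator hm
    calc _ ≤ ∫ x, ((confined f n (max |t| L)).indicator (fun _ => (1 : ℝ)) x +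
            L⁻¹ * |weight f n (x, t)|) ∂ν := by
          refine integral_mono_of_nonneg (ae_of_all _ fun x => indicator_survival_nonneg _ _)
            (hci.add (hwi.const_mul _)) (ae_of_all _ fun x => ?_)
          show (survival f n).indicator (fun _ => (1 : ℝ)) (x, t) ≤
            (confined f n (max |t| L)).indicator (fun _ => (1 : ℝ)) x + L⁻¹ * |weight f n (x, t)|
          have hn1 : 0 ≤ (confined f n (max |t| L)).indicator (fun _ => (1 : ℝ)) x :=
            Set.indicator_nonneg (fun _ _ => zero_le_one) x
          have hn2 : 0 ≤ L⁻¹ * |weight f n (x, t)| := by positivity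
          by_cases hs : (x, t) ∈ survival f n
          · rw [Set.indicator_of_mem hs]
            by_cases hc : birkhoffSum (shift M) f n x ≤ L
            · have : x ∈ confined f n (max |t| L) := by
                refine ⟨fun i hi => ?_, hc.trans (le_max_right _ _)⟩
                have h1 := le_max_left |t| L
                rcases Nat.eq_zero_or_pos i with rfl | hi0
                · rw [birkhoffSum_zero]; linarith [abs_nonneg t]
                · have := mem_survival.1 hs i hi0 hi
                  dsimp only at this
                  linarith [le_abs_self t]
              rw [Set.indicator_of_mem this]; linarith
            · have : 1 ≤ L⁻¹ * |weight f n (x, t)| := by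
                rw [inv_mul_eq_div, one_le_div hL, weight, Set.indicator_of_mem hs, mul_one]
                exact (not_le.1 hc).le.trans (le_abs_self _)
              linarith
          · rw [Set.indicator_of_notMem hs]; linarith
      _ = ν.real (confined f n (max |t| L)) + L⁻¹ * ∫ x, |weight f n (x, t)| ∂ν := by
          rw [integral_add hci (hwi.const_mul _), integral_const_mul, integral_indicator_const _ hm,
            smul_eq_mul, mul_one]
      _ ≤ _ := by
          rw [div_eq_inv_mul]
          have := hB n t le_rfl
          gcongr
  refine Metric.tendsto_atTop.2 fun ε hε => ?_
  set L := 2 * (B + 1) / ε with hL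
  have hL0 : 0 < L := by positivity
  have hBL : B / L < ε / 2 := by
    rw [hL, div_div_eq_mul_div, div_lt_div_iff₀ (by positivity) (by norm_num)]
    nlinarith
  have hsum := (summable_confined hM hψ hψ1 hν hf hf0 hfc (max |t| L)).tendsto_atTop_zero
  obtain ⟨N, hN⟩ := Metric.tendsto_atTop.1 hsum (ε / 2) (by positivity)
  refine ⟨N, fun n hn => ?_⟩
  have h1 := hN n hn
  rw [Real.dist_eq, sub_zero, abs_of_nonneg measureReal_nonneg] at h1
  rw [Real.dist_eq, sub_zero,
    abs_of_nonneg (integral_nonneg fun x => indicator_survival_nonneg _ _)]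
  linarith [hle L hL0 n]

end Bounds

/-! ### The limit measure -/

section TestFunctions

variable {ν : Measure (TwoSided M)} {f : TwoSided M → ℝ} {φ : TwoSided M × ℝ → ℝ}

theorem exists_strip (hφs : HasCompactSupport φ) :
    ∃ K, 0 ≤ K ∧ ∀ x t, K ≤ |t| → φ (x, t) = 0 := by
  obtain ⟨K, hK⟩ := (hφs.isCompact.image (continuous_abs.comp continuous_snd)).bddAbove
  refine ⟨max K 0 + 1, by positivity, fun x t ht => ?_⟩
  by_contra h
  have := hK ⟨(x, t), subset_tsupport φ h, rfl⟩
  simp only [Function.comp_apply] at this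
  linarith [le_max_left K 0]

theorem exists_abs_le (hφ : Continuous φ) (hφs : HasCompactSupport φ) :
    ∃ A, 0 ≤ A ∧ ∀ p, |φ p| ≤ A := by
  obtain ⟨A, hA⟩ := hφ.bounded_above_of_compact_support hφs
  exact ⟨max A 0, le_max_right _ _, fun p => (hA p).trans (le_max_left _ _)⟩

theorem eq_zero_of_notMem_Icc {K : ℝ} (hφK : ∀ x t, K ≤ |t| → φ (x, t) = 0)
    (p : TwoSided M × ℝ) (hp : p.2 ∉ Set.Icc (-K) K) : φ p = 0 := by
  refine hφK p.1 p.2 ?_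
  by_contra hlt
  have := abs_lt.1 (not_le.1 hlt)
  exact hp ⟨this.1.le, this.2.le⟩

theorem integrable_mul_weight [IsProbabilityMeasure ν] (hf : Continuous f) (hφ : Continuous φ)
    (hφs : HasCompactSupport φ) (n : ℕ) :
    Integrable (fun p => φ p * weight f n p) (ν.prod volume) := by
  obtain ⟨K, hK, hφK⟩ := exists_strip hφs
  obtain ⟨A, hA0, hA⟩ := exists_abs_le hφ hφs
  obtain ⟨W, hW⟩ := exists_abs_weight_le hf n
  refine integrable_of_strip (A := A * W) (a := -K) (b := K)
    (hφ.measurable.mul (measurable_weight hf n)) (fun p => ?_)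
    fun p hp => by rw [eq_zero_of_notMem_Icc hφK p hp, zero_mul]
  rw [abs_mul]
  exact mul_le_mul (hA p) (hW p) (abs_nonneg _) hA0

/-- A compactly supported continuous function is uniformly close to one that depends on finitely
many coordinates of `x`. -/
theorem exists_forall_agree_abs_sub_le (hφ : Continuous φ) (hφs : HasCompactSupport φ) {ε : ℝ}
    (hε : 0 < ε) : ∃ q : ℕ, ∀ x y t, Agree (-q) q x y → |φ (x, t) - φ (y, t)| ≤ ε := by
  obtain ⟨K, hK, hφK⟩ := exists_strip hφs
  have hc : IsCompact ((Set.univ : Set (TwoSided M)) ×ˢ Set.Icc (-K) K) :=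
    isCompact_univ.prod isCompact_Icc
  have key : ∃ q : ℕ, ∀ x y t, (x, t) ∈ (Set.univ : Set (TwoSided M)) ×ˢ Set.Icc (-K) K →
      Agree (-q) q x y → |φ (x, t) - φ (y, t)| ≤ ε := by
    refine hc.induction_on (p := fun s => ∃ q : ℕ, ∀ x y t, (x, t) ∈ s →
      Agree (-q) q x y → |φ (x, t) - φ (y, t)| ≤ ε) ⟨0, fun x y t h => h.elim⟩
      (fun s s' hss ⟨q, hq⟩ => ⟨q, fun x y t h => hq x y t (hss h)⟩)
      (fun s s' ⟨q, hq⟩ ⟨q', hq'⟩ => ⟨max q q', fun x y t h ha => ?_⟩) ?_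
    · rcases h with h | h
      · exact hq x y t h (ha.mono (by push_cast; omega) (by push_cast; omega))
      · exact hq' x y t h (ha.mono (by push_cast; omega) (by push_cast; omega))
    · rintro ⟨x, t⟩ -
      have h1 : {p | dist (φ p) (φ (x, t)) < ε / 2} ∈ 𝓝 (x, t) :=
        hφ.continuousAt.eventually (Metric.ball_mem_nhds _ (half_pos hε))
      obtain ⟨u, hu, v, hv, huv⟩ := mem_nhds_prod_iff.1 h1
      obtain ⟨q, hq⟩ := exists_agree_subset hu
      refine ⟨{y | Agree (-q) q y x} ×ˢ v, mem_nhdsWithin_of_mem_nhds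
        (prod_mem_nhds (eventually_agree _ _ x) hv), q, fun y y' s hs ha => ?_⟩
      have d1 : dist (φ (y, s)) (φ (x, t)) < ε / 2 := huv ⟨hq y hs.1, hs.2⟩
      have d2 : dist (φ (y', s)) (φ (x, t)) < ε / 2 := huv ⟨hq y' (ha.symm.trans hs.1), hs.2⟩
      rw [← Real.dist_eq]
      linarith [dist_triangle_right (φ (y, s)) (φ (y', s)) (φ (x, t))]
  obtain ⟨q, hq⟩ := key
  refine ⟨q, fun x y t h => ?_⟩
  by_cases ht : t ∈ Set.Icc (-K) K
  · exact hq x y t ⟨trivial, ht⟩ h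
  · rw [eq_zero_of_notMem_Icc hφK (x, t) ht, eq_zero_of_notMem_Icc hφK (y, t) ht, sub_zero,
      abs_zero]
    exact hε.le

end TestFunctions

section Limit

variable {ψ : OneSided M → ℝ} {ν : Measure (TwoSided M)} {f : TwoSided M → ℝ}

/-- Test functions of finitely many coordinates are treated by `exists_tendsto_tail`. A general test
function is uniformly close to one of these, and by `exists_integral_abs_weight_le` the error made
is uniform in `n`. -/
theorem exists_tendsto_integral_mul_weight (hM : IsTransitionMatrix M)
    (hψ : IsHolderPlus ψ) (hψ1 : IsNormalized ψ) (hν : IsGibbs ψ ν) (hfH : IsHolder f)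
    (hf0 : ∫ x, f x ∂ν = 0) (hfc : ¬ IsCoboundary f) {φ : TwoSided M × ℝ → ℝ}
    (hφ : Continuous φ) (hφs : HasCompactSupport φ) :
    ∃ L, Tendsto (fun n => ∫ p, φ p * weight f n p ∂(ν.prod volume)) atTop (𝓝 L) := by
  have := hν.isProbabilityMeasure
  obtain ⟨C, α, hf⟩ := hfH.exists_isHolderWith
  have hfcont := hf.continuous
  obtain ⟨K, hK, hφK⟩ := exists_strip hφs
  obtain ⟨A, hA0, hA⟩ := exists_abs_le hφ hφs
  obtain ⟨B, hB0, hB⟩ := exists_integral_abs_weight_le hM hψ hψ1 hν hfH hf0 hfc K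
  refine cauchySeq_tendsto_of_complete (Metric.cauchySeq_iff.2 fun ε hε => ?_)
  set η := ε / (4 * (B * (2 * K) + 1)) with hη
  have hη0 : 0 < η := by positivity
  have hηε : η * B * (K - -K) ≤ ε / 4 := by
    have : η * (B * (2 * K) + 1) = ε / 4 := by rw [hη]; field_simp
    nlinarith
  obtain ⟨q, hq⟩ := exists_forall_agree_abs_sub_le hφ hφs hη0
  obtain ⟨R, hR1, hR2⟩ := exists_representative M (-(q : ℤ)) q
  set φ' : TwoSided M × ℝ → ℝ := fun p => φ (R p.1, p.2) with hφ'
  have hRc : Continuous R := continuous_of_agree hR2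
  have hφ'c : Continuous φ' := by fun_prop
  have hφ'K : ∀ x t, K ≤ |t| → φ' (x, t) = 0 := fun x t h => hφK _ _ h
  have hφ's : HasCompactSupport φ' := by
    refine HasCompactSupport.of_support_subset_isCompact
      (isCompact_univ.prod (isCompact_Icc (a := -K) (b := K))) fun p hp => ⟨trivial, ?_⟩
    by_contra h
    exact hp (eq_zero_of_notMem_Icc hφ'K p h)
  obtain ⟨L, hL⟩ := exists_tendsto_tail (q := q) hM hψ hψ1 hν hf hfH hf0 hfc hφ'c
    (fun p => hA _) hA0 (fun x y t h => by simp only [hφ', hR2 x y h]) hφ'K hK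
  have hdiff : ∀ n, |∫ p, φ p * weight f n p ∂(ν.prod volume) -
      ∫ p, φ' p * weight f n p ∂(ν.prod volume)| ≤ ε / 4 := by
    intro n
    obtain ⟨W, hW⟩ := exists_abs_weight_le hfcont n
    rw [← integral_sub (integrable_mul_weight hfcont hφ hφs n)
      (integrable_mul_weight hfcont hφ'c hφ's n)]
    have e : ∀ p, φ p * weight f n p - φ' p * weight f n p = (φ p - φ' p) * weight f n p :=
      fun p => by ring
    simp only [e]
    refine (abs_integral_prod_le (g := fun p => φ p - φ' p) (hφ.sub hφ'c).measurable
      (fun p => hq _ _ _ (hR1 p.1).symm) (fun p hp => ?_) (by linarith)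
      (measurable_weight hfcont n) hW fun t ht => hB n t ht.2).trans hηε
    rw [eq_zero_of_notMem_Icc hφK p hp, eq_zero_of_notMem_Icc hφ'K p hp, sub_zero]
  have hL' : Tendsto (fun n => ∫ p, φ' p * weight f n p ∂(ν.prod volume)) atTop (𝓝 L) :=
    hL.congr fun n => (integral_mul_weight hfcont hφ'c (fun p => hA _) hφ'K n).symm
  obtain ⟨N, hN⟩ := Metric.cauchySeq_iff.1 hL'.cauchySeq (ε / 2) (half_pos hε)
  refine ⟨N, fun m hm n hn => ?_⟩
  have d1 := abs_le.1 (hdiff m)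
  have d2 := abs_le.1 (hdiff n)
  have d3 := abs_lt.1 (hN m hm n hn)
  rw [Real.dist_eq, abs_lt]
  constructor <;> linarith [d1.1, d1.2, d2.1, d2.2, d3.1, d3.2]

theorem tendsto_integral_mul_survival (hM : IsTransitionMatrix M)
    (hψ : IsHolderPlus ψ) (hψ1 : IsNormalized ψ) (hν : IsGibbs ψ ν) (hfH : IsHolder f)
    (hf0 : ∫ x, f x ∂ν = 0) (hfc : ¬ IsCoboundary f) {g : TwoSided M × ℝ → ℝ} {A K : ℝ}
    (hg : Measurable g) (hA : ∀ p, |g p| ≤ A) (hK : 0 ≤ K)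
    (h0 : ∀ p, p.2 ∉ Set.Icc (-K) K → g p = 0) :
    Tendsto (fun n => ∫ p, g p * (survival f n).indicator (fun _ => (1 : ℝ)) p ∂(ν.prod volume))
      atTop (𝓝 0) := by
  have := hν.isProbabilityMeasure
  obtain ⟨C, α, hf⟩ := hfH.exists_isHolderWith
  have hfcont := hf.continuous
  have h1 := ((tendsto_survival hM hψ hψ1 hν hfH hf0 hfc K).const_mul A).mul_const (K - -K)
  rw [mul_zero, zero_mul] at h1
  refine squeeze_zero_norm (fun n => ?_) h1
  have hm := measurable_indicator_survival hfcont n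
  have habs : ∀ p, |(survival f n).indicator (fun _ => (1 : ℝ)) p| =
      (survival f n).indicator (fun _ => (1 : ℝ)) p := fun p =>
    abs_of_nonneg (indicator_survival_nonneg n p)
  refine abs_integral_prod_le hg hA h0 (by linarith) hm (W := 1)
    (fun p => (habs p).le.trans (indicator_survival_le_one n p)) fun t ht => ?_
  simp only [habs]
  refine integral_mono_of_nonneg (ae_of_all _ fun x => indicator_survival_nonneg _ _) ?_
    (ae_of_all _ fun x => indicator_survival_mono ht.2)
  exact Integrable.of_bound
    (hm.comp (measurable_id.prodMk measurable_const)).aestronglyMeasurable 1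
    (ae_of_all _ fun x => (habs _).le.trans (indicator_survival_le_one n _))

/-- On `{τ_t^f > n}` the weight is at least `-t`, and `ν ⊗ dt`-almost every exit time is finite. -/
theorem nonneg_of_tendsto (hM : IsTransitionMatrix M)
    (hψ : IsHolderPlus ψ) (hψ1 : IsNormalized ψ) (hν : IsGibbs ψ ν) (hfH : IsHolder f)
    (hf0 : ∫ x, f x ∂ν = 0) (hfc : ¬ IsCoboundary f) {φ : TwoSided M × ℝ → ℝ}
    (hφ : Continuous φ) (hφs : HasCompactSupport φ) (hφ0 : ∀ p, 0 ≤ φ p) {L : ℝ}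
    (hL : Tendsto (fun n => ∫ p, φ p * weight f n p ∂(ν.prod volume)) atTop (𝓝 L)) : 0 ≤ L := by
  have := hν.isProbabilityMeasure
  obtain ⟨C, α, hf⟩ := hfH.exists_isHolderWith
  have hfcont := hf.continuous
  obtain ⟨K, hK, hφK⟩ := exists_strip hφs
  obtain ⟨A, hA0, hA⟩ := exists_abs_le hφ hφs
  have h1 := (tendsto_integral_mul_survival hM hψ hψ1 hν hfH hf0 hfc hφ.measurable hA hK
    (eq_zero_of_notMem_Icc hφK)).const_mul (-K)
  rw [mul_zero] at h1
  refine le_of_tendsto_of_tendsto h1 hL (eventually_atTop.2 ⟨1, fun n hn => ?_⟩)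
  have hi : Integrable (fun p => φ p * (survival f n).indicator (fun _ => (1 : ℝ)) p)
      (ν.prod volume) := by
    refine integrable_of_strip (A := A) (a := -K) (b := K)
      (hφ.measurable.mul (measurable_indicator_survival hfcont n)) (fun p => ?_)
      fun p hp => by rw [eq_zero_of_notMem_Icc hφK p hp, zero_mul]
    rw [abs_mul, abs_of_nonneg (indicator_survival_nonneg n p)]
    exact (mul_le_of_le_one_right (abs_nonneg _) (indicator_survival_le_one n p)).trans (hA p)
  show -K * ∫ p, φ p * (survival f n).indicator (fun _ => (1 : ℝ)) p ∂(ν.prod volume) ≤ _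
  rw [← integral_const_mul]
  refine integral_mono (hi.const_mul _) (integrable_mul_weight hfcont hφ hφs n) fun p => ?_
  show -K * (φ p * (survival f n).indicator (fun _ => (1 : ℝ)) p) ≤ φ p * weight f n p
  by_cases hs : p ∈ survival f n
  · rw [weight, Set.indicator_of_mem hs, mul_one, mul_one]
    by_cases hp : K ≤ |p.2|
    · rw [show φ p = 0 from hφK p.1 p.2 hp]; simp
    · have h2 := (abs_lt.1 (not_le.1 hp)).2
      have h3 := mem_survival.1 hs n hn le_rfl
      nlinarith [hφ0 p]
  · rw [weight, Set.indicator_of_notMem hs]; simp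

/-- The limits define a positive linear functional, represented by a Radon measure. -/
theorem exists_regular_measure (hM : IsTransitionMatrix M)
    (hψ : IsHolderPlus ψ) (hψ1 : IsNormalized ψ) (hν : IsGibbs ψ ν) (hfH : IsHolder f)
    (hf0 : ∫ x, f x ∂ν = 0) (hfc : ¬ IsCoboundary f) :
    ∃ μ : Measure (TwoSided M × ℝ), μ.Regular ∧ ∀ φ : TwoSided M × ℝ → ℝ, Continuous φ →
      HasCompactSupport φ → Tendsto (fun n => ∫ p, φ p * weight f n p ∂(ν.prod volume)) atTop
        (𝓝 (∫ p, φ p ∂μ)) := by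
  have := hν.isProbabilityMeasure
  obtain ⟨C, α, hf⟩ := hfH.exists_isHolderWith
  have hfcont := hf.continuous
  have hex : ∀ φ : CompactlySupportedContinuousMap (TwoSided M × ℝ) ℝ, ∃ L,
      Tendsto (fun n => ∫ p, φ p * weight f n p ∂(ν.prod volume)) atTop (𝓝 L) := fun φ =>
    exists_tendsto_integral_mul_weight hM hψ hψ1 hν hfH hf0 hfc φ.continuous φ.hasCompactSupport
  choose Λ hΛ using hex
  have hadd : ∀ φ φ', Λ (φ + φ') = Λ φ + Λ φ' := fun φ φ' => by
    refine tendsto_nhds_unique (hΛ (φ + φ')) (((hΛ φ).add (hΛ φ')).congr fun n => ?_)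
    have i1 : Integrable (fun p => φ p * weight f n p) (ν.prod volume) :=
      integrable_mul_weight hfcont φ.continuous φ.hasCompactSupport n
    have i2 : Integrable (fun p => φ' p * weight f n p) (ν.prod volume) :=
      integrable_mul_weight hfcont φ'.continuous φ'.hasCompactSupport n
    rw [← integral_add i1 i2]
    refine integral_congr_ae (ae_of_all _ fun p => ?_)
    show φ p * weight f n p + φ' p * weight f n p = (φ p + φ' p) * weight f n p
    ring
  have hsmul : ∀ (c : ℝ) φ, Λ (c • φ) = c • Λ φ := fun c φ => by
    refine tendsto_nhds_unique (hΛ (c • φ)) (((hΛ φ).const_mul c).congr fun n => ?_)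
    rw [← integral_const_mul]
    refine integral_congr_ae (ae_of_all _ fun p => ?_)
    show c * (φ p * weight f n p) = (c * φ p) * weight f n p
    ring
  let Λ' : CompactlySupportedContinuousMap (TwoSided M × ℝ) ℝ →ₚ[ℝ] ℝ :=
    PositiveLinearMap.mk₀ { toFun := Λ, map_add' := hadd, map_smul' := hsmul } fun φ hφ =>
      nonneg_of_tendsto hM hψ hψ1 hν hfH hf0 hfc φ.continuous φ.hasCompactSupport (fun p => hφ p)
        (hΛ φ)
  refine ⟨RealRMK.rieszMeasure Λ', inferInstance, fun φ hφ hφs => ?_⟩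
  have := RealRMK.integral_rieszMeasure Λ' ⟨⟨φ, hφ⟩, hφs⟩
  change ∫ p, φ p ∂_ = Λ ⟨⟨φ, hφ⟩, hφs⟩ at this
  rw [this]
  exact hΛ ⟨⟨φ, hφ⟩, hφs⟩

end Limit

/-! ### The invariance of the limit measure -/

section Invariance

variable {ψ : OneSided M → ℝ} {ν : Measure (TwoSided M)} {f : TwoSided M → ℝ}

/-- The skew product `(x, t) ↦ (T x, t + f x)`. -/
def skew (f : TwoSided M → ℝ) (hf : Continuous f) : TwoSided M × ℝ ≃ₜ TwoSided M × ℝ where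
  toFun p := (shift M p.1, p.2 + f p.1)
  invFun p := ((shift M).symm p.1, p.2 - f ((shift M).symm p.1))
  left_inv p := by simp
  right_inv p := by simp
  continuous_toFun := by fun_prop
  continuous_invFun := by fun_prop

theorem IsGibbs.measurePreserving_skew (hν : IsGibbs ψ ν) (hf : Continuous f) :
    MeasurePreserving (skew f hf) (ν.prod volume) (ν.prod volume) := by
  have := hν.isProbabilityMeasure
  refine hν.measurePreserving.skew_product (g := fun x t => t + f x) ?_ (ae_of_all _ fun x => ?_)
  · exact (measurable_snd.add (hf.measurable.comp measurable_fst))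
  · exact (measurePreserving_add_right volume (f x)).map_eq

/-- `τ_t^f(x) > n + 1` means that `t + f x ≥ 0` and that
the exit time of `(T x, t + f x)` is larger than `n`. -/
theorem weight_succ (hf : Continuous f) (n : ℕ) (p : TwoSided M × ℝ) :
    weight f (n + 1) p = {q : TwoSided M × ℝ | 0 ≤ q.2}.indicator (fun _ => (1 : ℝ)) (skew f hf p) *
      (weight f n (skew f hf p) +
        f p.1 * (survival f n).indicator (fun _ => (1 : ℝ)) (skew f hf p)) := by
  have hiff : p ∈ survival f (n + 1) ↔
      skew f hf p ∈ {q : TwoSided M × ℝ | 0 ≤ q.2} ∧ skew f hf p ∈ survival f n := by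
    rw [mem_survival, mem_survival]
    show _ ↔ 0 ≤ p.2 + f p.1 ∧ ∀ i, 1 ≤ i → i ≤ n →
      0 ≤ p.2 + f p.1 + birkhoffSum (shift M) f i (shift M p.1)
    constructor
    · intro h
      refine ⟨by simpa [birkhoffSum_one] using h 1 le_rfl (by omega), fun i h1 h2 => ?_⟩
      have := h (i + 1) (by omega) (by omega)
      rwa [birkhoffSum_succ', ← add_assoc] at this
    · rintro ⟨h1, h2⟩ i hi hi'
      obtain ⟨j, rfl⟩ : ∃ j, i = j + 1 := ⟨i - 1, by omega⟩
      rw [birkhoffSum_succ', ← add_assoc]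
      rcases Nat.eq_zero_or_pos j with rfl | hj
      · rw [birkhoffSum_zero, add_zero]; exact h1
      · exact h2 j hj (by omega)
  rw [weight, weight, birkhoffSum_succ']
  by_cases h1 : skew f hf p ∈ {q : TwoSided M × ℝ | 0 ≤ q.2}
  · by_cases h2 : skew f hf p ∈ survival f n
    · rw [Set.indicator_of_mem (hiff.2 ⟨h1, h2⟩), Set.indicator_of_mem h1, Set.indicator_of_mem h2]
      show (f p.1 + birkhoffSum (shift M) f n (shift M p.1)) * 1 =
        1 * (birkhoffSum (shift M) f n (shift M p.1) * 1 + f p.1 * 1)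
      ring
    · rw [Set.indicator_of_notMem (fun h => h2 (hiff.1 h).2), Set.indicator_of_notMem h2]
      ring
  · rw [Set.indicator_of_notMem (fun h => h1 (hiff.1 h).1), Set.indicator_of_notMem h1]
    ring

/-- A continuous approximation of `1_{t ≥ 0}`, with slope `j + 1` to the left of `0`. -/
def ramp (j : ℕ) (t : ℝ) : ℝ := max 0 (min 1 (1 + (j + 1) * t))

theorem continuous_ramp (j : ℕ) : Continuous (ramp j) := by unfold ramp; fun_prop

theorem ramp_nonneg (j : ℕ) (t : ℝ) : 0 ≤ ramp j t := le_max_left _ _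

theorem ramp_le_one (j : ℕ) (t : ℝ) : ramp j t ≤ 1 := max_le zero_le_one (min_le_left _ _)

theorem ramp_of_nonneg (j : ℕ) {t : ℝ} (ht : 0 ≤ t) : ramp j t = 1 := by
  have : 0 ≤ ((j : ℝ) + 1) * t := by positivity
  rw [ramp, min_eq_left (by linarith), max_eq_right zero_le_one]

theorem ramp_of_le (j : ℕ) {t : ℝ} (ht : t ≤ -(1 / ((j : ℝ) + 1))) : ramp j t = 0 := by
  have h1 : (0 : ℝ) < (j : ℝ) + 1 := by positivity
  have h2 := mul_le_mul_of_nonneg_left ht h1.le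
  have h3 : ((j : ℝ) + 1) * -(1 / ((j : ℝ) + 1)) = -1 := by field_simp
  rw [ramp, max_eq_left]
  exact (min_le_right _ _).trans (by linarith)

/-- The identity follows from `weight_succ` in the limit. The indicator of `{t ≥ 0}` is replaced by
a ramp; the error is of the order of the length of the ramp, uniformly in `n`, by the bound of
`exists_integral_abs_weight_le`. -/
theorem integral_eq_of_tendsto (hM : IsTransitionMatrix M)
    (hψ : IsHolderPlus ψ) (hψ1 : IsNormalized ψ) (hν : IsGibbs ψ ν) (hfH : IsHolder f)
    (hf0 : ∫ x, f x ∂ν = 0) (hfc : ¬ IsCoboundary f) {μ : Measure (TwoSided M × ℝ)}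
    (hμ : μ.Regular) (hlim : ∀ φ : TwoSided M × ℝ → ℝ, Continuous φ →
      HasCompactSupport φ → Tendsto (fun n => ∫ p, φ p * weight f n p ∂(ν.prod volume)) atTop
        (𝓝 (∫ p, φ p ∂μ)))
    {φ : TwoSided M × ℝ → ℝ} (hφ : Continuous φ) (hφs : HasCompactSupport φ) :
    ∫ p, φ p ∂μ = ∫ p : TwoSided M × ℝ,
      φ ((shift M).symm p.1, p.2 - f ((shift M).symm p.1)) *
        {q : TwoSided M × ℝ | 0 ≤ q.2}.indicator (fun _ => (1 : ℝ)) p ∂μ := by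
  have := hν.isProbabilityMeasure
  obtain ⟨C, α, hf⟩ := hfH.exists_isHolderWith
  have hfcont := hf.continuous
  set Θ := skew f hfcont with hΘ
  set χ : TwoSided M × ℝ → ℝ := fun p => φ (Θ.symm p) with hχ
  have hχc : Continuous χ := hφ.comp Θ.symm.continuous
  have hχs : HasCompactSupport χ := hφs.comp_homeomorph Θ.symm
  obtain ⟨K, hK, hχK⟩ := exists_strip hχs
  have hχ0 := eq_zero_of_notMem_Icc hχK
  obtain ⟨A, hA0, hA⟩ := exists_abs_le hχc hχs
  set pos : TwoSided M × ℝ → ℝ := {q : TwoSided M × ℝ | 0 ≤ q.2}.indicator fun _ => (1 : ℝ)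
    with hpos
  have hposm : Measurable pos :=
    measurable_const.indicator (measurableSet_le measurable_const measurable_snd)
  have hpos1 : ∀ p : TwoSided M × ℝ, 0 ≤ p.2 → pos p = 1 := fun p hp =>
    Set.indicator_of_mem (s := {q : TwoSided M × ℝ | 0 ≤ q.2}) hp _
  have hpos0 : ∀ p : TwoSided M × ℝ, p.2 < 0 → pos p = 0 := fun p hp =>
    Set.indicator_of_notMem (s := {q : TwoSided M × ℝ | 0 ≤ q.2}) (not_le.2 hp) _
  have hposA : ∀ p, |pos p| ≤ 1 := fun p => by
    rcases le_or_gt 0 p.2 with h | h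
    · rw [hpos1 p h, abs_one]
    · rw [hpos0 p h, abs_zero]; exact zero_le_one
  show ∫ p, φ p ∂μ = ∫ p, χ p * pos p ∂μ
  obtain ⟨F, hF⟩ := (isCompact_range hfcont.abs).bddAbove
  replace hF : ∀ x, |f x| ≤ F := fun x => hF ⟨x, rfl⟩
  obtain ⟨B, hB0, hB⟩ := exists_integral_abs_weight_le hM hψ hψ1 hν hfH hf0 hfc 0
  -- the weights of order `n + 1`, carried along the skew product
  set r : TwoSided M × ℝ → ℝ := fun p => χ p * pos p * f ((shift M).symm p.1) with hr
  have hfs : Measurable fun p : TwoSided M × ℝ => f ((shift M).symm p.1) :=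
    (hfcont.comp ((shift M).symm.continuous.comp continuous_fst)).measurable
  have hrm : Measurable r := (hχc.measurable.mul hposm).mul hfs
  have hχposA : ∀ p, |χ p * pos p| ≤ A := fun p => by
    rw [abs_mul]
    exact (mul_le_of_le_one_right (abs_nonneg _) (hposA p)).trans (hA p)
  have hrA : ∀ p, |r p| ≤ A * F := fun p => by
    rw [hr, abs_mul]
    exact mul_le_mul (hχposA p) (hF _) (abs_nonneg _) hA0
  have hr0 : ∀ p, p.2 ∉ Set.Icc (-K) K → r p = 0 := fun p hp => by
    simp only [hr, hχ0 p hp, zero_mul]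
  have hrlim := tendsto_integral_mul_survival hM hψ hψ1 hν hfH hf0 hfc hrm hrA hK hr0
  have hi1 : ∀ n, Integrable (fun p => χ p * pos p * weight f n p) (ν.prod volume) := fun n => by
    obtain ⟨W, hW⟩ := exists_abs_weight_le hfcont n
    refine integrable_of_strip (A := A * W) (a := -K) (b := K)
      ((hχc.measurable.mul hposm).mul (measurable_weight hfcont n)) (fun p => ?_)
      fun p hp => by rw [hχ0 p hp, zero_mul, zero_mul]
    rw [abs_mul]
    exact mul_le_mul (hχposA p) (hW p) (abs_nonneg _) hA0
  have hi2 : ∀ n, Integrable (fun p => r p * (survival f n).indicator (fun _ => (1 : ℝ)) p)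
      (ν.prod volume) := fun n => by
    refine integrable_of_strip (A := A * F) (a := -K) (b := K)
      (hrm.mul (measurable_indicator_survival hfcont n)) (fun p => ?_)
      fun p hp => by rw [hr0 p hp, zero_mul]
    rw [abs_mul, abs_of_nonneg (indicator_survival_nonneg n p)]
    exact (mul_le_of_le_one_right (abs_nonneg _) (indicator_survival_le_one n p)).trans (hrA p)
  have hstep : ∀ n, ∫ p, φ p * weight f (n + 1) p ∂(ν.prod volume) =
      ∫ p, χ p * pos p * weight f n p ∂(ν.prod volume) +
        ∫ p, r p * (survival f n).indicator (fun _ => (1 : ℝ)) p ∂(ν.prod volume) := by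
    intro n
    rw [← integral_add (hi1 n) (hi2 n)]
    refine Eq.trans (integral_congr_ae (ae_of_all _ fun p => ?_))
      ((hν.measurePreserving_skew hfcont).integral_comp Θ.measurableEmbedding
        fun p => χ p * pos p * weight f n p +
          r p * (survival f n).indicator (fun _ => (1 : ℝ)) p)
    have e1 : χ (Θ p) = φ p := by simp only [hχ, Homeomorph.symm_apply_apply]
    have e2 : (shift M).symm (Θ p).1 = p.1 := (shift M).symm_apply_apply p.1
    show φ p * weight f (n + 1) p = χ (Θ p) * pos (Θ p) * weight f n (Θ p) +
      χ (Θ p) * pos (Θ p) * f ((shift M).symm (Θ p).1) * _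
    rw [weight_succ hfcont, e1, e2]
    ring
  have hlim1 : Tendsto (fun n => ∫ p, χ p * pos p * weight f n p ∂(ν.prod volume)) atTop
      (𝓝 (∫ p, φ p ∂μ)) := by
    have := ((tendsto_add_atTop_iff_nat 1).2 (hlim φ hφ hφs)).sub hrlim
    rw [sub_zero] at this
    refine this.congr fun n => ?_
    rw [hstep n, add_sub_cancel_right]
  have hbound : ∀ j : ℕ, |∫ p, φ p ∂μ - ∫ p, χ p * ramp j p.2 ∂μ| ≤
      A * B * (1 / ((j : ℝ) + 1)) := by
    intro j
    have hc : Continuous fun p : TwoSided M × ℝ => χ p * ramp j p.2 :=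
      hχc.mul ((continuous_ramp j).comp continuous_snd)
    have hs : HasCompactSupport fun p : TwoSided M × ℝ => χ p * ramp j p.2 := hχs.mul_right
    have hl := hlim1.sub (hlim _ hc hs)
    refine le_of_tendsto hl.abs (Eventually.of_forall fun n => ?_)
    obtain ⟨W, hW⟩ := exists_abs_weight_le hfcont n
    rw [← integral_sub (hi1 n) (integrable_mul_weight hfcont hc hs n)]
    have e : ∀ p : TwoSided M × ℝ, χ p * pos p * weight f n p - χ p * ramp j p.2 * weight f n p =
        (χ p * (pos p - ramp j p.2)) * weight f n p := fun p => by ring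
    simp only [e]
    have hj : (0 : ℝ) < 1 / ((j : ℝ) + 1) := by positivity
    have hd : ∀ p : TwoSided M × ℝ, |pos p - ramp j p.2| ≤ 1 := fun p => by
      rcases le_or_gt 0 p.2 with h | h
      · rw [hpos1 p h, ramp_of_nonneg j h]; simp
      · rw [hpos0 p h, zero_sub, abs_neg, abs_of_nonneg (ramp_nonneg _ _)]
        exact ramp_le_one _ _
    have := abs_integral_prod_le (ν := ν) (g := fun p => χ p * (pos p - ramp j p.2)) (A := A)
      (a := -(1 / ((j : ℝ) + 1))) (b := 0)
      (hχc.measurable.mul (hposm.sub ((continuous_ramp j).measurable.comp measurable_snd)))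
      (fun p => by
        rw [abs_mul]
        exact (mul_le_of_le_one_right (abs_nonneg _) (hd p)).trans (hA p))
      (fun p hp => by
        rcases le_or_gt 0 p.2 with h | h
        · rw [hpos1 p h, ramp_of_nonneg j h, sub_self, mul_zero]
        · have : p.2 ≤ -(1 / ((j : ℝ) + 1)) := by
            by_contra hlt
            exact hp ⟨(not_le.1 hlt).le, h.le⟩
          rw [hpos0 p h, ramp_of_le j this, sub_self, mul_zero])
      (by linarith) (measurable_weight hfcont n) hW (C := B) fun t ht => hB n t ht.2
    refine this.trans (le_of_eq (by ring))
  have hramp : Tendsto (fun j : ℕ => ∫ p, χ p * ramp j p.2 ∂μ) atTop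
      (𝓝 (∫ p, χ p * pos p ∂μ)) := by
    refine tendsto_integral_of_dominated_convergence (fun p => |χ p|) (fun j => ?_) ?_
      (fun j => ae_of_all _ fun p => ?_) (ae_of_all _ fun p => ?_)
    · exact (hχc.mul ((continuous_ramp j).comp continuous_snd)).aestronglyMeasurable
    · exact (hχc.integrable_of_hasCompactSupport hχs).abs
    · rw [norm_mul, Real.norm_eq_abs, Real.norm_eq_abs, abs_of_nonneg (ramp_nonneg _ _)]
      exact mul_le_of_le_one_right (abs_nonneg _) (ramp_le_one _ _)
    · refine tendsto_const_nhds.congr' ?_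
      rcases le_or_gt 0 p.2 with h | h
      · exact Eventually.of_forall fun j => by
          show χ p * pos p = χ p * ramp j p.2
          rw [hpos1 p h, ramp_of_nonneg j h]
      · have h1 := tendsto_one_div_add_atTop_nhds_zero_nat (𝕜 := ℝ)
        filter_upwards [h1.eventually (ge_mem_nhds (show 0 < -p.2 by linarith))] with j hj
        show χ p * pos p = χ p * ramp j p.2
        rw [hpos0 p h, ramp_of_le j (by linarith)]
  have hz : Tendsto (fun j : ℕ => A * B * (1 / ((j : ℝ) + 1))) atTop (𝓝 0) := by
    have := (tendsto_one_div_add_atTop_nhds_zero_nat (𝕜 := ℝ)).const_mul (A * B)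
    rwa [mul_zero] at this
  have h1 := le_of_tendsto_of_tendsto (tendsto_const_nhds.sub hramp).abs hz
    (Eventually.of_forall hbound)
  exact sub_eq_zero.1 (abs_nonpos_iff.1 h1)

end Invariance

end SFT

end

theorem theorem1p1 {k : ℕ} (hk : 2 ≤ k) (M : Matrix (Fin k) (Fin k) ℕ)
    (hM : SFT.IsTransitionMatrix M)
    (ψ : SFT.OneSided M → ℝ) (hψ : SFT.IsHolderPlus ψ) (hψ1 : SFT.IsNormalized ψ)
    (ν : Measure (SFT.TwoSided M)) (hν : SFT.IsGibbs ψ ν)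
    (f : SFT.TwoSided M → ℝ) (hf : SFT.IsHolder f) (hf0 : ∫ x, f x ∂ν = 0)
    (hfc : ¬ SFT.IsCoboundary f) :
    ∃ μ : Measure (SFT.TwoSided M × ℝ),
      SFT.IsHarmonicMeasure ν f μ ∧
      (∀ μ' : Measure (SFT.TwoSided M × ℝ), SFT.IsHarmonicMeasure ν f μ' → μ' = μ) ∧
      ∀ φ : SFT.TwoSided M × ℝ → ℝ, Continuous φ → HasCompactSupport φ →
        ∫ p, φ p ∂μ =
          ∫ p : SFT.TwoSided M × ℝ,
            φ ((SFT.shift M).symm p.1, p.2 - f ((SFT.shift M).symm p.1)) *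
              {q : SFT.TwoSided M × ℝ | 0 ≤ q.2}.indicator (fun _ => (1 : ℝ)) p ∂μ := by
  obtain ⟨μ, hμ, hlim⟩ := SFT.exists_regular_measure hM hψ hψ1 hν hf hf0 hfc
  have hharm : SFT.IsHarmonicMeasure ν f μ := ⟨hμ, fun φ hφ hφs => by
    simpa only [SFT.weight, SFT.survival, mul_assoc] using hlim φ hφ hφs⟩
  refine ⟨μ, hharm, fun μ' hμ' => ?_, fun φ hφ hφs =>
    SFT.integral_eq_of_tendsto hM hψ hψ1 hν hf hf0 hfc hμ hlim hφ hφs⟩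
  have := hμ'.1
  exact Measure.ext_of_integral_eq_on_compactlySupported fun φ =>
    tendsto_nhds_unique (hμ'.2 φ φ.continuous φ.hasCompactSupport)
      (hharm.2 φ φ.continuous φ.hasCompactSupport)
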